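/- **Setting.** Let $n_u,N\ge 1$ and consider $$\min_{x,u}\ \sum_{k=0}^{N-1} g_k(x_k,u_k)+g_N(x_N)\quad\text{s.t.}\quad x_{k+1}=f_k(x_k,u_k)\ (0\le k<N),\qquad x_0=\bar x_0,$$ with $x_k\in\mathbb R^{n_x}$, $u_k\in\mathbb R^{n_u}$. Write $z_k=(x_k;u_k)$ for $k<N$, $z_N=x_N$, $z=(z_0;\dots;z_N)$, $\lambda=(\lambda_0;\dots;\lambda_N)$, $g(z)$ for the objective, $f(z)=(x_0-\bar x_0;\,x_1-f_0(z_0);\dots;x_N-f_{N-1}(z_{N-1}))$, $\mathcal L(z,\lambda)=g(z)+\lambda^Tf(z)$, $G=\nabla_z^Tf$, $H=\nabla_z^2\mathcal L=\operatorname{diag}(H_0,\dots,H_N)$, $A_k=\nabla_{x_k}^Tf_k$, $B_k=\nabla_{u_k}^Tf_k$, and for $\eta=(\eta_1,\eta_2)$ with $\eta_1,\eta_2>0$ $$\mathcal L_\eta=\mathcal L+\tfrac{\eta_1}{2}\|\nabla_\lambda\mathcal L\|^2+\tfrac{\eta_2}{2}\|\nabla_z\mathcal L\|^2 .$$ A superscript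 $\tau$ denotes evaluation at the iterate $(z^\tau,\lambda^\tau)$. For each $\tau$ let $\hat H^\tau=\operatorname{diag}(\hat H_0^\tau,\dots,\hat H_N^\tau)$ be a symmetric block diagonal modified Hessian with $k$-th block $\hat H_k^\tau=\begin{pmatrix}\hat Q_k&\hat S_k^T\\ \hat S_k&\hat R_k\end{pmatrix}$ for $k<N$ and $\hat H_N^\tau=\hat Q_N$. The Newton direction $(\Delta z^\tau,\Delta\lambda^\tau)$ solves $$\begin{pmatrix}\hat H^\tau&(G^\tau)^T\\G^\tau&0\end{pmatrix}\begin{pmatrix}\Delta z^\tau\\\Delta\lambda^\tau\end{pmatrix}=-\nabla\mathcal L^\tau .$$ With search directions $(\tilde\Delta z^\tau,\tilde\Delta\lambda^\tau)$, the iterates are $(z^{\tau+1},\lambda^{\tau+1})=(z^\tau,\lambda^\tau)+\alpha_\tau(\tilde\Delta z^\tau,\tilde\Delta\lambda^\tau)$, where $\alpha_\tau$ is found by backtracking: for a fixed $\theta\in(0,1)$ it is the first of $1,\theta,\theta^2,\dots$ that satisfies, with a fixed $\beta\in(0,1/2)$, $$\mathcal L_\eta^{\tau+1}\le\mathcal L_\eta^\tau+\beta\alpha_\tau(\nabla\mathcal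 L_\eta^\tau)^T(\tilde\Delta z^\tau;\tilde\Delta\lambda^\tau).$$ **Assumptions** (constants $\gamma_{RH}>0$, $0<\gamma_C\le1$, $\Upsilon_{upper}\ge2$, integer $t\ge1$, independent of $\tau$): 1. $v^T\hat H^\tau v\ge\gamma_{RH}\|v\|^2$ for all $\tau$ and all $v$ with $G^\tau v=0$. 2. For all $\tau$ and all $0\le k\le N-t$ there is $s\in[1,t]$ with $\Xi\Xi^T\succeq\gamma_CI$, where $\Xi=(B_{k+s-1}\ \ A_{k+s-1}B_{k+s-2}\ \cdots\ A_{k+s-1}\cdots A_{k+1}B_k)$ at $z^\tau$. 3. $\|\hat H_k^\tau\|,\|A_k^\tau\|,\|B_k^\tau\|\le\Upsilon_{upper}$ for all $\tau,k$. 4. All $g_k,f_k$ are $C^3$, and there is a compact set $\mathcal Z\times\Lambda=\prod_{k=0}^N\mathcal Z_k\times\prod_{k=0}^N\Lambda_k$ that contains $(z^\tau+\alpha\tilde\Delta z^\tau,\lambda^\tau+\alpha\tilde\Delta\lambda^\tau)$ for all $\tau\ge0$, $\alpha\in[0,1]$, and on which $\|H_k(z_k,\lambda_{k+1})\|$ ($k<N$),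 $\|H_N(z_N)\|$, $\|A_k(z_k)\|$ and $\|B_k(z_k)\|$ are at most $\Upsilon_{upper}$. Put $$\gamma_G=\Bigl(\tfrac{\gamma_C}{\gamma_C+\Upsilon_{upper}^{t+1}/(\Upsilon_{upper}-1)}\Bigr)^2\frac{\min\{1,\gamma_C\}}{(1+\Upsilon_{upper})^{2t}},\qquad \bar\mu=\frac{32\,\Upsilon_{upper}^{4t+1}}{\gamma_C}.$$ Under Assumptions 1–4 there are constants $\Upsilon_{HG}>0$ bounding $\|H\|$ on $\mathcal Z\times\Lambda$ and $\|G\|$ on $\mathcal Z$, and $\Upsilon_{KKT}>0$ bounding, for all $\tau$, the norm of the inverse of the matrix of the Newton system (which is invertible). Fix any such constants and put $\Upsilon=\max\{\Upsilon_{upper},\Upsilon_{KKT},\Upsilon_{HG}\}$. **FOTD directions.** Let $0=n_0<n_1<\dots<n_M=N$ be knots, $b\ge1$ an integer, $\mu>0$, $m_1^i=\max\{n_i-b,0\}$, $m_2^i=\min\{n_{i+1}+b,N\}$ for $0\le i<M$. With $m_1=m_1^i$, $m_2=m_2^i$, subproblem $i$ at iteration $\tau$ is $$\min_{p,q}\ \sum_{k=m_1}^{m_2-1}\Bigl\{\tfrac12\tbinom{p_k}{q_k}^T\hat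 H_k^\tau\tbinom{p_k}{q_k}+(\nabla_{z_k}\mathcal L^\tau)^T\tbinom{p_k}{q_k}\Bigr\}+\tfrac12p_{m_2}^T\hat Q_{m_2}p_{m_2}+(\nabla_{x_{m_2}}\mathcal L^\tau)^Tp_{m_2}+\tfrac{\mu'}2\|p_{m_2}\|^2$$ $$\text{s.t. } p_{k+1}=A_kp_k+B_kq_k-\nabla_{\lambda_{k+1}}\mathcal L^\tau\ (m_1\le k<m_2),\qquad p_{m_1}=0,$$ where $\mu'=\mu$ if $m_2<N$ and $\mu'=0$ if $m_2=N$. The FOTD direction $(\tilde\Delta z^\tau,\tilde\Delta\lambda^\tau)$ takes its stages $k\in[n_i,n_{i+1})$ from the primal-dual solution of subproblem $i$, and its stage $N$ from subproblem $M-1$. The FOTD iterates are the iterates above with these directions, started with $x_0^0=\bar x_0$. **Theorem (global convergence).** (i) Suppose that Assumptions 1–4 hold, that for some $\delta\in(0,1)$ $$\|(\tilde\Delta z^\tau-\Delta z^\tau,\tilde\Delta\lambda^\tau-\Delta\lambda^\tau)\|\le\delta\,\|(\Delta z^\tau,\Delta\lambda^\tau)\|\quad\text{for all }\tau,$$ and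 that $$\eta_1\ge\frac{17}{\eta_2\gamma_G},\qquad\eta_2\le\frac{\gamma_{RH}}{12\Upsilon^2},\qquad\delta\le\frac{\eta_2\gamma_G}{9\eta_1\Upsilon^2}.$$ Then the backtracking line search always terminates, and $\|\nabla\mathcal L^\tau\|\to0$ as $\tau\to\infty$. (ii) Let $\mu\ge\bar\mu$. There are constants $C>0$ and $\rho\in(0,1)$, depending only on $\mu,\gamma_{RH},\gamma_C,t,\Upsilon_{upper}$, such that for all FOTD iterates that satisfy Assumptions 1–3 (with $g_k,f_k$ of class $C^2$) $$\|(\tilde\Delta z^\tau-\Delta z^\tau,\tilde\Delta\lambda^\tau-\Delta\lambda^\tau)\|\le C\rho^b\,\|(\Delta z^\tau,\Delta\lambda^\tau)\|\quad\text{for all }\tau,$$ and, if in addition Assumption 4, the first two of the three conditions on $(\eta_1,\eta_2)$ in (i) and $$b\ge\frac{\log\bigl(9C\eta_1\Upsilon^2/(\eta_2\gamma_G)\bigr)}{\log(1/\rho)}$$ hold, then the line search always terminates and $\|\nabla\mathcal L^\tau\|\to0$ as $\tau\to\infty$. -/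

import Mathlib

open Filter Topology
open scoped InnerProductSpace

noncomputable section

namespace FOTD

/-- `ℝⁿ` with the Euclidean norm. -/
abbrev E (n : ℕ) : Type := EuclideanSpace ℝ (Fin n)

/-- The space of stage variables `z_k = (x_k; u_k)`, `k < N`, with the Euclidean norm. -/
abbrev StageVar (nx nu : ℕ) : Type := WithLp 2 (E nx × E nu)

/-- The space of primal variables `z = (z_0; …; z_{N-1}; z_N)`, `z_N = x_N`, with the Euclidean
norm: `z.fst k` is `z_k = (x_k; u_k)` for `k < N` and `z.snd` is `x_N`. -/
abbrev Primal (nx nu N : ℕ) : Type :=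
  WithLp 2 (PiLp 2 (fun _ : Fin N => StageVar nx nu) × E nx)

/-- The space of dual variables `λ = (λ_0; …; λ_N)`, with the Euclidean norm. -/
abbrev Dual (nx N : ℕ) : Type := PiLp 2 (fun _ : Fin (N + 1) => E nx)

/-- The space of pairs `(z, λ)`, with the Euclidean norm. -/
abbrev PrimalDual (nx nu N : ℕ) : Type := WithLp 2 (Primal nx nu N × Dual nx N)

/-- The data of the nonlinear dynamic program
`min ∑_{k<N} g_k(x_k,u_k) + g_N(x_N)` subject to `x_{k+1} = f_k(x_k,u_k)`, `x_0 = xbar0`. -/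
structure Problem (nx nu N : ℕ) where
  /-- stage costs -/
  g : Fin N → StageVar nx nu → ℝ
  /-- terminal cost -/
  gN : E nx → ℝ
  /-- dynamics -/
  f : Fin N → StageVar nx nu → E nx
  /-- initial state -/
  xbar0 : E nx

variable {nx nu N : ℕ}

/-- All cost and dynamics functions are `r` times continuously differentiable. -/
def Problem.IsContDiff (P : Problem nx nu N) (r : ℕ) : Prop :=
  (∀ k, ContDiff ℝ r (P.g k)) ∧ ContDiff ℝ r P.gN ∧ (∀ k, ContDiff ℝ r (P.f k))

/-- The state `x_k`, `k = 0, …, N`, of a primal vector. -/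
def state (z : Primal nx nu N) (k : Fin (N + 1)) : E nx :=
  Fin.lastCases (motive := fun _ => E nx) z.snd (fun j => (z.fst j).fst) k

/-- The objective `g(z)`. -/
def Problem.cost (P : Problem nx nu N) (z : Primal nx nu N) : ℝ :=
  ∑ k : Fin N, P.g k (z.fst k) + P.gN z.snd

/-- The constraint function `f(z) = (x_0 - xbar0; x_1 - f_0(z_0); …; x_N - f_{N-1}(z_{N-1}))`. -/
def Problem.constr (P : Problem nx nu N) (z : Primal nx nu N) : Dual nx N :=
  WithLp.toLp 2 (Fin.cases (motive := fun _ => E nx) (state z 0 - P.xbar0)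
    (fun k => state z k.succ - P.f k (z.fst k)))

/-- The Lagrangian `g(z) + λᵀ f(z)`. -/
def Problem.lagrangian (P : Problem nx nu N) (z : Primal nx nu N) (lam : Dual nx N) : ℝ :=
  P.cost z + ⟪lam, P.constr z⟫_ℝ

/-- `∇_z L(z, λ)`. -/
def Problem.gradZ (P : Problem nx nu N) (z : Primal nx nu N) (lam : Dual nx N) :
    Primal nx nu N :=
  gradient (fun z' => P.lagrangian z' lam) z

/-- `∇_λ L(z, λ)`. -/
def Problem.gradLam (P : Problem nx nu N) (z : Primal nx nu N) (lam : Dual nx N) : Dual nx N :=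
  gradient (fun lam' => P.lagrangian z lam') lam

/-- The KKT residual `∇L = (∇_z L; ∇_λ L)`. -/
def Problem.gradL (P : Problem nx nu N) (w : PrimalDual nx nu N) : PrimalDual nx nu N :=
  WithLp.toLp 2 (P.gradZ w.fst w.snd, P.gradLam w.fst w.snd)

/-- The Jacobian `G(z)` of the constraint function. -/
def Problem.jac (P : Problem nx nu N) (z : Primal nx nu N) :
    Primal nx nu N →L[ℝ] Dual nx N :=
  fderiv ℝ P.constr z

/-- The Hessian `H(z, λ) = ∇²_z L(z, λ)`. -/
def Problem.hess (P : Problem nx nu N) (z : Primal nx nu N) (lam : Dual nx N) :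
    Primal nx nu N →L[ℝ] Primal nx nu N :=
  fderiv ℝ (fun z' => P.gradZ z' lam) z

/-- The Jacobian `A_k` of `f_k` in the state. -/
def Problem.A (P : Problem nx nu N) (k : Fin N) (v : StageVar nx nu) : E nx →L[ℝ] E nx :=
  fderiv ℝ (fun x : E nx => P.f k (WithLp.toLp 2 (x, v.snd))) v.fst

/-- The Jacobian `B_k` of `f_k` in the control. -/
def Problem.B (P : Problem nx nu N) (k : Fin N) (v : StageVar nx nu) : E nu →L[ℝ] E nx :=
  fderiv ℝ (fun u : E nu => P.f k (WithLp.toLp 2 (v.fst, u))) v.snd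

/-- The diagonal block `H_k(z_k, λ_{k+1}) = ∇²_{z_k} L`, `k < N`; the remaining terms of the
Lagrangian are affine in `z_k` or do not contain it. -/
def Problem.stageHess (P : Problem nx nu N) (k : Fin N) (v : StageVar nx nu) (l : E nx) :
    StageVar nx nu →L[ℝ] StageVar nx nu :=
  fderiv ℝ (gradient (fun v' => P.g k v' - ⟪l, P.f k v'⟫_ℝ)) v

/-- The last diagonal block `H_N(z_N) = ∇²_{x_N} L`. -/
def Problem.termHess (P : Problem nx nu N) (x : E nx) : E nx →L[ℝ] E nx :=
  fderiv ℝ (gradient P.gN) x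

/-- The exact augmented Lagrangian
`L_η(z, λ) = L + (η₁/2) ‖∇_λ L‖² + (η₂/2) ‖∇_z L‖²`. -/
def Problem.augL (P : Problem nx nu N) (eta1 eta2 : ℝ) (w : PrimalDual nx nu N) : ℝ :=
  P.lagrangian w.fst w.snd + eta1 / 2 * ‖P.gradLam w.fst w.snd‖ ^ 2
    + eta2 / 2 * ‖P.gradZ w.fst w.snd‖ ^ 2

/-- A block diagonal modified Hessian `diag(Ĥ_0, …, Ĥ_N)`, given by its blocks. -/
structure BlockHess (nx nu N : ℕ) where
  /-- the blocks `Ĥ_k`, `k < N` -/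
  stage : Fin N → StageVar nx nu →L[ℝ] StageVar nx nu
  /-- the last block `Ĥ_N` -/
  term : E nx →L[ℝ] E nx

/-- All blocks are symmetric. -/
def BlockHess.IsSymm (K : BlockHess nx nu N) : Prop :=
  (∀ k, IsSelfAdjoint (K.stage k)) ∧ IsSelfAdjoint K.term

/-- The block diagonal operator `Ĥ`. -/
def BlockHess.toCLM (K : BlockHess nx nu N) : Primal nx nu N →L[ℝ] Primal nx nu N :=
  ((WithLp.prodContinuousLinearEquiv 2 ℝ
      (PiLp 2 (fun _ : Fin N => StageVar nx nu)) (E nx)).symm : _ →L[ℝ] Primal nx nu N).comp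
    (((((PiLp.continuousLinearEquiv 2 ℝ (fun _ : Fin N => StageVar nx nu)).symm :
        _ →L[ℝ] PiLp 2 (fun _ : Fin N => StageVar nx nu)).comp
        (ContinuousLinearMap.pi fun k => (K.stage k).comp
          (PiLp.proj 2 (fun _ : Fin N => StageVar nx nu) k))).prodMap K.term).comp
      (WithLp.prodContinuousLinearEquiv 2 ℝ
        (PiLp 2 (fun _ : Fin N => StageVar nx nu)) (E nx) : Primal nx nu N →L[ℝ] _))

/-- `Ĥ z = (Ĥ_0 z_0; …; Ĥ_N z_N)`. -/
theorem BlockHess.toCLM_apply (K : BlockHess nx nu N) (z : Primal nx nu N) :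
    K.toCLM z = WithLp.toLp 2 (WithLp.toLp 2 (fun k => K.stage k (z.fst k)), K.term z.snd) :=
  rfl

/-- The KKT matrix with rows `(Ĥ, Gᵀ)` and `(G, 0)` at `z`. -/
def Problem.kkt (P : Problem nx nu N) (K : BlockHess nx nu N) (z : Primal nx nu N) :
    PrimalDual nx nu N →L[ℝ] PrimalDual nx nu N :=
  ((WithLp.prodContinuousLinearEquiv 2 ℝ (Primal nx nu N) (Dual nx N)).symm :
      _ →L[ℝ] PrimalDual nx nu N).comp
    ((((K.toCLM.comp (ContinuousLinearMap.fst ℝ (Primal nx nu N) (Dual nx N)))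
        + ((P.jac z).adjoint.comp (ContinuousLinearMap.snd ℝ (Primal nx nu N) (Dual nx N)))).prod
        ((P.jac z).comp (ContinuousLinearMap.fst ℝ (Primal nx nu N) (Dual nx N)))).comp
      (WithLp.prodContinuousLinearEquiv 2 ℝ (Primal nx nu N) (Dual nx N) :
        PrimalDual nx nu N →L[ℝ] _))

/-- The KKT matrix maps `(v, l)` to `(Ĥ v + Gᵀ l, G v)`. -/
theorem Problem.kkt_apply (P : Problem nx nu N) (K : BlockHess nx nu N) (z : Primal nx nu N)
    (v : PrimalDual nx nu N) :
    P.kkt K z v = WithLp.toLp 2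
      (K.toCLM v.fst + (P.jac z).adjoint v.snd, P.jac z v.fst) :=
  rfl

/-- `d = (Δz, Δλ)` is the Newton direction at `w = (z, λ)`. -/
def Problem.IsNewtonDir (P : Problem nx nu N) (K : BlockHess nx nu N)
    (w d : PrimalDual nx nu N) : Prop :=
  P.kkt K w.fst d = - P.gradL w

/-! ### Line search -/

/-- The Armijo condition for the step `a` along `d` at `w`. -/
def Problem.Armijo (P : Problem nx nu N) (eta1 eta2 beta : ℝ)
    (w d : PrimalDual nx nu N) (a : ℝ) : Prop :=
  P.augL eta1 eta2 (w + a • d) ≤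
    P.augL eta1 eta2 w + beta * a * ⟪gradient (P.augL eta1 eta2) w, d⟫_ℝ

/-- Backtracking over the trial steps `1, θ, θ², …` accepts `θ ^ j`: it is the first trial step
that satisfies the Armijo condition. -/
def Problem.Accepts (P : Problem nx nu N) (eta1 eta2 beta theta : ℝ)
    (w d : PrimalDual nx nu N) (j : ℕ) : Prop :=
  P.Armijo eta1 eta2 beta w d (theta ^ j) ∧ ∀ i < j, ¬ P.Armijo eta1 eta2 beta w d (theta ^ i)

/-- `w` is a sequence of iterates along the directions `d` with steps `α` found by backtracking.
That backtracking accepts a step is not demanded here: if at some iteration it accepted none,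
the step of that iteration would be arbitrary. -/
def Problem.IsRun (P : Problem nx nu N) (eta1 eta2 beta theta : ℝ)
    (w d : ℕ → PrimalDual nx nu N) (α : ℕ → ℝ) : Prop :=
  ∀ τ, w (τ + 1) = w τ + α τ • d τ ∧
    ∀ j, P.Accepts eta1 eta2 beta theta (w τ) (d τ) j → α τ = theta ^ j

/-! ### Assumptions on the iterates -/

/-- Lower bound on the reduced Hessian: `ZᵀĤZ ⪰ γ I` for matrices `Z` whose columns are an
orthonormal basis of the null space of `G`, that is, `vᵀĤv ≥ γ‖v‖²` on this null space. -/
def Problem.ReducedHessianBound (P : Problem nx nu N) (gamRH : ℝ)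
    (w : ℕ → PrimalDual nx nu N) (K : ℕ → BlockHess nx nu N) : Prop :=
  ∀ τ, ∀ v : Primal nx nu N, P.jac (w τ).fst v = 0 →
    gamRH * ‖v‖ ^ 2 ≤ ⟪v, (K τ).toCLM v⟫_ℝ

/-- `A_k` at the `k`-th stage of `z` (zero for `k ≥ N`, a case that is never used). -/
def Problem.Aat (P : Problem nx nu N) (z : Primal nx nu N) (k : ℕ) : E nx →L[ℝ] E nx :=
  if h : k < N then P.A ⟨k, h⟩ (z.fst ⟨k, h⟩) else 0

/-- `B_k` at the `k`-th stage of `z` (zero for `k ≥ N`, a case that is never used). -/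
def Problem.Bat (P : Problem nx nu N) (z : Primal nx nu N) (k : ℕ) : E nu →L[ℝ] E nx :=
  if h : k < N then P.B ⟨k, h⟩ (z.fst ⟨k, h⟩) else 0

/-- The product `A_{k+n-1} ⋯ A_{k+1} A_k`. -/
def Problem.prodA (P : Problem nx nu N) (z : Primal nx nu N) (k : ℕ) :
    ℕ → E nx →L[ℝ] E nx
  | 0 => ContinuousLinearMap.id ℝ (E nx)
  | n + 1 => (P.Aat z (k + n)).comp (Problem.prodA P z k n)

/-- The controllability matrix
`Ξ_{k,s} = (B_{k+s-1}  A_{k+s-1}B_{k+s-2}  …  A_{k+s-1}⋯A_{k+1}B_k)`. -/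
def Problem.ctrl (P : Problem nx nu N) (z : Primal nx nu N) (k s : ℕ) :
    PiLp 2 (fun _ : Fin s => E nu) →L[ℝ] E nx :=
  ∑ j : Fin s, ((P.prodA z (k + s - j) j).comp (P.Bat z (k + s - 1 - j))).comp
    (PiLp.proj 2 (fun _ : Fin s => E nu) j)

/-- Controllability: for all `τ` and all `0 ≤ k ≤ N - t` there is `s ∈ [1, t]` with
`Ξ_{k,s} Ξ_{k,s}ᵀ ⪰ γ_C I`. -/
def Problem.Controllable (P : Problem nx nu N) (gamC : ℝ) (t : ℕ)
    (w : ℕ → PrimalDual nx nu N) : Prop :=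
  ∀ τ k, k + t ≤ N → ∃ s, 1 ≤ s ∧ s ≤ t ∧
    ∀ v : E nx, gamC * ‖v‖ ^ 2 ≤
      ⟪v, (P.ctrl (w τ).fst k s).comp (P.ctrl (w τ).fst k s).adjoint v⟫_ℝ

/-- Upper boundedness of the blocks `Ĥ_k`, `A_k`, `B_k` along the iterates. -/
def Problem.UpperBounded (P : Problem nx nu N) (ups : ℝ)
    (w : ℕ → PrimalDual nx nu N) (K : ℕ → BlockHess nx nu N) : Prop :=
  ∀ τ, (∀ k, ‖(K τ).stage k‖ ≤ ups ∧ ‖P.A k ((w τ).fst.fst k)‖ ≤ ups ∧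
      ‖P.B k ((w τ).fst.fst k)‖ ≤ ups) ∧ ‖(K τ).term‖ ≤ ups

/-- A product set `(Z_0 × ⋯ × Z_N) × (Λ_0 × ⋯ × Λ_N)`, given by its factors. -/
structure ProdSet (nx nu N : ℕ) where
  /-- the factors `Z_k`, `k < N` -/
  Z : Fin N → Set (StageVar nx nu)
  /-- the factor `Z_N` -/
  ZN : Set (E nx)
  /-- the factors `Λ_k`, `k ≤ N` -/
  L : Fin (N + 1) → Set (E nx)

/-- The set `Z = Z_0 × ⋯ × Z_N`. -/
def ProdSet.primal (S : ProdSet nx nu N) : Set (Primal nx nu N) :=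
  {z | (∀ k, z.fst k ∈ S.Z k) ∧ z.snd ∈ S.ZN}

/-- The set `Λ = Λ_0 × ⋯ × Λ_N`. -/
def ProdSet.dual (S : ProdSet nx nu N) : Set (Dual nx N) := {lam | ∀ k, lam k ∈ S.L k}

/-- Compactness: the functions are three times continuously differentiable, the segments between
iterates and full steps stay in the compact product set `S`, and the blocks `H_k`, `A_k`, `B_k`
are bounded on it. -/
def Problem.Compactness (P : Problem nx nu N) (ups : ℝ) (S : ProdSet nx nu N)
    (w d : ℕ → PrimalDual nx nu N) : Prop :=
  P.IsContDiff 3 ∧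
  (∀ k, IsCompact (S.Z k)) ∧ IsCompact S.ZN ∧ (∀ k, IsCompact (S.L k)) ∧
  (∀ τ, ∀ a ∈ Set.Icc (0 : ℝ) 1,
    (w τ + a • d τ).fst ∈ S.primal ∧ (w τ + a • d τ).snd ∈ S.dual) ∧
  (∀ k, ∀ v ∈ S.Z k, (∀ l ∈ S.L k.succ, ‖P.stageHess k v l‖ ≤ ups) ∧
    ‖P.A k v‖ ≤ ups ∧ ‖P.B k v‖ ≤ ups) ∧
  (∀ x ∈ S.ZN, ‖P.termHess x‖ ≤ ups)

/-! ### Constants -/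

/-- `γ_G = (γ_C / (γ_C + Υ^{t+1}/(Υ-1)))² min{1, γ_C} / (1+Υ)^{2t}` with `Υ = Υ_upper`. -/
def gammaG (gamC : ℝ) (t : ℕ) (ups : ℝ) : ℝ :=
  (gamC / (gamC + ups ^ (t + 1) / (ups - 1))) ^ 2 * (min 1 gamC / (1 + ups) ^ (2 * t))

/-- `μ̄ = 32 Υ^{4t+1} / γ_C` with `Υ = Υ_upper`. -/
def muBar (gamC : ℝ) (t : ℕ) (ups : ℝ) : ℝ := 32 * ups ^ (4 * t + 1) / gamC

/-- `c` is an upper bound for `‖H‖` on `Z × Λ` and for `‖G‖` on `Z`. -/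
def Problem.IsUpsHG (P : Problem nx nu N) (S : ProdSet nx nu N) (c : ℝ) : Prop :=
  0 < c ∧ (∀ z ∈ S.primal, ∀ lam ∈ S.dual, ‖P.hess z lam‖ ≤ c) ∧
    ∀ z ∈ S.primal, ‖P.jac z‖ ≤ c

/-- The KKT matrices along the iterates are invertible, and `c` is an upper bound for the norms of
their inverses. -/
def Problem.IsUpsKKT (P : Problem nx nu N) (w : ℕ → PrimalDual nx nu N)
    (K : ℕ → BlockHess nx nu N) (c : ℝ) : Prop :=
  0 < c ∧ ∀ τ, IsUnit (P.kkt (K τ) (w τ).fst) ∧ ‖Ring.inverse (P.kkt (K τ) (w τ).fst)‖ ≤ c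

/-- The conditions `η₁ ≥ 17/(η₂ γ_G)` and `η₂ ≤ γ_RH/(12 Υ²)` on the penalty parameters. -/
def PenaltyCond (gamRH gamG ups eta1 eta2 : ℝ) : Prop :=
  17 / (eta2 * gamG) ≤ eta1 ∧ eta2 ≤ gamRH / (12 * ups ^ 2)

/-! ### Overlapping temporal decomposition -/

/-- The left end `m₁ = max{n_i - b, 0}` of the `i`-th extended interval. -/
def leftEnd {M : ℕ} (n : Fin (M + 1) → Fin (N + 1)) (b : ℕ) (i : Fin M) : Fin (N + 1) :=
  ⟨(n i.castSucc : ℕ) - b, lt_of_le_of_lt (Nat.sub_le _ _) (n i.castSucc).isLt⟩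

/-- The right end `m₂ = min{n_{i+1} + b, N}` of the `i`-th extended interval. -/
def rightEnd {M : ℕ} (n : Fin (M + 1) → Fin (N + 1)) (b : ℕ) (i : Fin M) : Fin (N + 1) :=
  ⟨min ((n i.succ : ℕ) + b) N, Nat.lt_succ_of_le (Nat.min_le_right _ _)⟩

/-- Boundary variables `d = (pbar_{m₁}; pbar_{m₂}; qbar_{m₂}; ζbar_{m₂+1})`; the last three are
used only when `m₂ < N`. -/
structure Boundary (nx nu : ℕ) where
  /-- initial state -/
  p1 : E nx
  /-- terminal state -/
  p2 : E nx
  /-- terminal control -/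
  q2 : E nu
  /-- terminal dual variable -/
  zeta : E nx

/-- The boundary variables `(0; 0; 0; 0)`. -/
def Boundary.zero (nx nu : ℕ) : Boundary nx nu := ⟨0, 0, 0, 0⟩

/-- Primal-dual variables `p_k, q_k, ζ_k` of a subproblem. They are indexed by all stages, but the
subproblem on `[m₁, m₂]` and the composition use only `p_k, ζ_k` with `m₁ ≤ k ≤ m₂` and `q_k`
with `m₁ ≤ k < m₂`. -/
structure SubVar (nx nu N : ℕ) where
  /-- states -/
  p : Fin (N + 1) → E nx
  /-- controls -/
  q : Fin N → E nu
  /-- dual variables -/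
  zeta : Fin (N + 1) → E nx

/-- The pair `(p_k; q_k)`. -/
def SubVar.pq (s : SubVar nx nu N) (k : Fin N) : StageVar nx nu :=
  WithLp.toLp 2 (s.p k.castSucc, s.q k)

/-- The constraints of the linear-quadratic subproblem on `[m₁, m₂]` at `w = (z, λ)`:
`p_{m₁} = pbar_{m₁}` and `p_{k+1} = A_k p_k + B_k q_k - ∇_{λ_{k+1}} L` for `m₁ ≤ k < m₂`. -/
def Problem.SubFeasible (P : Problem nx nu N) (w : PrimalDual nx nu N)
    (m1 m2 : Fin (N + 1)) (d : Boundary nx nu) (s : SubVar nx nu N) : Prop :=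
  s.p m1 = d.p1 ∧ ∀ k : Fin N, (m1 : ℕ) ≤ k → (k : ℕ) < m2 →
    s.p k.succ = P.A k (w.fst.fst k) (s.p k.castSucc) + P.B k (w.fst.fst k) (s.q k)
      - P.gradLam w.fst w.snd k.succ

/-- The terminal cost of the linear-quadratic subproblem. If the interval ends at `N`, it is the
terminal cost of the full linear-quadratic problem, without adjustment. -/
def Problem.subTerm (P : Problem nx nu N) (K : BlockHess nx nu N) (w : PrimalDual nx nu N)
    (mu : ℝ) (m2 : Fin (N + 1)) (d : Boundary nx nu) (p : E nx) : ℝ :=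
  if h : (m2 : ℕ) < N then
    1 / 2 * ⟪(WithLp.toLp 2 (p, d.q2) : StageVar nx nu),
        K.stage ⟨m2, h⟩ (WithLp.toLp 2 (p, d.q2))⟫_ℝ
      + ⟪p, ((P.gradZ w.fst w.snd).fst ⟨m2, h⟩).fst
          - (P.A ⟨m2, h⟩ (w.fst.fst ⟨m2, h⟩)).adjoint d.zeta⟫_ℝ
      + mu / 2 * ‖p - d.p2‖ ^ 2
  else 1 / 2 * ⟪p, K.term p⟫_ℝ + ⟪(P.gradZ w.fst w.snd).snd, p⟫_ℝ

/-- The objective of the linear-quadratic subproblem on `[m₁, m₂]`. -/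
def Problem.subObj (P : Problem nx nu N) (K : BlockHess nx nu N) (w : PrimalDual nx nu N)
    (mu : ℝ) (m1 m2 : Fin (N + 1)) (d : Boundary nx nu) (s : SubVar nx nu N) : ℝ :=
  (∑ k ∈ (Finset.univ : Finset (Fin N)).filter
      (fun k : Fin N => (m1 : ℕ) ≤ (k : ℕ) ∧ (k : ℕ) < (m2 : ℕ)),
    (1 / 2 * ⟪s.pq k, K.stage k (s.pq k)⟫_ℝ
      + ⟪(P.gradZ w.fst w.snd).fst k, s.pq k⟫_ℝ))
    + P.subTerm K w mu m2 d (s.p m2)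

/-- The gradient of the terminal cost of the linear-quadratic subproblem. -/
def Problem.subTermGrad (P : Problem nx nu N) (K : BlockHess nx nu N) (w : PrimalDual nx nu N)
    (mu : ℝ) (m2 : Fin (N + 1)) (d : Boundary nx nu) (p : E nx) : E nx :=
  gradient (P.subTerm K w mu m2 d) p

/-- Stationarity of the Lagrangian of the subproblem on `[m₁, m₂]` in `(p_k, q_k)`, `m₁ ≤ k < m₂`,
and in `p_{m₂}`; the dual variable `ζ_{m₁}` belongs to `p_{m₁} - pbar_{m₁} = 0` and `ζ_{k+1}` to
`p_{k+1} - A_k p_k - B_k q_k + ∇_{λ_{k+1}} L = 0`. -/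
def Problem.SubStationary (P : Problem nx nu N) (K : BlockHess nx nu N) (w : PrimalDual nx nu N)
    (mu : ℝ) (m1 m2 : Fin (N + 1)) (d : Boundary nx nu) (s : SubVar nx nu N) : Prop :=
  (∀ k : Fin N, (m1 : ℕ) ≤ k → (k : ℕ) < m2 →
    K.stage k (s.pq k) + (P.gradZ w.fst w.snd).fst k
      + WithLp.toLp 2 (s.zeta k.castSucc - (P.A k (w.fst.fst k)).adjoint (s.zeta k.succ),
          - (P.B k (w.fst.fst k)).adjoint (s.zeta k.succ)) = 0) ∧
  P.subTermGrad K w mu m2 d (s.p m2) + s.zeta m2 = 0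

/-- `s` is a primal-dual solution of the subproblem on `[m₁, m₂]`: its primal part is a global
minimizer, and its dual part is a Lagrange multiplier. -/
def Problem.IsSubSol (P : Problem nx nu N) (K : BlockHess nx nu N) (w : PrimalDual nx nu N)
    (mu : ℝ) (m1 m2 : Fin (N + 1)) (d : Boundary nx nu) (s : SubVar nx nu N) : Prop :=
  P.SubFeasible w m1 m2 d s ∧
  (∀ s' : SubVar nx nu N, P.SubFeasible w m1 m2 d s' →
    P.subObj K w mu m1 m2 d s ≤ P.subObj K w mu m1 m2 d s') ∧
  P.SubStationary K w mu m1 m2 d s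

/-- `d` is the composition of the subproblem variables `s_i`, `i < M`, along the knots `n`: on
`[n_i, n_{i+1})` it is taken from `s_i`, at stage `N` from `s_{M-1}`. -/
def IsComposition {M : ℕ} (n : Fin (M + 1) → Fin (N + 1)) (s : Fin M → SubVar nx nu N)
    (d : PrimalDual nx nu N) : Prop :=
  (∀ i : Fin M, ∀ k : Fin N, (n i.castSucc : ℕ) ≤ k → (k : ℕ) < n i.succ →
    d.fst.fst k = (s i).pq k ∧ d.snd k.castSucc = (s i).zeta k.castSucc) ∧
  (∀ i : Fin M, (i : ℕ) + 1 = M →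
    d.fst.snd = (s i).p (Fin.last N) ∧ d.snd (Fin.last N) = (s i).zeta (Fin.last N))

/-- `d` is the search direction that FOTD computes at `w`: the composition of solutions of the
subproblems on the extended intervals with zero boundary variables. -/
def Problem.IsFOTDDir (P : Problem nx nu N) (K : BlockHess nx nu N) (mu : ℝ) {M : ℕ}
    (n : Fin (M + 1) → Fin (N + 1)) (b : ℕ) (w d : PrimalDual nx nu N) : Prop :=
  ∃ s : Fin M → SubVar nx nu N,
    (∀ i, P.IsSubSol K w mu (leftEnd n b i) (rightEnd n b i) (Boundary.zero nx nu) (s i)) ∧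
    IsComposition n s d

/-- The knots `0 = n_0 < n_1 < ⋯ < n_M = N`. -/
def IsKnots {M : ℕ} (n : Fin (M + 1) → Fin (N + 1)) : Prop :=
  StrictMono n ∧ n 0 = 0 ∧ n (Fin.last M) = Fin.last N

end FOTD

end

open FOTD

/-!
Both parts rest on two facts about the saddle point matrix with rows `(Ĥ, Gᵀ)` and `(G, 0)`.

*Stability.* If `G Gᵀ ⪰ γ I` and `Ĥ` is positive definite on the kernel of `G`, then the matrix has
an inverse whose norm is bounded in terms of these constants only (`saddle_bound`). For the
constraints of a dynamic program, the components of `Gᵀ λ` are the residuals `λ_k - A_kᵀ λ_{k+1}` of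
the adjoint dynamics and the outputs `B_kᵀ λ_{k+1}`. Controllability means that the outputs along `t`
stages determine the adjoint state, which bounds each `λ_k` by `Gᵀ λ` on the next `t` stages; a
discrete Young inequality then gives `G Gᵀ ⪰ γ_G I` (`gammaG_mul_le_norm_adjoint`).

*Locality.* The matrix couples neighbouring stages only, so that its commutator with weights `ω^(d_k)`,
where `|d_{k+1} - d_k| ≤ 1`, is of size `ω - 1`. For `ω` close to one, stability carries over to
weighted norms (`norm_scale_le`).

*Accuracy of the decomposed direction.* A subproblem on `[m₁, m₂]` is regarded as a system on all
stages, with decoupled identity blocks outside the interval (`truncHess`). It is as stable as the full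
problem: a feasible direction of the truncated problem is continued beyond `m₂` by steering the state
to zero at a cost of order `‖x_{m₂}‖²`, and the penalty `μ ≥ μ̄` on `x_{m₂}` pays for this cost
(`trunc_coercive`, `trunc_stable`). The difference between the solution of the subproblem and the exact
Newton direction solves the truncated system with a residual at `m₁` and `m₂` only, and none at an end
of the horizon (`lqKKT_subError`); at stage zero this uses that the iterates keep the prescribed initial
state. Weights growing with the distance to `m₁` and `m₂` show that the error on `[n_i, n_{i+1})` is
smaller by the factor `ω^(-b)`. Summation of the squares over all subproblems gives a constant
independent of their number, since every stage is an inner end of a bounded number of subproblems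
(`norm_sub_newton_le`).

*Global convergence.* The exact Newton direction has slope at most
`-(η₂/2) ‖∇_z L‖² - (η₁/2) ‖∇_λ L‖²` for the exact augmented Lagrangian (`augDeriv_newton_le`), and
the conditions on `δ` leave at least half of this descent for the inexact direction
(`perturbation_ineq`). On the compact set the second derivative of the augmented Lagrangian is bounded,
hence all small steps are acceptable, the accepted steps are bounded below, and the sum of the
`‖∇L‖²` is finite because the augmented Lagrangian is bounded below
(`tendsto_of_sufficientDecrease`).
-/

noncomputable section

namespace FOTD

/-! ### Saddle point systems in Hilbert spaces -/

section Saddle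

variable {X Y : Type*} [NormedAddCommGroup X] [InnerProductSpace ℝ X] [CompleteSpace X]
  [NormedAddCommGroup Y] [InnerProductSpace ℝ Y] [CompleteSpace Y]
  [FiniteDimensional ℝ Y]

/-- If the adjoint of `T` is bounded below, every `y` is `T v` for some `v` of controlled norm,
namely `v = Tᵀ(T Tᵀ)⁻¹ y`. -/
theorem exists_preimage_of_adjoint_bound (T : X →L[ℝ] Y) {c : ℝ} (hc : 0 < c)
    (hT : ∀ l, c * ‖l‖ ^ 2 ≤ ‖T.adjoint l‖ ^ 2) (y : Y) :
    ∃ v, T v = y ∧ c * ‖v‖ ^ 2 ≤ ‖y‖ ^ 2 := by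
  have key : ∀ l, ⟪l, T (T.adjoint l)⟫_ℝ = ‖T.adjoint l‖ ^ 2 := fun l => by
    rw [← ContinuousLinearMap.adjoint_inner_left, real_inner_self_eq_norm_sq]
  have hinj : Function.Injective (T.comp T.adjoint : Y →ₗ[ℝ] Y) := by
    rw [injective_iff_map_eq_zero]
    intro l hl
    have h1 : T (T.adjoint l) = 0 := hl
    have h2 := hT l
    rw [← key l, h1, inner_zero_right] at h2
    have h3 : ‖l‖ ^ 2 ≤ 0 := by
      by_contra h
      push Not at h
      nlinarith
    exact norm_eq_zero.1 (pow_eq_zero_iff (two_ne_zero) |>.1 (le_antisymm h3 (sq_nonneg _)))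
  obtain ⟨l, hl⟩ := (LinearMap.injective_iff_surjective.1 hinj) y
  have hl' : T (T.adjoint l) = y := hl
  refine ⟨T.adjoint l, hl', ?_⟩
  have h1 : ‖T.adjoint l‖ ^ 2 ≤ ‖l‖ * ‖y‖ := by
    rw [← key l, hl']
    exact real_inner_le_norm l y
  have h2 := hT l
  set a := ‖T.adjoint l‖
  have ha : 0 ≤ a := norm_nonneg _
  rcases eq_or_lt_of_le (norm_nonneg l) with h0 | h0
  · rw [← h0, zero_mul] at h1
    nlinarith [sq_nonneg a, sq_nonneg ‖y‖]
  · have h3 : c * ‖l‖ ≤ ‖y‖ := by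
      have : ‖l‖ * (c * ‖l‖) ≤ ‖l‖ * ‖y‖ := by nlinarith
      exact le_of_mul_le_mul_left this h0
    nlinarith [norm_nonneg y]

/-- The bound for the inverse of a saddle point matrix with upper left block of norm at most `h`,
bounded below by `γ` on the kernel of `G`, where `‖Gᵀ l‖ ≥ ‖l‖ / c`. -/
def saddleConst (c γ h : ℝ) : ℝ :=
  ((1 + h * c) / γ + c) + c * (1 + h * ((1 + h * c) / γ + c))

theorem saddleConst_pos {c γ h : ℝ} (hc : 0 < c) (hγ : 0 < γ) (hh : 0 ≤ h) :
    0 < saddleConst c γ h := by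
  unfold saddleConst; positivity

/-- Stability of a saddle point system `H v + Gᵀ l = a`, `G v = b`. The part of `v` in the range of
`Gᵀ` is controlled by `b`, the part in the kernel of `G` by coercivity, and `l` by the lower bound
for `Gᵀ`. -/
theorem saddle_bound (G : X →L[ℝ] Y) (H : X →L[ℝ] X) {g γ h : ℝ} (hg : 0 < g) (hγ : 0 < γ)
    (hh : 0 ≤ h) (hG : ∀ l, g * ‖l‖ ^ 2 ≤ ‖G.adjoint l‖ ^ 2)
    (hH : ∀ v, G v = 0 → γ * ‖v‖ ^ 2 ≤ ⟪v, H v⟫_ℝ) (hn : ‖H‖ ≤ h) (v : X) (l : Y) {R : ℝ}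
    (ha : ‖H v + G.adjoint l‖ ≤ R) (hb : ‖G v‖ ≤ R) :
    ‖v‖ + ‖l‖ ≤ saddleConst (1 / √g) γ h * R := by
  have hsg : 0 < √g := Real.sqrt_pos.2 hg
  have hR : 0 ≤ R := (norm_nonneg _).trans hb
  set c := 1 / √g with hc
  have hcpos : 0 < c := by positivity
  have hcg : c ^ 2 * g = 1 := by
    rw [hc, div_pow, Real.sq_sqrt hg.le]; field_simp
  have hroot : ∀ x y : ℝ, 0 ≤ y → g * x ^ 2 ≤ y ^ 2 → x ≤ c * y := by
    intro x y hy hxy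
    apply le_of_sq_le_sq _ (by positivity)
    calc x ^ 2 = c ^ 2 * (g * x ^ 2) := by rw [← mul_assoc, hcg, one_mul]
      _ ≤ c ^ 2 * y ^ 2 := by gcongr
      _ = (c * y) ^ 2 := by ring
  obtain ⟨v2, hv2, hv2n⟩ := exists_preimage_of_adjoint_bound G hg hG (G v)
  have hv2' : ‖v2‖ ≤ c * R :=
    (hroot _ _ (norm_nonneg _) hv2n).trans (by gcongr)
  set v1 := v - v2 with hv1
  have hGv1 : G v1 = 0 := by rw [hv1, map_sub, hv2, sub_self]
  have hHle : ∀ x, ‖H x‖ ≤ h * ‖x‖ := fun x => H.le_of_opNorm_le hn x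
  have h1 : γ * ‖v1‖ ^ 2 ≤ ‖v1‖ * ((1 + h * c) * R) := by
    have hsplit : H v1 = (H v + G.adjoint l) - G.adjoint l - H v2 := by
      rw [hv1, map_sub]; abel
    calc γ * ‖v1‖ ^ 2 ≤ ⟪v1, H v1⟫_ℝ := hH v1 hGv1
      _ = ⟪v1, (H v + G.adjoint l) - H v2⟫_ℝ := by
          rw [hsplit, inner_sub_right, inner_sub_right, inner_sub_right,
            ContinuousLinearMap.adjoint_inner_right, hGv1, inner_zero_left]; ring
      _ ≤ ‖v1‖ * ‖(H v + G.adjoint l) - H v2‖ := real_inner_le_norm _ _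
      _ ≤ ‖v1‖ * ((1 + h * c) * R) := by
          gcongr
          calc ‖(H v + G.adjoint l) - H v2‖ ≤ ‖H v + G.adjoint l‖ + ‖H v2‖ := norm_sub_le _ _
            _ ≤ R + h * (c * R) := by gcongr; exact (hHle v2).trans (by gcongr)
            _ = (1 + h * c) * R := by ring
  have hv1n : ‖v1‖ ≤ (1 + h * c) / γ * R := by
    rw [div_mul_eq_mul_div, le_div_iff₀ hγ]
    rcases eq_or_lt_of_le (norm_nonneg v1) with h0 | h0
    · rw [← h0]; simp; positivity
    · refine le_of_mul_le_mul_left ?_ h0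
      linarith
  have hv : ‖v‖ ≤ ((1 + h * c) / γ + c) * R := by
    calc ‖v‖ = ‖v1 + v2‖ := by rw [hv1]; congr 1; abel
      _ ≤ ‖v1‖ + ‖v2‖ := norm_add_le _ _
      _ ≤ _ := by rw [add_mul]; gcongr
  have hl : ‖l‖ ≤ c * (1 + h * ((1 + h * c) / γ + c)) * R := by
    calc ‖l‖ ≤ c * ‖G.adjoint l‖ := hroot _ _ (norm_nonneg _) (hG l)
      _ = c * ‖(H v + G.adjoint l) - H v‖ := by congr 2; abel
      _ ≤ c * (R + h * (((1 + h * c) / γ + c) * R)) := by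
          gcongr
          exact (norm_sub_le _ _).trans (add_le_add ha ((hHle v).trans (by gcongr)))
      _ = _ := by ring
  unfold saddleConst
  rw [add_mul]
  exact add_le_add hv hl

end Saddle

variable {nx nu N : ℕ}

-- Instance search does not find these within its limits, since it tries to unfold the norms.
instance : ContinuousSMul ℝ (Primal nx nu N) := IsBoundedSMul.continuousSMul

instance : ContinuousSMul ℝ (Dual nx N) := IsBoundedSMul.continuousSMul

/-! ### Stagewise description of the constraint operator and its adjoint -/

@[simp] theorem state_castSucc (z : Primal nx nu N) (k : Fin N) :
    state z k.castSucc = (z.fst k).fst := by simp [state]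

@[simp] theorem state_last (z : Primal nx nu N) : state z (Fin.last N) = z.snd := by simp [state]

theorem state_add (z z' : Primal nx nu N) (k : Fin (N + 1)) :
    state (z + z') k = state z k + state z' k := by
  refine Fin.lastCases ?_ (fun j => ?_) k <;> simp

theorem state_smul (c : ℝ) (z : Primal nx nu N) (k : Fin (N + 1)) :
    state (c • z) k = c • state z k := by
  refine Fin.lastCases ?_ (fun j => ?_) k <;> simp

theorem stageVar_ext {v w : StageVar nx nu} (h1 : v.fst = w.fst) (h2 : v.snd = w.snd) : v = w := by
  apply WithLp.ofLp_injective
  exact Prod.ext h1 h2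

theorem primal_ext {z z' : Primal nx nu N} (h1 : ∀ k, z.fst k = z'.fst k) (h2 : z.snd = z'.snd) :
    z = z' := by
  apply WithLp.ofLp_injective
  exact Prod.ext (PiLp.ext h1) h2

theorem primalDual_ext {w w' : PrimalDual nx nu N} (h1 : w.fst = w'.fst) (h2 : w.snd = w'.snd) :
    w = w' := by
  apply WithLp.ofLp_injective
  exact Prod.ext h1 h2

theorem norm_sq_stageVar (v : StageVar nx nu) : ‖v‖ ^ 2 = ‖v.fst‖ ^ 2 + ‖v.snd‖ ^ 2 :=
  WithLp.prod_norm_sq_eq_of_L2 v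

theorem norm_sq_primal (z : Primal nx nu N) :
    ‖z‖ ^ 2 = ∑ k, ‖z.fst k‖ ^ 2 + ‖z.snd‖ ^ 2 := by
  rw [WithLp.prod_norm_sq_eq_of_L2, PiLp.norm_sq_eq_of_L2]

theorem norm_sq_dual (l : Dual nx N) : ‖l‖ ^ 2 = ∑ k, ‖l k‖ ^ 2 := PiLp.norm_sq_eq_of_L2 _ _

theorem norm_sq_primalDual (w : PrimalDual nx nu N) : ‖w‖ ^ 2 = ‖w.fst‖ ^ 2 + ‖w.snd‖ ^ 2 :=
  WithLp.prod_norm_sq_eq_of_L2 w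

theorem inner_stageVar (v w : StageVar nx nu) :
    ⟪v, w⟫_ℝ = ⟪v.fst, w.fst⟫_ℝ + ⟪v.snd, w.snd⟫_ℝ := WithLp.prod_inner_apply v w

theorem inner_primal (z z' : Primal nx nu N) :
    ⟪z, z'⟫_ℝ = ∑ k, ⟪z.fst k, z'.fst k⟫_ℝ + ⟪z.snd, z'.snd⟫_ℝ := by
  rw [WithLp.prod_inner_apply, PiLp.inner_apply]; rfl

/-- The projection of a primal vector to the stage variable `z_k`. -/
def stageProj (k : Fin N) : Primal nx nu N →L[ℝ] StageVar nx nu :=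
  (PiLp.proj 2 (fun _ : Fin N => StageVar nx nu) k).comp
    (WithLp.fstL 2 ℝ (PiLp 2 (fun _ : Fin N => StageVar nx nu)) (E nx))

theorem stageProj_apply (k : Fin N) (z : Primal nx nu N) : stageProj k z = z.fst k := rfl

/-- The projection of a primal vector to the state `x_k`. -/
def stateProj (k : Fin (N + 1)) : Primal nx nu N →L[ℝ] E nx :=
  Fin.lastCases (motive := fun _ => Primal nx nu N →L[ℝ] E nx)
    (WithLp.sndL 2 ℝ (PiLp 2 (fun _ : Fin N => StageVar nx nu)) (E nx))
    (fun j => (WithLp.fstL 2 ℝ (E nx) (E nu)).comp (stageProj j)) k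

theorem stateProj_apply (k : Fin (N + 1)) (z : Primal nx nu N) : stateProj k z = state z k := by
  refine Fin.lastCases ?_ (fun j => ?_) k
  · simp [stateProj]
  · simp [stateProj, stageProj_apply]

/-- The Jacobian of constraints with linearized dynamics `A`, `B`:
`z ↦ (x_0; x_1 - A_0 x_0 - B_0 u_0; …)`. -/
def dynOp (A : Fin N → E nx →L[ℝ] E nx) (B : Fin N → E nu →L[ℝ] E nx) :
    Primal nx nu N →L[ℝ] Dual nx N :=
  ((PiLp.continuousLinearEquiv 2 ℝ (fun _ : Fin (N + 1) => E nx)).symm :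
      _ →L[ℝ] Dual nx N).comp
    (ContinuousLinearMap.pi (Fin.cases (motive := fun _ => Primal nx nu N →L[ℝ] E nx)
      (stateProj 0) (fun k => stateProj k.succ
        - ((A k).comp (WithLp.fstL 2 ℝ (E nx) (E nu))
          + (B k).comp (WithLp.sndL 2 ℝ (E nx) (E nu))).comp (stageProj k))))

section DynOp

variable (A : Fin N → E nx →L[ℝ] E nx) (B : Fin N → E nu →L[ℝ] E nx)

@[simp] theorem dynOp_zero (z : Primal nx nu N) : dynOp A B z 0 = state z 0 :=
  stateProj_apply 0 z

@[simp] theorem dynOp_succ (z : Primal nx nu N) (k : Fin N) :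
    dynOp A B z k.succ = state z k.succ - (A k (z.fst k).fst + B k (z.fst k).snd) := by
  rw [← stateProj_apply]; rfl

theorem inner_dynOp (z : Primal nx nu N) (l : Dual nx N) :
    ⟪dynOp A B z, l⟫_ℝ = ⟪z, (WithLp.toLp 2 (WithLp.toLp 2 (fun k : Fin N =>
      (WithLp.toLp 2 (l k.castSucc - (A k).adjoint (l k.succ), -(B k).adjoint (l k.succ)) :
        StageVar nx nu)), l (Fin.last N)) : Primal nx nu N)⟫_ℝ := by
  have h1 : ∑ k : Fin (N + 1), ⟪state z k, l k⟫_ℝ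
      = ∑ k : Fin N, ⟪(z.fst k).fst, l k.castSucc⟫_ℝ + ⟪z.snd, l (Fin.last N)⟫_ℝ := by
    rw [Fin.sum_univ_castSucc]; simp
  have h2 : ⟪dynOp A B z, l⟫_ℝ = ∑ k : Fin (N + 1), ⟪state z k, l k⟫_ℝ
      - ∑ k : Fin N, (⟪A k (z.fst k).fst, l k.succ⟫_ℝ + ⟪B k (z.fst k).snd, l k.succ⟫_ℝ) := by
    rw [PiLp.inner_apply, Fin.sum_univ_succ, Fin.sum_univ_succ, add_sub_assoc,
      ← Finset.sum_sub_distrib]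
    simp only [dynOp_zero, dynOp_succ, inner_sub_left, inner_add_left]
  rw [h2, h1, inner_primal]
  simp only [inner_stageVar, WithLp.toLp_fst, WithLp.toLp_snd, inner_sub_right, inner_neg_right,
    ContinuousLinearMap.adjoint_inner_right, Finset.sum_add_distrib, Finset.sum_sub_distrib,
    Finset.sum_neg_distrib]
  ring

theorem dynOp_adjoint (l : Dual nx N) :
    (dynOp A B).adjoint l = WithLp.toLp 2 (WithLp.toLp 2 (fun k : Fin N =>
      (WithLp.toLp 2 (l k.castSucc - (A k).adjoint (l k.succ), -(B k).adjoint (l k.succ)) :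
        StageVar nx nu)), l (Fin.last N)) := by
  refine ext_inner_left ℝ fun z => ?_
  rw [ContinuousLinearMap.adjoint_inner_right, inner_dynOp]

theorem dynOp_adjoint_fst (l : Dual nx N) (k : Fin N) :
    ((dynOp A B).adjoint l).fst k = WithLp.toLp 2
      (l k.castSucc - (A k).adjoint (l k.succ), -(B k).adjoint (l k.succ)) := by
  rw [dynOp_adjoint]; rfl

theorem dynOp_adjoint_snd (l : Dual nx N) :
    ((dynOp A B).adjoint l).snd = l (Fin.last N) := by
  rw [dynOp_adjoint]; rfl

/-- The saddle point system of a linear-quadratic problem with Hessian blocks `K` and linearized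
dynamics `A`, `B`: `(v, l) ↦ (K v + Gᵀ l, G v)`. -/
def lqKKT (K : BlockHess nx nu N) (w : PrimalDual nx nu N) : PrimalDual nx nu N :=
  WithLp.toLp 2 (K.toCLM w.fst + (dynOp A B).adjoint w.snd, dynOp A B w.fst)

variable {A B}

theorem BlockHess.norm_toCLM_le (K : BlockHess nx nu N) {c : ℝ} (hc : 0 ≤ c)
    (h1 : ∀ k, ‖K.stage k‖ ≤ c) (h2 : ‖K.term‖ ≤ c) : ‖K.toCLM‖ ≤ c := by
  refine ContinuousLinearMap.opNorm_le_bound _ hc fun z => ?_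
  refine le_of_sq_le_sq ?_ (by positivity)
  rw [K.toCLM_apply, mul_pow, norm_sq_primal, norm_sq_primal, mul_add, Finset.mul_sum]
  refine add_le_add (Finset.sum_le_sum fun k _ => ?_) ?_
  · rw [← mul_pow]
    exact pow_le_pow_left₀ (norm_nonneg _) ((K.stage k).le_of_opNorm_le (h1 k) _) 2
  · rw [← mul_pow]
    exact pow_le_pow_left₀ (norm_nonneg _) (K.term.le_of_opNorm_le h2 _) 2

theorem BlockHess.inner_toCLM (K : BlockHess nx nu N) (z : Primal nx nu N) :
    ⟪z, K.toCLM z⟫_ℝ = ∑ k, ⟪z.fst k, K.stage k (z.fst k)⟫_ℝ + ⟪z.snd, K.term z.snd⟫_ℝ := by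
  rw [K.toCLM_apply, inner_primal]
  rfl

/-! ### The Jacobian of the constraints -/

theorem fderiv_f_apply (P : Problem nx nu N) (k : Fin N) (v w : StageVar nx nu)
    (h : DifferentiableAt ℝ (P.f k) v) :
    fderiv ℝ (P.f k) v w = P.A k v w.fst + P.B k v w.snd := by
  set e := (WithLp.prodContinuousLinearEquiv 2 ℝ (E nx) (E nu)).symm with he
  have hv : e (v.fst, v.snd) = v := rfl
  have h' : HasFDerivAt (P.f k) (fderiv ℝ (P.f k) v) (e (v.fst, v.snd)) := h.hasFDerivAt
  have hA : P.A k v = (fderiv ℝ (P.f k) v).comp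
      ((e : _ →L[ℝ] StageVar nx nu).comp (ContinuousLinearMap.inl ℝ (E nx) (E nu))) := by
    have h1 : HasFDerivAt (fun x : E nx => e (x, v.snd))
        ((e : _ →L[ℝ] StageVar nx nu).comp (ContinuousLinearMap.inl ℝ (E nx) (E nu))) v.fst :=
      e.toContinuousLinearMap.hasFDerivAt.comp v.fst (hasFDerivAt_prodMk_left v.fst v.snd)
    exact (HasFDerivAt.comp (f := fun x : E nx => e (x, v.snd)) v.fst h' h1).fderiv
  have hB : P.B k v = (fderiv ℝ (P.f k) v).comp
      ((e : _ →L[ℝ] StageVar nx nu).comp (ContinuousLinearMap.inr ℝ (E nx) (E nu))) := by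
    have h1 : HasFDerivAt (fun u : E nu => e (v.fst, u))
        ((e : _ →L[ℝ] StageVar nx nu).comp (ContinuousLinearMap.inr ℝ (E nx) (E nu))) v.snd :=
      e.toContinuousLinearMap.hasFDerivAt.comp v.snd (hasFDerivAt_prodMk_right v.fst v.snd)
    exact (HasFDerivAt.comp (f := fun u : E nu => e (v.fst, u)) v.snd h' h1).fderiv
  rw [hA, hB]
  simp only [ContinuousLinearMap.comp_apply]
  rw [← map_add, ← map_add]
  congr 1
  apply stageVar_ext <;> simp [e]

theorem hasFDerivAt_constr (P : Problem nx nu N) (z : Primal nx nu N)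
    (h : ∀ k, DifferentiableAt ℝ (P.f k) (z.fst k)) :
    HasFDerivAt P.constr
      (dynOp (fun k => P.A k (z.fst k)) (fun k => P.B k (z.fst k))) z := by
  have hst : ∀ k : Fin (N + 1),
      HasFDerivAt (fun z' : Primal nx nu N => state z' k) (stateProj k) z := fun k => by
    simp only [← stateProj_apply]
    exact (stateProj k).hasFDerivAt
  rw [← hasFDerivWithinAt_univ, hasFDerivWithinAt_piLp]
  intro i
  rw [hasFDerivWithinAt_univ]
  refine Fin.cases ?_ (fun k => ?_) i
  · refine ((hst 0).sub_const P.xbar0).congr_fderiv ?_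
    rfl
  · have hf : HasFDerivAt (fun z' : Primal nx nu N => P.f k (z'.fst k))
        ((fderiv ℝ (P.f k) (z.fst k)).comp (stageProj k)) z :=
      HasFDerivAt.comp (f := fun z' : Primal nx nu N => stageProj k z') z
        (h k).hasFDerivAt (stageProj k).hasFDerivAt
    refine ((hst k.succ).sub hf).congr_fderiv ?_
    refine ContinuousLinearMap.ext fun v => ?_
    simp only [sub_apply, ContinuousLinearMap.comp_apply, stageProj_apply,
      fderiv_f_apply P k _ _ (h k)]
    rfl

theorem jac_eq_dynOp (P : Problem nx nu N) (z : Primal nx nu N)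
    (h : ∀ k, DifferentiableAt ℝ (P.f k) (z.fst k)) :
    P.jac z = dynOp (fun k => P.A k (z.fst k)) (fun k => P.B k (z.fst k)) := by
  unfold Problem.jac
  rw [(hasFDerivAt_constr P z h).fderiv]

theorem kkt_eq_lqKKT (P : Problem nx nu N) (K : BlockHess nx nu N) (z : Primal nx nu N)
    (h : ∀ k, DifferentiableAt ℝ (P.f k) (z.fst k)) (w : PrimalDual nx nu N) :
    P.kkt K z w = lqKKT (fun k => P.A k (z.fst k)) (fun k => P.B k (z.fst k)) K w := by
  rw [P.kkt_apply, jac_eq_dynOp P z h]; rfl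

end DynOp

/-! ### Observability of the adjoint dynamics -/

section Observability

variable {V W : Type*} [NormedAddCommGroup V] [InnerProductSpace ℝ V] [CompleteSpace V]
  [NormedAddCommGroup W] [InnerProductSpace ℝ W] [CompleteSpace W]

/-- The window `[k, k + s)` is observable with constant `g`: for every solution of the adjoint
dynamics `y_i = A_iᵀ y_{i+1}` on it, the outputs `B_iᵀ y_{i+1}` determine `y_{k+s}`. This is
`Ξ_{k,s} Ξ_{k,s}ᵀ ⪰ g I`, in a form that mentions no products of the matrices `A_i`. -/
def ObservableWindow (A : ℕ → V →L[ℝ] V) (B : ℕ → W →L[ℝ] V) (g : ℝ) (k s : ℕ) : Prop :=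
  ∀ y : ℕ → V, (∀ i < s, y (k + i) = (A (k + i)).adjoint (y (k + i + 1))) →
    g * ‖y (k + s)‖ ^ 2 ≤ ∑ i ∈ Finset.range s, ‖(B (k + i)).adjoint (y (k + i + 1))‖ ^ 2

theorem ObservableWindow.congr {A A' : ℕ → V →L[ℝ] V} {B B' : ℕ → W →L[ℝ] V} {g : ℝ} {k s : ℕ}
    (h : ObservableWindow A B g k s) (hA : ∀ i < s, A' (k + i) = A (k + i))
    (hB : ∀ i < s, B' (k + i) = B (k + i)) : ObservableWindow A' B' g k s := by
  intro y hy
  refine (h y fun i hi => ?_).trans_eq (Finset.sum_congr rfl fun i hi => ?_)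
  · rw [hy i hi, hA i hi]
  · rw [hB i (Finset.mem_range.1 hi)]

variable {A : ℕ → V →L[ℝ] V} {B : ℕ → W →L[ℝ] V} {U g : ℝ} {l : ℕ → V} {ρ : ℕ → ℝ}

theorem norm_adjoint_apply_le {F F' : Type*} [NormedAddCommGroup F] [InnerProductSpace ℝ F]
    [CompleteSpace F] [NormedAddCommGroup F'] [InnerProductSpace ℝ F'] [CompleteSpace F']
    {T : F →L[ℝ] F'} {c : ℝ} (h : ‖T‖ ≤ c) (x : F') : ‖T.adjoint x‖ ≤ c * ‖x‖ :=
  T.adjoint.le_of_opNorm_le ((LinearIsometryEquiv.norm_map _ T).trans_le h) x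

/-- Running the adjoint dynamics backwards from stage `j + s`. -/
theorem norm_le_backward_sum (hU : 0 ≤ U) (hA : ∀ k, ‖A k‖ ≤ U)
    (hρ : ∀ k, ‖l k - (A k).adjoint (l (k + 1))‖ ≤ ρ k) (j s : ℕ) :
    ‖l j‖ ≤ ∑ i ∈ Finset.range s, U ^ i * ρ (j + i) + U ^ s * ‖l (j + s)‖ := by
  induction s with
  | zero => simp
  | succ s ih =>
    have h1 : ‖l (j + s)‖ ≤ ρ (j + s) + U * ‖l (j + (s + 1))‖ := by
      calc ‖l (j + s)‖ = ‖(l (j + s) - (A (j + s)).adjoint (l (j + s + 1)))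
            + (A (j + s)).adjoint (l (j + s + 1))‖ := by rw [sub_add_cancel]
        _ ≤ _ := (norm_add_le _ _).trans
            (add_le_add (hρ _) (norm_adjoint_apply_le (hA _) _))
    rw [Finset.sum_range_succ, pow_succ]
    nlinarith [mul_le_mul_of_nonneg_left h1 (pow_nonneg hU s)]

/-- On an observable window, `l_{k+s}` is controlled by the residuals `l_i - A_iᵀ l_{i+1}` and
the outputs `B_iᵀ l_{i+1}`, both bounded by `ρ_i`. -/
theorem ObservableWindow.norm_le {k s : ℕ} (h : ObservableWindow A B g k s) (hU : 1 < U)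
    (hg : 0 ≤ g)
    (hA : ∀ k, ‖A k‖ ≤ U) (hB : ∀ k, ‖B k‖ ≤ U)
    (hρ : ∀ k, ‖l k - (A k).adjoint (l (k + 1))‖ ≤ ρ k)
    (hρ' : ∀ k, ‖(B k).adjoint (l (k + 1))‖ ≤ ρ k) :
    √g * ‖l (k + s)‖ ≤ ∑ m ∈ Finset.range s, U ^ (m + 1) / (U - 1) * ρ (k + m) := by
  have hU0 : 0 < U - 1 := by linarith
  have hρ0 : ∀ k, 0 ≤ ρ k := fun k => (norm_nonneg _).trans (hρ k)
  -- the solution of the adjoint dynamics that ends in `l (k + s)`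
  let c : ℕ → V := fun n => Nat.rec (l (k + s)) (fun i y => (A (k + s - 1 - i)).adjoint y) n
  set y : ℕ → V := fun j => c (k + s - j) with hy
  have hy1 : ∀ i < s, y (k + i) = (A (k + i)).adjoint (y (k + i + 1)) := by
    intro i hi
    have e1 : k + s - (k + i) = (k + s - (k + i + 1)) + 1 := by omega
    have e2 : k + s - 1 - (k + s - (k + i + 1)) = k + i := by omega
    simp only [hy]
    rw [e1]
    change (A (k + s - 1 - (k + s - (k + i + 1)))).adjoint _ = _
    rw [e2]
  have hys : y (k + s) = l (k + s) := by
    simp only [hy, Nat.sub_self]; rfl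
  set δ : ℕ → ℝ := fun i => ‖y (k + i) - l (k + i)‖ with hδ
  have hδs : δ s = 0 := by simp [hδ, hys]
  have hδ0 : ∀ i, 0 ≤ δ i := fun i => norm_nonneg _
  have hδ1 : ∀ i < s, δ i ≤ U * δ (i + 1) + ρ (k + i) := by
    intro i hi
    have : y (k + i) - l (k + i) = (A (k + i)).adjoint (y (k + i + 1) - l (k + i + 1))
        - (l (k + i) - (A (k + i)).adjoint (l (k + i + 1))) := by
      rw [hy1 i hi, map_sub]; abel
    simp only [hδ]
    rw [this]
    exact (norm_sub_le _ _).trans (add_le_add (norm_adjoint_apply_le (hA _) _) (hρ _))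
  -- weighted summation of the recursion for `δ`
  have hsum : ∀ c ≤ s, ∑ i ∈ Finset.range c, U * δ (i + 1)
      ≤ ∑ m ∈ Finset.range c, (U ^ (m + 1) - U) / (U - 1) * ρ (k + m)
        + (U ^ (c + 1) - U) / (U - 1) * δ c := by
    intro c
    induction c with
    | zero => intro _; simp
    | succ c ih =>
      intro hc
      have h1 := ih (by omega)
      have h2 := hδ1 c (by omega)
      have h3 : 0 ≤ (U ^ (c + 1) - U) / (U - 1) := by
        apply div_nonneg _ hU0.le
        rw [sub_nonneg]
        exact le_self_pow₀ hU.le (by omega)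
      have h4 : (U ^ (c + 1 + 1) - U) / (U - 1) = U * ((U ^ (c + 1) - U) / (U - 1)) + U := by
        field_simp; ring
      rw [Finset.sum_range_succ, Finset.sum_range_succ, h4]
      nlinarith [mul_le_mul_of_nonneg_left h2 h3]
  have h1 := hsum s le_rfl
  rw [hδs, mul_zero, add_zero] at h1
  have h2 : ∀ i ∈ Finset.range s,
      ‖(B (k + i)).adjoint (y (k + i + 1))‖ ≤ ρ (k + i) + U * δ (i + 1) := by
    intro i _
    have : (B (k + i)).adjoint (y (k + i + 1)) = (B (k + i)).adjoint (l (k + i + 1))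
        + (B (k + i)).adjoint (y (k + i + 1) - l (k + i + 1)) := by rw [map_sub]; abel
    rw [this]
    exact (norm_add_le _ _).trans (add_le_add (hρ' _) (norm_adjoint_apply_le (hB _) _))
  have h3 : (√g * ‖l (k + s)‖) ^ 2
      ≤ (∑ i ∈ Finset.range s, ‖(B (k + i)).adjoint (y (k + i + 1))‖) ^ 2 := by
    rw [mul_pow, Real.sq_sqrt hg, ← hys]
    exact (h y hy1).trans
      (Finset.sum_sq_le_sq_sum_of_nonneg fun i _ => norm_nonneg _)
  have h4 := le_of_sq_le_sq h3 (Finset.sum_nonneg fun i _ => norm_nonneg _)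
  calc √g * ‖l (k + s)‖ ≤ ∑ i ∈ Finset.range s, (ρ (k + i) + U * δ (i + 1)) :=
        h4.trans (Finset.sum_le_sum h2)
    _ ≤ ∑ m ∈ Finset.range s, (ρ (k + m) + (U ^ (m + 1) - U) / (U - 1) * ρ (k + m)) := by
        rw [Finset.sum_add_distrib, Finset.sum_add_distrib]; gcongr
    _ ≤ _ := by
        refine Finset.sum_le_sum fun m _ => ?_
        have : U ^ (m + 1) / (U - 1) = 1 + (U ^ (m + 1) - U) / (U - 1) + 1 / (U - 1) := by
          field_simp; ring
        rw [this]
        have h5 : 0 ≤ 1 / (U - 1) * ρ (k + m) := mul_nonneg (by positivity) (hρ0 _)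
        linarith

/-- Every stage is the start of an observable window of length at most `t`, or is followed within
`t` stages by one where the dynamics are decoupled (`A = 0`), as at the end of the horizon. -/
def UniformlyObservable (A : ℕ → V →L[ℝ] V) (B : ℕ → W →L[ℝ] V) (g : ℝ) (t : ℕ) : Prop :=
  ∀ j, (∃ s < t, A (j + s) = 0) ∨ ∃ s ≤ t, ObservableWindow A B g j s

theorem UniformlyObservable.norm_le {t : ℕ} (h : UniformlyObservable A B g t) (hU : 1 < U)
    (hg : 0 < g)
    (hA : ∀ k, ‖A k‖ ≤ U) (hB : ∀ k, ‖B k‖ ≤ U)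
    (hρ : ∀ k, ‖l k - (A k).adjoint (l (k + 1))‖ ≤ ρ k)
    (hρ' : ∀ k, ‖(B k).adjoint (l (k + 1))‖ ≤ ρ k) (j : ℕ) :
    ‖l j‖ ≤ (1 + U ^ (t + 1) / (U - 1) / √g) * ∑ i ∈ Finset.range t, U ^ i * ρ (j + i) := by
  have hU0 : 0 < U - 1 := by linarith
  have hsg : 0 < √g := Real.sqrt_pos.2 hg
  have hρ0 : ∀ k, 0 ≤ ρ k := fun k => (norm_nonneg _).trans (hρ k)
  have hmono : ∀ s ≤ t, ∑ i ∈ Finset.range s, U ^ i * ρ (j + i)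
      ≤ ∑ i ∈ Finset.range t, U ^ i * ρ (j + i) := fun s hs =>
    Finset.sum_le_sum_of_subset_of_nonneg (Finset.range_mono hs) fun i _ _ =>
      mul_nonneg (by positivity) (hρ0 _)
  have hS0 : 0 ≤ ∑ i ∈ Finset.range t, U ^ i * ρ (j + i) :=
    Finset.sum_nonneg fun i _ => mul_nonneg (by positivity) (hρ0 _)
  rcases h j with ⟨s, hs, hAs⟩ | ⟨s, hs, hw⟩
  · have h1 := norm_le_backward_sum (by linarith) hA hρ j s
    have h2 := hρ (j + s)
    rw [hAs, map_zero, zero_apply, sub_zero] at h2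
    have h3 : ‖l j‖ ≤ ∑ i ∈ Finset.range (s + 1), U ^ i * ρ (j + i) := by
      rw [Finset.sum_range_succ]
      exact h1.trans (by gcongr)
    refine (h3.trans (hmono _ hs)).trans (le_mul_of_one_le_left hS0 ?_)
    have : 0 ≤ U ^ (t + 1) / (U - 1) / √g := by positivity
    linarith
  · have h1 := norm_le_backward_sum (by linarith) hA hρ j s
    have h2 := hw.norm_le hU hg.le hA hB hρ hρ'
    have h3 : ∑ m ∈ Finset.range s, U ^ (m + 1) / (U - 1) * ρ (j + m)
        = U / (U - 1) * ∑ m ∈ Finset.range s, U ^ m * ρ (j + m) := by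
      rw [Finset.mul_sum]
      refine Finset.sum_congr rfl fun m _ => ?_
      rw [pow_succ]; ring
    rw [h3] at h2
    have h4 : ‖l (j + s)‖ ≤ U / (U - 1) * (∑ i ∈ Finset.range t, U ^ i * ρ (j + i)) / √g := by
      rw [le_div_iff₀ hsg, mul_comm]
      refine h2.trans ?_
      exact mul_le_mul_of_nonneg_left (hmono s hs) (by positivity)
    calc ‖l j‖ ≤ ∑ i ∈ Finset.range t, U ^ i * ρ (j + i)
          + U ^ t * (U / (U - 1) * (∑ i ∈ Finset.range t, U ^ i * ρ (j + i)) / √g) := by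
          refine h1.trans (add_le_add (hmono s hs) ?_)
          gcongr
          exact hU.le
      _ = _ := by rw [pow_succ]; ring

/-- Discrete Young inequality for a convolution with the kernel `U^i`, `i < t`. -/
theorem sum_sq_conv_le (hU : 0 ≤ U) {t n : ℕ} (hρn : ∀ k, n ≤ k → ρ k = 0) :
    ∑ j ∈ Finset.range n, (∑ i ∈ Finset.range t, U ^ i * ρ (j + i)) ^ 2
      ≤ (∑ i ∈ Finset.range t, U ^ i) ^ 2 * ∑ k ∈ Finset.range n, ρ k ^ 2 := by
  have h1 : ∀ j, (∑ i ∈ Finset.range t, U ^ i * ρ (j + i)) ^ 2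
      ≤ (∑ i ∈ Finset.range t, U ^ i) * ∑ i ∈ Finset.range t, U ^ i * ρ (j + i) ^ 2 := fun j =>
    Finset.sum_sq_le_sum_mul_sum_of_sq_le_mul _ (fun i _ => by positivity)
      (fun i _ => by positivity) (fun i _ => le_of_eq (by ring))
  have h2 : ∀ i, ∑ j ∈ Finset.range n, ρ (j + i) ^ 2 ≤ ∑ k ∈ Finset.range n, ρ k ^ 2 := by
    intro i
    have e1 : ∑ j ∈ Finset.range n, ρ (j + i) ^ 2 = ∑ k ∈ Finset.Ico i (n + i), ρ k ^ 2 := by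
      rw [Finset.sum_Ico_eq_sum_range, Nat.add_sub_cancel]
      exact Finset.sum_congr rfl fun j _ => by rw [add_comm]
    have e2 : ∑ k ∈ Finset.range n, ρ k ^ 2 = ∑ k ∈ Finset.range (n + i), ρ k ^ 2 := by
      refine Finset.sum_subset (Finset.range_mono (by omega)) fun k _ hk => ?_
      rw [hρn k (by simpa using hk)]; simp
    rw [e1, e2]
    refine Finset.sum_le_sum_of_subset_of_nonneg (fun k hk => ?_) fun k _ _ => sq_nonneg _
    rw [Finset.mem_Ico] at hk
    exact Finset.mem_range.2 hk.2
  calc _ ≤ ∑ j ∈ Finset.range n, (∑ i ∈ Finset.range t, U ^ i)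
          * ∑ i ∈ Finset.range t, U ^ i * ρ (j + i) ^ 2 := Finset.sum_le_sum fun j _ => h1 j
    _ = (∑ i ∈ Finset.range t, U ^ i)
          * ∑ i ∈ Finset.range t, U ^ i * ∑ j ∈ Finset.range n, ρ (j + i) ^ 2 := by
        rw [← Finset.mul_sum, Finset.sum_comm]
        simp only [Finset.mul_sum]
    _ ≤ (∑ i ∈ Finset.range t, U ^ i)
          * ∑ i ∈ Finset.range t, U ^ i * ∑ k ∈ Finset.range n, ρ k ^ 2 := by
        refine mul_le_mul_of_nonneg_left (Finset.sum_le_sum fun i _ => ?_)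
          (Finset.sum_nonneg fun i _ => by positivity)
        exact mul_le_mul_of_nonneg_left (h2 i) (by positivity)
    _ = _ := by rw [← Finset.sum_mul]; ring

end Observability

theorem geom_sum_le_pow {U : ℝ} (hU : 2 ≤ U) (t : ℕ) : ∑ i ∈ Finset.range t, U ^ i ≤ U ^ t := by
  have h1 := geom_sum_mul U t
  have h2 : 0 ≤ ∑ i ∈ Finset.range t, U ^ i := Finset.sum_nonneg fun i _ => by positivity
  nlinarith

theorem gammaG_pos {gamC ups : ℝ} (t : ℕ) (hg : 0 < gamC) (hU : 2 ≤ ups) :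
    0 < gammaG gamC t ups := by
  have : 0 < ups - 1 := by linarith
  have : 0 < min 1 gamC := lt_min one_pos hg
  unfold gammaG
  positivity

theorem gammaG_le_one {gamC ups : ℝ} (t : ℕ) (hg : 0 < gamC) (hU : 2 ≤ ups) :
    gammaG gamC t ups ≤ 1 := by
  have h0 : 0 < ups - 1 := by linarith
  have h1 : gamC / (gamC + ups ^ (t + 1) / (ups - 1)) ≤ 1 := by
    rw [div_le_one (by positivity)]
    have : 0 ≤ ups ^ (t + 1) / (ups - 1) := by positivity
    linarith
  have h2 : min 1 gamC / (1 + ups) ^ (2 * t) ≤ 1 := by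
    rw [div_le_one (by positivity)]
    exact (min_le_left _ _).trans (one_le_pow₀ (by linarith))
  have h3 : 0 ≤ gamC / (gamC + ups ^ (t + 1) / (ups - 1)) := by positivity
  unfold gammaG
  have h4 : 0 ≤ min 1 gamC / (1 + ups) ^ (2 * t) :=
    div_nonneg (le_min zero_le_one hg.le) (by positivity)
  exact mul_le_one₀ (pow_le_one₀ h3 h1) h4 h2

/-- The constant that the observability argument produces is at least `gammaG`. -/
theorem gammaG_mul_le_one {gamC ups : ℝ} (t : ℕ) (hg : 0 < gamC) (hg1 : gamC ≤ 1) (hU : 2 ≤ ups) :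
    gammaG gamC t ups * ((1 + ups ^ (t + 1) / (ups - 1) / √gamC) * ups ^ t) ^ 2 ≤ 1 := by
  have h0 : 0 < ups - 1 := by linarith
  set a := ups ^ (t + 1) / (ups - 1) with ha
  have ha0 : 0 ≤ a := by positivity
  set r := √gamC with hr
  have hr0 : 0 < r := Real.sqrt_pos.2 hg
  have hrr : r ^ 2 = gamC := Real.sq_sqrt hg.le
  have hr1 : r ≤ 1 := Real.sqrt_le_one.2 hg1
  have h1 : gamC / (gamC + a) * r * (1 + a / r) ≤ 1 := by
    have : gamC / (gamC + a) * r * (1 + a / r) = gamC * (r + a) / (gamC + a) := by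
      field_simp
    rw [this, div_le_one (by positivity)]
    nlinarith
  have h2 : ups ^ t / (1 + ups) ^ t ≤ 1 := by
    rw [div_le_one (by positivity)]
    gcongr
    linarith
  have h3 : gammaG gamC t ups * ((1 + a / r) * ups ^ t) ^ 2
      = (gamC / (gamC + a) * r * (1 + a / r) * (ups ^ t / (1 + ups) ^ t)) ^ 2 := by
    unfold gammaG
    rw [min_eq_right hg1, ← ha, mul_comm 2 t, pow_mul]
    simp only [mul_pow, div_pow, ← hrr]
    field_simp
  rw [h3]
  exact pow_le_one₀ (by positivity) (mul_le_one₀ h1 (by positivity) h2)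

/-- Extension of a finite sequence to `ℕ` by zero. -/
def seqExt {F : Type*} [Zero F] (a : Fin N → F) (k : ℕ) : F := if h : k < N then a ⟨k, h⟩ else 0

theorem seqExt_of_lt {F : Type*} [Zero F] (a : Fin N → F) {k : ℕ} (h : k < N) :
    seqExt a k = a ⟨k, h⟩ := dif_pos h

theorem seqExt_of_le {F : Type*} [Zero F] (a : Fin N → F) {k : ℕ} (h : N ≤ k) :
    seqExt a k = 0 := dif_neg (by omega)

@[simp] theorem seqExt_coe {F : Type*} [Zero F] (a : Fin N → F) (k : Fin N) :
    seqExt a k = a k := dif_pos k.isLt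

theorem norm_seqExt_le {F : Type*} [NormedAddCommGroup F] {a : Fin N → F} {c : ℝ} (hc : 0 ≤ c)
    (h : ∀ k, ‖a k‖ ≤ c) (k : ℕ) : ‖seqExt a k‖ ≤ c := by
  unfold seqExt
  split_ifs
  · exact h _
  · simpa using hc

/-- The constraint Jacobian of an observable system satisfies `G Gᵀ ⪰ γ_G I`. -/
theorem gammaG_mul_le_norm_adjoint {A : Fin N → E nx →L[ℝ] E nx} {B : Fin N → E nu →L[ℝ] E nx}
    {gamC ups : ℝ} {t : ℕ} (hg : 0 < gamC) (hg1 : gamC ≤ 1) (hU : 2 ≤ ups)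
    (hA : ∀ k, ‖A k‖ ≤ ups) (hB : ∀ k, ‖B k‖ ≤ ups)
    (hobs : UniformlyObservable (seqExt A) (seqExt B) gamC t) (l : Dual nx N) :
    gammaG gamC t ups * ‖l‖ ^ 2 ≤ ‖(dynOp A B).adjoint l‖ ^ 2 := by
  have hU0 : 0 ≤ ups := by linarith
  set r := (dynOp A B).adjoint l with hr
  set l' : ℕ → E nx := seqExt (fun k : Fin (N + 1) => l k) with hl'
  set ρ : ℕ → ℝ := seqExt (fun k : Fin (N + 1) =>
    Fin.lastCases (motive := fun _ => ℝ) ‖r.snd‖ (fun j => ‖r.fst j‖) k) with hρ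
  have hρN : ρ N = ‖r.snd‖ := by
    rw [hρ, seqExt_of_lt _ (Nat.lt_succ_self N)]
    exact Fin.lastCases_last
  have hρlt : ∀ k : Fin N, ρ k = ‖r.fst k‖ := by
    intro k
    rw [hρ, seqExt_of_lt _ (k.isLt.trans (Nat.lt_succ_self N))]
    exact Fin.lastCases_castSucc k
  have hl'lt : ∀ k : Fin (N + 1), l' k = l k := fun k => seqExt_coe _ k
  have hcase : ∀ k : ℕ, (∃ j : Fin N, k = j) ∨ k = N ∨ N + 1 ≤ k := by
    intro k
    rcases lt_trichotomy k N with h | h | h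
    · exact Or.inl ⟨⟨k, h⟩, rfl⟩
    · exact Or.inr (Or.inl h)
    · exact Or.inr (Or.inr h)
  have hrk : ∀ k : Fin N, r.fst k = WithLp.toLp 2
      (l k.castSucc - (A k).adjoint (l k.succ), -(B k).adjoint (l k.succ)) := by
    intro k; rw [hr, dynOp_adjoint_fst]
  have hrN : r.snd = l (Fin.last N) := by rw [hr, dynOp_adjoint_snd]
  have hres : ∀ k, ‖l' k - (seqExt A k).adjoint (l' (k + 1))‖ ≤ ρ k
      ∧ ‖(seqExt B k).adjoint (l' (k + 1))‖ ≤ ρ k := by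
    intro k
    rcases hcase k with ⟨j, rfl⟩ | rfl | h
    · have e1 : l' (j : ℕ) = l j.castSucc := hl'lt j.castSucc
      have e2 : l' (j + 1 : ℕ) = l j.succ := hl'lt j.succ
      have h2 := norm_sq_stageVar (r.fst j)
      rw [hρlt, e1, e2, seqExt_coe, seqExt_coe]
      rw [hrk j] at h2 ⊢
      rw [WithLp.toLp_fst, WithLp.toLp_snd, norm_neg] at h2
      constructor
      · refine le_of_sq_le_sq ?_ (norm_nonneg _)
        rw [h2]; nlinarith [sq_nonneg ‖(B j).adjoint (l j.succ)‖]
      · refine le_of_sq_le_sq ?_ (norm_nonneg _)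
        rw [h2]; nlinarith [sq_nonneg ‖l j.castSucc - (A j).adjoint (l j.succ)‖]
    · have e1 : l' k = l (Fin.last k) := hl'lt (Fin.last k)
      rw [hρN, seqExt_of_le A le_rfl, seqExt_of_le B le_rfl, e1, hrN]
      simp
    · rw [seqExt_of_le A (by omega), seqExt_of_le B (by omega), hρ, seqExt_of_le _ h, hl',
        seqExt_of_le _ h]
      simp
  have hbound := hobs.norm_le (l := l') (ρ := ρ) (by linarith) hg
    (norm_seqExt_le hU0 hA) (norm_seqExt_le hU0 hB) (fun k => (hres k).1) (fun k => (hres k).2)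
  set D := 1 + ups ^ (t + 1) / (ups - 1) / √gamC with hD
  have hD0 : 0 ≤ D := by
    have : 0 < ups - 1 := by linarith
    positivity
  have hnl : ‖l‖ ^ 2 = ∑ j ∈ Finset.range (N + 1), ‖l' j‖ ^ 2 := by
    rw [norm_sq_dual, Finset.sum_range]
    simp only [hl'lt]
  have hnr : ‖r‖ ^ 2 = ∑ j ∈ Finset.range (N + 1), ρ j ^ 2 := by
    rw [norm_sq_primal, Finset.sum_range_succ, Finset.sum_range, hρN]
    simp only [hρlt]
  have hρ0 : ∀ k, 0 ≤ ρ k := fun k => (norm_nonneg _).trans (hres k).1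
  have h1 : ‖l‖ ^ 2 ≤ (D * ups ^ t) ^ 2 * ‖r‖ ^ 2 := by
    rw [hnl]
    calc ∑ j ∈ Finset.range (N + 1), ‖l' j‖ ^ 2
        ≤ ∑ j ∈ Finset.range (N + 1),
            D ^ 2 * (∑ i ∈ Finset.range t, ups ^ i * ρ (j + i)) ^ 2 := by
          refine Finset.sum_le_sum fun j _ => ?_
          rw [← mul_pow]
          exact pow_le_pow_left₀ (norm_nonneg _) (hbound j) 2
      _ ≤ D ^ 2 * ((∑ i ∈ Finset.range t, ups ^ i) ^ 2
            * ∑ k ∈ Finset.range (N + 1), ρ k ^ 2) := by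
          rw [← Finset.mul_sum]
          gcongr
          refine sum_sq_conv_le hU0 fun k hk => ?_
          rw [hρ, seqExt_of_le _ hk]
      _ ≤ D ^ 2 * ((ups ^ t) ^ 2 * ‖r‖ ^ 2) := by
          rw [← hnr]
          gcongr
          exact geom_sum_le_pow hU t
      _ = _ := by ring
  calc gammaG gamC t ups * ‖l‖ ^ 2
      ≤ gammaG gamC t ups * ((D * ups ^ t) ^ 2 * ‖r‖ ^ 2) := by
        gcongr
        exact (gammaG_pos t hg hU).le
    _ = (gammaG gamC t ups * (D * ups ^ t) ^ 2) * ‖r‖ ^ 2 := by ring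
    _ ≤ 1 * ‖r‖ ^ 2 := by
        gcongr
        exact gammaG_mul_le_one t hg hg1 hU
    _ = ‖r‖ ^ 2 := one_mul _

/-! ### Exponential decay by stagewise weights -/

/-- Multiplication of stage `k` of a primal vector by the weight `c k`. -/
def scalePrimal (c : Fin (N + 1) → ℝ) (z : Primal nx nu N) : Primal nx nu N :=
  WithLp.toLp 2 (WithLp.toLp 2 (fun k => c k.castSucc • z.fst k), c (Fin.last N) • z.snd)

/-- Multiplication of stage `k` of a dual vector by the weight `c k`. -/
def scaleDual (c : Fin (N + 1) → ℝ) (l : Dual nx N) : Dual nx N :=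
  WithLp.toLp 2 (fun k => c k • l k)

/-- Multiplication of stage `k` of a primal-dual vector by the weight `c k`. -/
def scale (c : Fin (N + 1) → ℝ) (w : PrimalDual nx nu N) : PrimalDual nx nu N :=
  WithLp.toLp 2 (scalePrimal c w.fst, scaleDual c w.snd)

theorem state_scalePrimal (c : Fin (N + 1) → ℝ) (z : Primal nx nu N) (k : Fin (N + 1)) :
    state (scalePrimal c z) k = c k • state z k := by
  refine Fin.lastCases ?_ (fun j => ?_) k
  · rw [state_last, state_last]; rfl
  · rw [state_castSucc, state_castSucc]; rfl

theorem lqKKT_fst_fst (A : Fin N → E nx →L[ℝ] E nx) (B : Fin N → E nu →L[ℝ] E nx)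
    (K : BlockHess nx nu N) (w : PrimalDual nx nu N) (k : Fin N) :
    (lqKKT A B K w).fst.fst k = K.stage k (w.fst.fst k) + WithLp.toLp 2
      (w.snd k.castSucc - (A k).adjoint (w.snd k.succ), -(B k).adjoint (w.snd k.succ)) := by
  rw [← dynOp_adjoint_fst]; rfl

theorem lqKKT_fst_snd (A : Fin N → E nx →L[ℝ] E nx) (B : Fin N → E nu →L[ℝ] E nx)
    (K : BlockHess nx nu N) (w : PrimalDual nx nu N) :
    (lqKKT A B K w).fst.snd = K.term w.fst.snd + w.snd (Fin.last N) := by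
  rw [← dynOp_adjoint_snd A B]; rfl

theorem lqKKT_snd (A : Fin N → E nx →L[ℝ] E nx) (B : Fin N → E nu →L[ℝ] E nx)
    (K : BlockHess nx nu N) (w : PrimalDual nx nu N) :
    (lqKKT A B K w).snd = dynOp A B w.fst := rfl

theorem norm_sq_eq_stages (w : PrimalDual nx nu N) :
    ‖w‖ ^ 2 = ∑ k : Fin N, ‖w.fst.fst k‖ ^ 2 + ‖w.fst.snd‖ ^ 2
      + (‖w.snd 0‖ ^ 2 + ∑ k : Fin N, ‖w.snd k.succ‖ ^ 2) := by
  rw [norm_sq_primalDual, norm_sq_primal, norm_sq_dual, Fin.sum_univ_succ]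

/-- The saddle point matrix couples neighbouring stages only, so that its commutator with slowly
varying weights is small. -/
theorem norm_lqKKT_scale_sub_le (A : Fin N → E nx →L[ℝ] E nx) (B : Fin N → E nu →L[ℝ] E nx)
    (K : BlockHess nx nu N) {U ε : ℝ} (hU : 0 ≤ U) (hε : 0 ≤ ε) (hA : ∀ k, ‖A k‖ ≤ U)
    (hB : ∀ k, ‖B k‖ ≤ U) {c : Fin (N + 1) → ℝ}
    (hc1 : ∀ k : Fin N, |c k.castSucc - c k.succ| ≤ ε * |c k.castSucc|)
    (hc2 : ∀ k : Fin N, |c k.castSucc - c k.succ| ≤ ε * |c k.succ|) (w : PrimalDual nx nu N) :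
    ‖lqKKT A B K (scale c w) - scale c (lqKKT A B K w)‖ ≤ 2 * (U * ε) * ‖scale c w‖ := by
  set Δ := lqKKT A B K (scale c w) - scale c (lqKKT A B K w) with hΔ
  have h1 : ∀ k : Fin N, Δ.fst.fst k = (c k.castSucc - c k.succ) • (WithLp.toLp 2
      ((A k).adjoint (w.snd k.succ), (B k).adjoint (w.snd k.succ)) : StageVar nx nu) := by
    intro k
    have e1 : (scale c (lqKKT A B K w)).fst.fst k
        = c k.castSucc • (lqKKT A B K w).fst.fst k := rfl
    have e2 : (scale c w).fst.fst k = c k.castSucc • w.fst.fst k := rfl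
    have e3 : ∀ j, (scale c w).snd j = c j • w.snd j := fun _ => rfl
    have e4 : Δ.fst.fst k = (lqKKT A B K (scale c w)).fst.fst k
        - (scale c (lqKKT A B K w)).fst.fst k := rfl
    rw [e4, e1, lqKKT_fst_fst, lqKKT_fst_fst, e2, e3, e3]
    apply stageVar_ext
    · simp only [map_smul, WithLp.sub_fst, WithLp.add_fst, WithLp.smul_fst, WithLp.toLp_fst]
      module
    · simp only [map_smul, WithLp.sub_snd, WithLp.add_snd, WithLp.smul_snd, WithLp.toLp_snd]
      module
  have h2 : Δ.fst.snd = 0 := by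
    have e4 : Δ.fst.snd = (lqKKT A B K (scale c w)).fst.snd
        - c (Fin.last N) • (lqKKT A B K w).fst.snd := rfl
    have e1 : (scale c w).fst.snd = c (Fin.last N) • w.fst.snd := rfl
    have e2 : (scale c w).snd (Fin.last N) = c (Fin.last N) • w.snd (Fin.last N) := rfl
    rw [e4, lqKKT_fst_snd, lqKKT_fst_snd, e1, e2, map_smul, smul_add, sub_self]
  have h3 : Δ.snd 0 = 0 := by
    have e4 : Δ.snd 0 = state (scalePrimal c w.fst) 0 - c 0 • state w.fst 0 := by
      rw [← dynOp_zero A B w.fst, ← dynOp_zero A B (scalePrimal c w.fst)]; rfl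
    rw [e4, state_scalePrimal, sub_self]
  have h4 : ∀ k : Fin N, Δ.snd k.succ = -((c k.castSucc - c k.succ) •
      (A k (w.fst.fst k).fst + B k (w.fst.fst k).snd)) := by
    intro k
    have e4 : Δ.snd k.succ = dynOp A B (scalePrimal c w.fst) k.succ
      - c k.succ • dynOp A B w.fst k.succ := rfl
    have e1 : (scalePrimal c w.fst).fst k = c k.castSucc • w.fst.fst k := rfl
    rw [e4, dynOp_succ, dynOp_succ, state_scalePrimal, e1, WithLp.smul_fst, WithLp.smul_snd,
      map_smul, map_smul]
    module
  refine le_of_sq_le_sq ?_ (by positivity)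
  rw [norm_sq_eq_stages, mul_pow, norm_sq_eq_stages, h2, h3]
  have b1 : ∀ k : Fin N, ‖Δ.fst.fst k‖ ^ 2 ≤ (2 * (U * ε)) ^ 2 * ‖(scale c w).snd k.succ‖ ^ 2 := by
    intro k
    have e3 : (scale c w).snd k.succ = c k.succ • w.snd k.succ := rfl
    have a1 := pow_le_pow_left₀ (norm_nonneg _) (norm_adjoint_apply_le (hA k) (w.snd k.succ)) 2
    have a2 := pow_le_pow_left₀ (norm_nonneg _) (norm_adjoint_apply_le (hB k) (w.snd k.succ)) 2
    have a3 := pow_le_pow_left₀ (abs_nonneg _) (hc2 k) 2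
    rw [h1, norm_smul, mul_pow, Real.norm_eq_abs, norm_sq_stageVar, WithLp.toLp_fst,
      WithLp.toLp_snd, e3, norm_smul, Real.norm_eq_abs]
    calc _ ≤ (ε * |c k.succ|) ^ 2 * ((U * ‖w.snd k.succ‖) ^ 2 + (U * ‖w.snd k.succ‖) ^ 2) :=
          mul_le_mul a3 (add_le_add a1 a2) (by positivity) (by positivity)
      _ ≤ _ := by
          have : 0 ≤ (U * ε * (|c k.succ| * ‖w.snd k.succ‖)) ^ 2 := sq_nonneg _
          nlinarith
  have b2 : ∀ k : Fin N, ‖Δ.snd k.succ‖ ^ 2 ≤ (2 * (U * ε)) ^ 2 * ‖(scale c w).fst.fst k‖ ^ 2 := by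
    intro k
    have e3 : (scale c w).fst.fst k = c k.castSucc • w.fst.fst k := rfl
    have a1 := (A k).le_of_opNorm_le (hA k) (w.fst.fst k).fst
    have a2 := (B k).le_of_opNorm_le (hB k) (w.fst.fst k).snd
    have f1 : ‖(w.fst.fst k).fst‖ ≤ ‖w.fst.fst k‖ := by
      refine le_of_sq_le_sq ?_ (norm_nonneg _)
      rw [norm_sq_stageVar (w.fst.fst k)]; nlinarith [sq_nonneg ‖(w.fst.fst k).snd‖]
    have f2 : ‖(w.fst.fst k).snd‖ ≤ ‖w.fst.fst k‖ := by
      refine le_of_sq_le_sq ?_ (norm_nonneg _)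
      rw [norm_sq_stageVar (w.fst.fst k)]; nlinarith [sq_nonneg ‖(w.fst.fst k).fst‖]
    rw [h4, norm_neg, norm_smul, Real.norm_eq_abs, ← mul_pow, e3, norm_smul, Real.norm_eq_abs]
    refine pow_le_pow_left₀ (by positivity) ?_ 2
    calc _ ≤ ε * |c k.castSucc| * (U * ‖w.fst.fst k‖ + U * ‖w.fst.fst k‖) := by
          gcongr
          · exact hc1 k
          · exact (norm_add_le _ _).trans (add_le_add (a1.trans (by gcongr)) (a2.trans (by gcongr)))
      _ = _ := by ring
  have s1 := Finset.sum_le_sum fun k (_ : k ∈ Finset.univ) => b1 k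
  have s2 := Finset.sum_le_sum fun k (_ : k ∈ Finset.univ) => b2 k
  rw [← Finset.mul_sum] at s1 s2
  have p1 : 0 ≤ (2 * (U * ε)) ^ 2 * ‖(scale c w).fst.snd‖ ^ 2 := by positivity
  have p2 : 0 ≤ (2 * (U * ε)) ^ 2 * ‖(scale c w).snd 0‖ ^ 2 := by positivity
  simp only [norm_zero, zero_pow two_ne_zero, add_zero, zero_add]
  linarith

/-- If the saddle point matrix is stable with constant `C`, it is stable with constant `2 C` in
every norm with sufficiently slowly varying stagewise weights. -/
theorem norm_scale_le (A : Fin N → E nx →L[ℝ] E nx) (B : Fin N → E nu →L[ℝ] E nx)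
    (K : BlockHess nx nu N) {U ε C : ℝ} (hU : 0 ≤ U) (hε : 0 ≤ ε) (hC : 0 ≤ C)
    (hA : ∀ k, ‖A k‖ ≤ U) (hB : ∀ k, ‖B k‖ ≤ U) {c : Fin (N + 1) → ℝ}
    (hc1 : ∀ k : Fin N, |c k.castSucc - c k.succ| ≤ ε * |c k.castSucc|)
    (hc2 : ∀ k : Fin N, |c k.castSucc - c k.succ| ≤ ε * |c k.succ|)
    (hstab : ∀ w, ‖w‖ ≤ C * ‖lqKKT A B K w‖) (hCε : C * (2 * (U * ε)) ≤ 1 / 2)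
    (w : PrimalDual nx nu N) :
    ‖scale c w‖ ≤ 2 * C * ‖scale c (lqKKT A B K w)‖ := by
  have h1 := norm_lqKKT_scale_sub_le A B K hU hε hA hB hc1 hc2 w
  have h2 : ‖lqKKT A B K (scale c w)‖ ≤ ‖scale c (lqKKT A B K w)‖
      + 2 * (U * ε) * ‖scale c w‖ := by
    have := norm_le_norm_add_norm_sub' (lqKKT A B K (scale c w)) (scale c (lqKKT A B K w))
    linarith
  have h3 := (hstab (scale c w)).trans (mul_le_mul_of_nonneg_left h2 hC)
  have h4 : C * (2 * (U * ε)) * ‖scale c w‖ ≤ 1 / 2 * ‖scale c w‖ := by gcongr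
  linarith

/-! ### Controllability: observability of the adjoint dynamics and steering to zero -/

/-- Controllability of a single linearization: every window of length `t` in the horizon starts
with a window on which `Ξ Ξᵀ ⪰ γ_C I`. -/
def Problem.ControllableAt (P : Problem nx nu N) (gamC : ℝ) (t : ℕ) (z : Primal nx nu N) : Prop :=
  ∀ k, k + t ≤ N → ∃ s, 1 ≤ s ∧ s ≤ t ∧
    ∀ v : E nx, gamC * ‖v‖ ^ 2 ≤ ⟪v, (P.ctrl z k s).comp (P.ctrl z k s).adjoint v⟫_ℝ

theorem inner_comp_adjoint_self {F F' : Type*} [NormedAddCommGroup F] [InnerProductSpace ℝ F]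
    [CompleteSpace F] [NormedAddCommGroup F'] [InnerProductSpace ℝ F'] [CompleteSpace F']
    (T : F →L[ℝ] F') (v : F') : ⟪v, T.comp T.adjoint v⟫_ℝ = ‖T.adjoint v‖ ^ 2 := by
  rw [ContinuousLinearMap.comp_apply, ← ContinuousLinearMap.adjoint_inner_left,
    real_inner_self_eq_norm_sq]

theorem ctrl_apply (P : Problem nx nu N) (z : Primal nx nu N) (k s : ℕ)
    (q : PiLp 2 (fun _ : Fin s => E nu)) :
    P.ctrl z k s q = ∑ j : Fin s, P.prodA z (k + s - j) j (P.Bat z (k + s - 1 - j) (q j)) := by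
  rw [Problem.ctrl, sum_apply]
  rfl

theorem ctrl_adjoint_apply (P : Problem nx nu N) (z : Primal nx nu N) (k s : ℕ) (v : E nx)
    (j : Fin s) : (P.ctrl z k s).adjoint v j
      = (P.Bat z (k + s - 1 - j)).adjoint ((P.prodA z (k + s - j) j).adjoint v) := by
  have : (P.ctrl z k s).adjoint v = WithLp.toLp 2 (fun j : Fin s =>
      (P.Bat z (k + s - 1 - j)).adjoint ((P.prodA z (k + s - j) j).adjoint v)) := by
    refine ext_inner_left ℝ fun q => ?_
    rw [ContinuousLinearMap.adjoint_inner_right, ctrl_apply, sum_inner, PiLp.inner_apply]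
    simp only [ContinuousLinearMap.adjoint_inner_right]
  rw [this]

theorem prodA_adjoint_apply (P : Problem nx nu N) (z : Primal nx nu N) (y : ℕ → E nx) (c j : ℕ)
    (hy : ∀ i < j, y (c + i) = (P.Aat z (c + i)).adjoint (y (c + i + 1))) :
    (P.prodA z c j).adjoint (y (c + j)) = y c := by
  induction j with
  | zero =>
    rw [Problem.prodA]
    exact congrArg (fun T : E nx →L[ℝ] E nx => T (y (c + 0))) (ContinuousLinearMap.adjoint_id)
  | succ j ih =>
    rw [Problem.prodA, ContinuousLinearMap.adjoint_comp, ContinuousLinearMap.comp_apply,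
      ← add_assoc, ← hy j (Nat.lt_succ_self j)]
    exact ih fun i hi => hy i (by omega)

/-- The controllability matrix has the adjoint `v ↦ (B_iᵀ y_{i+1})_i`, where `y` solves the adjoint
dynamics with final value `v`. -/
theorem observableWindow_of_ctrl (P : Problem nx nu N) (z : Primal nx nu N) {gamC : ℝ} {k s : ℕ}
    (h : ∀ v : E nx, gamC * ‖v‖ ^ 2 ≤ ⟪v, (P.ctrl z k s).comp (P.ctrl z k s).adjoint v⟫_ℝ) :
    ObservableWindow (P.Aat z) (P.Bat z) gamC k s := by
  intro y hy
  refine (h (y (k + s))).trans_eq ?_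
  rw [inner_comp_adjoint_self, PiLp.norm_sq_eq_of_L2, ← Finset.sum_range_reflect,
    Finset.sum_range]
  refine Finset.sum_congr rfl fun j _ => ?_
  have hj := j.isLt
  have h1 : (P.prodA z (k + s - j) j).adjoint (y (k + s)) = y (k + s - j) := by
    have := prodA_adjoint_apply P z y (k + s - j) j fun i hi => by
      have e : k + s - j + i = k + (s - j + i) := by omega
      rw [e]
      exact hy _ (by omega)
    rwa [show k + s - j + j = k + s by omega] at this
  rw [ctrl_adjoint_apply, h1, show k + (s - 1 - (j : ℕ)) = k + s - 1 - j by omega,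
    show k + s - 1 - (j : ℕ) + 1 = k + s - j by omega]

/-- The state reached at stage `k + s` from `r 0` at stage `k`. -/
theorem rollout_eq (P : Problem nx nu N) (z : Primal nx nu N) (k : ℕ) (r : ℕ → E nx)
    (q : ℕ → E nu) (h : ∀ i, r (i + 1) = P.Aat z (k + i) (r i) + P.Bat z (k + i) (q i)) (s : ℕ) :
    r s = P.prodA z k s (r 0) + ∑ j ∈ Finset.range s,
      P.prodA z (k + s - j) j (P.Bat z (k + s - 1 - j) (q (s - 1 - j))) := by
  induction s with
  | zero => simp [Problem.prodA]
  | succ s ih =>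
    rw [Finset.sum_range_succ', h s, ih, map_add, map_sum, add_assoc]
    congr 2
    refine Finset.sum_congr rfl fun j hj => ?_
    rw [Finset.mem_range] at hj
    rw [show k + (s + 1) - (j + 1) = k + s - j by omega,
      show k + (s + 1) - 1 - (j + 1) = k + s - 1 - j by omega,
      show s + 1 - 1 - (j + 1) = s - 1 - j by omega]
    conv_rhs => rw [Problem.prodA]
    rw [show k + s - j + j = k + s by omega]
    rfl

theorem norm_prodA_le (P : Problem nx nu N) (z : Primal nx nu N) {U : ℝ} (hU : 0 ≤ U)
    (hA : ∀ k, ‖P.Aat z k‖ ≤ U) (k n : ℕ) (x : E nx) : ‖P.prodA z k n x‖ ≤ U ^ n * ‖x‖ := by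
  induction n with
  | zero => simp [Problem.prodA]
  | succ n ih =>
    rw [Problem.prodA, ContinuousLinearMap.comp_apply, pow_succ', mul_assoc]
    exact ((P.Aat z _).le_of_opNorm_le (hA _) _).trans (by gcongr)

theorem norm_rollout_le (P : Problem nx nu N) (z : Primal nx nu N) {U : ℝ} (hU : 2 ≤ U)
    (hA : ∀ k, ‖P.Aat z k‖ ≤ U) (hB : ∀ k, ‖P.Bat z k‖ ≤ U) (k : ℕ) (r : ℕ → E nx)
    (q : ℕ → E nu) (h : ∀ i, r (i + 1) = P.Aat z (k + i) (r i) + P.Bat z (k + i) (q i))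
    {Q : ℝ} (hQ : ∀ i, ‖q i‖ ≤ Q) (i : ℕ) :
    ‖r i‖ ≤ U ^ i * ‖r 0‖ + (2 * U ^ i - 2) * Q := by
  have hQ0 : 0 ≤ Q := (norm_nonneg _).trans (hQ 0)
  induction i with
  | zero => simp
  | succ i ih =>
    have h1 : ‖r (i + 1)‖ ≤ U * ‖r i‖ + U * Q := by
      rw [h i]
      exact (norm_add_le _ _).trans (add_le_add ((P.Aat z _).le_of_opNorm_le (hA _) _)
        (((P.Bat z _).le_of_opNorm_le (hB _) _).trans (by gcongr; exact hQ i)))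
    have h2 : U * ‖r i‖ ≤ U * (U ^ i * ‖r 0‖ + (2 * U ^ i - 2) * Q) := by gcongr
    rw [pow_succ]
    nlinarith

/-- The cost of steering a state of norm one to zero, or of letting it evolve freely for fewer
than `t` stages. -/
def steerConst (gamC : ℝ) (t : ℕ) (ups : ℝ) : ℝ := 11 * ups ^ (4 * t) / gamC

theorem exists_rollout (P : Problem nx nu N) (z : Primal nx nu N) (k : ℕ) (x : E nx)
    (q : ℕ → E nu) : ∃ r : ℕ → E nx, r 0 = x ∧
      ∀ i, r (i + 1) = P.Aat z (k + i) (r i) + P.Bat z (k + i) (q i) :=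
  ⟨fun n => Nat.rec x (fun i y => P.Aat z (k + i) y + P.Bat z (k + i) (q i)) n, rfl, fun _ => rfl⟩

/-- From every state at stage `m` the dynamics can be continued up to stage `N` at a cost that
does not depend on the remaining horizon: if at least `t` stages remain, controllability allows to
reach the zero state and to stay there; otherwise zero controls will do. -/
theorem exists_tail (P : Problem nx nu N) (z : Primal nx nu N) {gamC U : ℝ} {t : ℕ}
    (hg : 0 < gamC) (hg1 : gamC ≤ 1) (hU : 2 ≤ U) (hA : ∀ k, ‖P.Aat z k‖ ≤ U)
    (hB : ∀ k, ‖P.Bat z k‖ ≤ U) (hctrl : P.ControllableAt gamC t z) {m : ℕ} (hm : m ≤ N)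
    (x : E nx) : ∃ (r : ℕ → E nx) (q : ℕ → E nu), r 0 = x ∧
      (∀ i, r (i + 1) = P.Aat z (m + i) (r i) + P.Bat z (m + i) (q i)) ∧
      ∑ i ∈ Finset.range (N - m), (‖r i‖ ^ 2 + ‖q i‖ ^ 2) + ‖r (N - m)‖ ^ 2
        ≤ steerConst gamC t U * ‖x‖ ^ 2 := by
  have hU0 : 0 ≤ U := by linarith
  have hU1 : 1 ≤ U := by linarith
  have hU2 : (2 : ℝ) ≤ U ^ 2 := by nlinarith
  -- a bound for the states from a bound for the controls
  have hstate : ∀ (r : ℕ → E nx) (q : ℕ → E nu) (Q : ℝ), r 0 = x →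
      (∀ i, r (i + 1) = P.Aat z (m + i) (r i) + P.Bat z (m + i) (q i)) → (∀ i, ‖q i‖ ≤ Q) →
      ∀ n ≤ t, ∑ i ∈ Finset.range n, ‖r i‖ ^ 2 ≤ U ^ (2 * t) * (2 * ‖x‖ ^ 2 + 8 * Q ^ 2) := by
    intro r q Q h0 hr hQ n hn
    have hQ0 : 0 ≤ Q := (norm_nonneg _).trans (hQ 0)
    have h1 : ∀ i, ‖r i‖ ^ 2 ≤ (U ^ 2) ^ i * (2 * ‖x‖ ^ 2 + 8 * Q ^ 2) := by
      intro i
      have h2 := norm_rollout_le P z hU hA hB m r q hr hQ i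
      rw [h0] at h2
      have h3 : ‖r i‖ ≤ U ^ i * (‖x‖ + 2 * Q) := by nlinarith
      calc ‖r i‖ ^ 2 ≤ (U ^ i * (‖x‖ + 2 * Q)) ^ 2 := by gcongr
        _ = (U ^ 2) ^ i * (‖x‖ + 2 * Q) ^ 2 := by rw [mul_pow, ← pow_mul, ← pow_mul, mul_comm i]
        _ ≤ _ := by
            gcongr
            nlinarith [sq_nonneg (‖x‖ - 2 * Q)]
    calc ∑ i ∈ Finset.range n, ‖r i‖ ^ 2
        ≤ ∑ i ∈ Finset.range n, (U ^ 2) ^ i * (2 * ‖x‖ ^ 2 + 8 * Q ^ 2) :=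
          Finset.sum_le_sum fun i _ => h1 i
      _ = (∑ i ∈ Finset.range n, (U ^ 2) ^ i) * (2 * ‖x‖ ^ 2 + 8 * Q ^ 2) := by
          rw [Finset.sum_mul]
      _ ≤ U ^ (2 * t) * (2 * ‖x‖ ^ 2 + 8 * Q ^ 2) := by
          gcongr
          calc _ ≤ (U ^ 2) ^ n := geom_sum_le_pow hU2 n
            _ ≤ (U ^ 2) ^ t := pow_le_pow_right₀ (by linarith) hn
            _ = U ^ (2 * t) := by rw [pow_mul]
  have hpow : U ^ (4 * t) = U ^ (2 * t) * U ^ (2 * t) := by rw [← pow_add]; congr 1; ring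
  have hp1 : 1 ≤ U ^ (2 * t) := one_le_pow₀ hU1
  have hx0 : 0 ≤ ‖x‖ ^ 2 := sq_nonneg _
  by_cases hmt : m + t ≤ N
  · obtain ⟨s, hs1, hst, hs⟩ := hctrl m hmt
    obtain ⟨v, hv, hvn⟩ := exists_preimage_of_adjoint_bound (P.ctrl z m s) hg
      (fun l => (hs l).trans_eq (inner_comp_adjoint_self _ _)) (-(P.prodA z m s x))
    set q : ℕ → E nu := fun i => if h : i < s then v ⟨s - 1 - i, by omega⟩ else 0 with hq
    obtain ⟨r, hr0, hr⟩ := exists_rollout P z m x q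
    have hqs : ∀ i, s ≤ i → q i = 0 := fun i hi => dif_neg (by omega)
    have hrs : r s = 0 := by
      rw [rollout_eq P z m r q hr s, hr0, Finset.sum_range]
      have : ∑ j : Fin s, P.prodA z (m + s - j) j (P.Bat z (m + s - 1 - j) (q (s - 1 - j)))
          = P.ctrl z m s v := by
        rw [ctrl_apply]
        refine Finset.sum_congr rfl fun j _ => ?_
        have hj := j.isLt
        have : q (s - 1 - j) = v j := by
          simp only [hq]
          rw [dif_pos (by omega)]
          exact congrArg v.ofLp (Fin.ext (by simp only; omega))
        rw [this]
      rw [this, hv, add_neg_cancel]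
    have hrs' : ∀ i, s ≤ i → r i = 0 := by
      intro i hi
      induction i, hi using Nat.le_induction with
      | base => exact hrs
      | succ i hi ih => rw [hr, ih, hqs i hi, map_zero, map_zero, add_zero]
    have hqsum : ∑ i ∈ Finset.range s, ‖q i‖ ^ 2 = ‖v‖ ^ 2 := by
      rw [PiLp.norm_sq_eq_of_L2, ← Finset.sum_range_reflect, Finset.sum_range]
      refine Finset.sum_congr rfl fun j _ => ?_
      have hj := j.isLt
      simp only [hq]
      rw [dif_pos (by omega)]
      exact congrArg (fun i => ‖v.ofLp i‖ ^ 2) (Fin.ext (by simp only; omega))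
    have hqv : ∀ i, ‖q i‖ ≤ ‖v‖ := by
      intro i
      simp only [hq]
      split_ifs with h
      · exact PiLp.norm_apply_le v _
      · simp
    have hQ : ‖v‖ ^ 2 ≤ U ^ (2 * t) / gamC * ‖x‖ ^ 2 := by
      rw [div_mul_eq_mul_div, le_div_iff₀ hg, mul_comm]
      refine hvn.trans ?_
      rw [norm_neg]
      calc ‖P.prodA z m s x‖ ^ 2 ≤ (U ^ s * ‖x‖) ^ 2 := by
            gcongr; exact norm_prodA_le P z hU0 hA m s x
        _ = U ^ (2 * s) * ‖x‖ ^ 2 := by rw [mul_pow, ← pow_mul, mul_comm s]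
        _ ≤ _ := by gcongr
    refine ⟨r, q, hr0, hr, ?_⟩
    have hsub : ∑ i ∈ Finset.range (N - m), (‖r i‖ ^ 2 + ‖q i‖ ^ 2)
        = ∑ i ∈ Finset.range s, (‖r i‖ ^ 2 + ‖q i‖ ^ 2) := by
      symm
      refine Finset.sum_subset (Finset.range_mono (by omega)) fun i _ hi => ?_
      have : s ≤ i := by simpa using hi
      rw [hrs' i this, hqs i this]; simp
    rw [hsub, hrs' (N - m) (by omega), Finset.sum_add_distrib, hqsum]
    have h1 := hstate r q ‖v‖ hr0 hr hqv s hst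
    unfold steerConst
    have h2 : U ^ (2 * t) * (8 * ‖v‖ ^ 2) ≤ U ^ (2 * t) * (8 * (U ^ (2 * t) / gamC * ‖x‖ ^ 2)) := by
      gcongr
    have h3 : 11 * U ^ (4 * t) / gamC * ‖x‖ ^ 2
        = 8 * (U ^ (2 * t) * (U ^ (2 * t) / gamC * ‖x‖ ^ 2))
          + 3 * (U ^ (2 * t) * (U ^ (2 * t) / gamC * ‖x‖ ^ 2)) := by rw [hpow]; ring
    have h4 : U ^ (2 * t) / gamC * ‖x‖ ^ 2 ≤ U ^ (2 * t) * (U ^ (2 * t) / gamC * ‖x‖ ^ 2) :=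
      le_mul_of_one_le_left (by positivity) hp1
    have h5 : U ^ (2 * t) * ‖x‖ ^ 2 ≤ U ^ (2 * t) / gamC * ‖x‖ ^ 2 := by
      gcongr
      rw [le_div_iff₀ hg]
      exact mul_le_of_le_one_right (by positivity) hg1
    simp only [norm_zero]
    nlinarith
  · obtain ⟨r, hr0, hr⟩ := exists_rollout P z m x (fun _ => 0)
    refine ⟨r, fun _ => 0, hr0, hr, ?_⟩
    have h1 := hstate r (fun _ => 0) 0 hr0 hr (fun _ => by simp) (N - m + 1) (by omega)
    rw [Finset.sum_range_succ] at h1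
    simp only [norm_zero, zero_pow two_ne_zero, add_zero, mul_zero] at h1 ⊢
    refine h1.trans ?_
    unfold steerConst
    have h2 : U ^ (2 * t) ≤ U ^ (4 * t) / gamC := by
      rw [le_div_iff₀ hg, hpow]
      calc U ^ (2 * t) * gamC ≤ U ^ (2 * t) * 1 := by gcongr
        _ ≤ _ := by gcongr
    have h3 : 0 ≤ U ^ (4 * t) / gamC := by positivity
    rw [mul_div_assoc]
    nlinarith

/-! ### Truncated problems, embedded into the full horizon -/

/-- Restriction of stagewise data to the stages in `[m₁, m₂)`, zero elsewhere. -/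
def truncSeq {F : Type*} [Zero F] (m1 m2 : ℕ) (a : Fin N → F) (k : Fin N) : F :=
  if m1 ≤ k ∧ (k : ℕ) < m2 then a k else 0

/-- The block `(x, u) ↦ (Q x + μ x, u)`, where `Q` is the upper left block of `H`. -/
def termBlock (H : StageVar nx nu →L[ℝ] StageVar nx nu) (mu : ℝ) :
    StageVar nx nu →L[ℝ] StageVar nx nu :=
  let e := WithLp.prodContinuousLinearEquiv 2 ℝ (E nx) (E nu)
  (e.symm : _ →L[ℝ] StageVar nx nu).comp
    ((((WithLp.fstL 2 ℝ (E nx) (E nu)).comp (H.comp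
      ((e.symm : _ →L[ℝ] StageVar nx nu).comp (ContinuousLinearMap.inl ℝ (E nx) (E nu))))
        + mu • ContinuousLinearMap.id ℝ (E nx)).prodMap (ContinuousLinearMap.id ℝ (E nu))).comp
      (e : StageVar nx nu →L[ℝ] _))

theorem termBlock_apply (H : StageVar nx nu →L[ℝ] StageVar nx nu) (mu : ℝ) (v : StageVar nx nu) :
    termBlock H mu v
      = WithLp.toLp 2 ((H (WithLp.toLp 2 (v.fst, 0))).fst + mu • v.fst, v.snd) := rfl

/-- The Hessian blocks of the problem truncated to `[m₁, m₂]`, extended to all stages: identity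
blocks outside of `[m₁, m₂]`, where the problem is decoupled, and, if `m₂ < N`, the terminal block
`Q + μ I` for `x_{m₂}`. -/
def truncHess (K : BlockHess nx nu N) (mu : ℝ) (m1 m2 : ℕ) : BlockHess nx nu N where
  stage k := if m1 ≤ k ∧ (k : ℕ) < m2 then K.stage k
    else if (k : ℕ) = m2 then termBlock (K.stage k) mu else ContinuousLinearMap.id ℝ _
  term := if m2 = N then K.term else ContinuousLinearMap.id ℝ _

theorem norm_toLp_zero_le (x : E nx) : ‖(WithLp.toLp 2 (x, 0) : StageVar nx nu)‖ = ‖x‖ :=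
  WithLp.norm_toLp_fst 2 (E nx) (E nu) x

theorem norm_fst_le (v : StageVar nx nu) : ‖v.fst‖ ≤ ‖v‖ := by
  refine le_of_sq_le_sq ?_ (norm_nonneg _)
  rw [norm_sq_stageVar v]; nlinarith [sq_nonneg ‖v.snd‖]

theorem norm_snd_le (v : StageVar nx nu) : ‖v.snd‖ ≤ ‖v‖ := by
  refine le_of_sq_le_sq ?_ (norm_nonneg _)
  rw [norm_sq_stageVar v]; nlinarith [sq_nonneg ‖v.fst‖]

theorem norm_fst_apply_toLp_le {H : StageVar nx nu →L[ℝ] StageVar nx nu} {U : ℝ} (hH : ‖H‖ ≤ U)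
    (x : E nx) : ‖(H (WithLp.toLp 2 (x, 0))).fst‖ ≤ U * ‖x‖ := by
  refine (norm_fst_le _).trans ((H.le_of_opNorm_le hH _).trans_eq ?_)
  rw [norm_toLp_zero_le]

theorem norm_termBlock_le {H : StageVar nx nu →L[ℝ] StageVar nx nu} {mu U : ℝ} (hU : 1 ≤ U)
    (hmu : 0 ≤ mu) (hH : ‖H‖ ≤ U) : ‖termBlock H mu‖ ≤ U + mu := by
  refine ContinuousLinearMap.opNorm_le_bound _ (by linarith) fun v => ?_
  refine le_of_sq_le_sq ?_ (by positivity)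
  have h1 : ‖(H (WithLp.toLp 2 (v.fst, 0))).fst + mu • v.fst‖ ≤ (U + mu) * ‖v.fst‖ := by
    refine (norm_add_le _ _).trans ?_
    rw [norm_smul, Real.norm_of_nonneg hmu, add_mul]
    gcongr
    exact norm_fst_apply_toLp_le hH _
  have h2 := pow_le_pow_left₀ (norm_nonneg _) h1 2
  have h3 : (1 : ℝ) ≤ (U + mu) ^ 2 := one_le_pow₀ (by linarith)
  have h4 : ‖termBlock H mu v‖ ^ 2
      = ‖(H (WithLp.toLp 2 (v.fst, 0))).fst + mu • v.fst‖ ^ 2 + ‖v.snd‖ ^ 2 := by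
    rw [norm_sq_stageVar, termBlock_apply]; rfl
  rw [h4, mul_pow, norm_sq_stageVar v, mul_add]
  nlinarith [sq_nonneg ‖v.snd‖]

theorem norm_truncHess_le {K : BlockHess nx nu N} {mu U : ℝ} (hU : 1 ≤ U) (hmu : 0 ≤ mu)
    (h1 : ∀ k, ‖K.stage k‖ ≤ U) (h2 : ‖K.term‖ ≤ U) (m1 m2 : ℕ) :
    ‖(truncHess K mu m1 m2).toCLM‖ ≤ U + mu := by
  have hid : ∀ {F : Type} [NormedAddCommGroup F] [NormedSpace ℝ F],
      ‖ContinuousLinearMap.id ℝ F‖ ≤ U + mu := fun {F} _ _ =>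
    ContinuousLinearMap.norm_id_le.trans (by linarith)
  refine BlockHess.norm_toCLM_le _ (by linarith) (fun k => ?_) ?_
  · simp only [truncHess]
    split_ifs
    · exact (h1 k).trans (by linarith)
    · exact norm_termBlock_le hU hmu (h1 k)
    · exact hid
  · simp only [truncHess]
    split_ifs
    · exact h2.trans (by linarith)
    · exact hid

theorem norm_truncSeq_le {F : Type*} [NormedAddCommGroup F] {a : Fin N → F} {c : ℝ} (hc : 0 ≤ c)
    (h : ∀ k, ‖a k‖ ≤ c) (m1 m2 : ℕ) (k : Fin N) : ‖truncSeq m1 m2 a k‖ ≤ c := by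
  unfold truncSeq
  split_ifs
  · exact h _
  · simpa using hc

theorem seqExt_truncSeq {F : Type*} [Zero F] (a : Fin N → F) {m1 m2 k : ℕ} (h1 : m1 ≤ k)
    (h2 : k < m2) : seqExt (truncSeq m1 m2 a) k = seqExt a k := by
  simp [seqExt, truncSeq, h1, h2]

theorem seqExt_truncSeq_of_not {F : Type*} [Zero F] (a : Fin N → F) {m1 m2 k : ℕ}
    (h : ¬ (m1 ≤ k ∧ k < m2)) : seqExt (truncSeq m1 m2 a) k = 0 := by
  simp [seqExt, truncSeq, h]

/-- The linearized dynamics at `z`, in the order of stages. -/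
theorem seqExt_A (P : Problem nx nu N) (z : Primal nx nu N) :
    seqExt (fun k => P.A k (z.fst k)) = P.Aat z := rfl

theorem seqExt_B (P : Problem nx nu N) (z : Primal nx nu N) :
    seqExt (fun k => P.B k (z.fst k)) = P.Bat z := rfl

/-- Truncation keeps observability: a window of length `t` that does not fit into `[m₁, m₂]` meets a
stage where the truncated dynamics vanish. -/
theorem uniformlyObservable_trunc (P : Problem nx nu N) (z : Primal nx nu N) {gamC : ℝ} {t : ℕ}
    (ht : 0 < t) (hctrl : P.ControllableAt gamC t z) {m1 m2 : ℕ} (hm2 : m2 ≤ N) :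
    UniformlyObservable (seqExt (truncSeq m1 m2 fun k => P.A k (z.fst k)))
      (seqExt (truncSeq m1 m2 fun k => P.B k (z.fst k))) gamC t := by
  intro j
  by_cases hj : m1 ≤ j ∧ j < m2
  · by_cases hjt : j + t ≤ m2
    · obtain ⟨s, hs1, hst, hs⟩ := hctrl j (by omega)
      refine Or.inr ⟨s, hst, (observableWindow_of_ctrl P z hs).congr (fun i hi => ?_)
        (fun i hi => ?_)⟩
      · rw [seqExt_truncSeq _ (by omega) (by omega), seqExt_A]
      · rw [seqExt_truncSeq _ (by omega) (by omega), seqExt_B]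
    · exact Or.inl ⟨m2 - j, by omega, seqExt_truncSeq_of_not _ (by omega)⟩
  · exact Or.inl ⟨0, ht, seqExt_truncSeq_of_not _ (by simpa using hj)⟩

theorem truncSeq_full {F : Type*} [Zero F] (a : Fin N → F) : truncSeq 0 N a = a := by
  funext k
  simp [truncSeq]

theorem uniformlyObservable_full (P : Problem nx nu N) (z : Primal nx nu N) {gamC : ℝ} {t : ℕ}
    (ht : 0 < t) (hctrl : P.ControllableAt gamC t z) :
    UniformlyObservable (seqExt fun k => P.A k (z.fst k)) (seqExt fun k => P.B k (z.fst k))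
      gamC t := by
  have := uniformlyObservable_trunc P z ht hctrl (m1 := 0) (le_refl N)
  rwa [truncSeq_full, truncSeq_full] at this

theorem sum_fin_ite_le_eq (f : ℕ → ℝ) {m : ℕ} (hm : m ≤ N) :
    ∑ k : Fin N, (if m ≤ (k : ℕ) then f (k - m) else 0) = ∑ i ∈ Finset.range (N - m), f i := by
  obtain ⟨n, rfl⟩ := Nat.exists_eq_add_of_le hm
  rw [← Finset.sum_range (fun k => if m ≤ k then f (k - m) else 0), Finset.sum_range_add,
    Finset.sum_eq_zero, zero_add, Nat.add_sub_cancel_left]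
  · refine Finset.sum_congr rfl fun i _ => ?_
    rw [if_pos (Nat.le_add_right m i), Nat.add_sub_cancel_left]
  · intro k hk
    rw [if_neg (by simpa using hk)]

/-- A feasible direction `v` of the problem truncated to `[m₁, m₂]` extends to a feasible
direction of the full problem, which vanishes before `m₁` and whose part after `m₂` has a cost of
the order of `‖x_{m₂}‖²`. -/
theorem exists_feasible_extension (P : Problem nx nu N) (z : Primal nx nu N)
    (hf : ∀ k, DifferentiableAt ℝ (P.f k) (z.fst k)) {gamC U : ℝ} {t : ℕ}
    (hg : 0 < gamC) (hg1 : gamC ≤ 1) (hU : 2 ≤ U)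
    (hctrl : P.ControllableAt gamC t z)
    (hA : ∀ k, ‖P.A k (z.fst k)‖ ≤ U) (hB : ∀ k, ‖P.B k (z.fst k)‖ ≤ U)
    {m1 m2 : ℕ} (hm : m1 < m2) (hm2 : m2 ≤ N) (v : Primal nx nu N)
    (hv : dynOp (truncSeq m1 m2 fun k => P.A k (z.fst k))
      (truncSeq m1 m2 fun k => P.B k (z.fst k)) v = 0) :
    ∃ (r : ℕ → E nx) (q : ℕ → E nu) (v' : Primal nx nu N),
      r 0 = state v ⟨m2, Nat.lt_succ_of_le hm2⟩ ∧
      ∑ i ∈ Finset.range (N - m2), (‖r i‖ ^ 2 + ‖q i‖ ^ 2) + ‖r (N - m2)‖ ^ 2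
        ≤ steerConst gamC t U * ‖state v ⟨m2, Nat.lt_succ_of_le hm2⟩‖ ^ 2 ∧
      (∀ k : Fin N, v'.fst k = if (k : ℕ) < m1 then 0 else if (k : ℕ) < m2 then v.fst k
        else (WithLp.toLp 2 (r (k - m2), q (k - m2)) : StageVar nx nu)) ∧
      v'.snd = r (N - m2) ∧ P.jac z v' = 0 := by
  have hU0 : 0 ≤ U := by linarith
  have hv0 : state v 0 = 0 := by
    rw [← dynOp_zero (truncSeq m1 m2 fun k => P.A k (z.fst k))
      (truncSeq m1 m2 fun k => P.B k (z.fst k)), hv]; rfl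
  have hvin : ∀ k : Fin N, m1 ≤ k → (k : ℕ) < m2 → state v k.succ
      = P.A k (z.fst k) (v.fst k).fst + P.B k (z.fst k) (v.fst k).snd := by
    intro k h1 h2
    have := dynOp_succ (truncSeq m1 m2 fun k => P.A k (z.fst k))
      (truncSeq m1 m2 fun k => P.B k (z.fst k)) v k
    rw [hv] at this
    simp only [truncSeq, if_pos (And.intro h1 h2)] at this
    exact sub_eq_zero.1 this.symm
  have hvout : ∀ k : Fin N, ¬ (m1 ≤ k ∧ (k : ℕ) < m2) → state v k.succ = 0 := by
    intro k h
    have := dynOp_succ (truncSeq m1 m2 fun k => P.A k (z.fst k))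
      (truncSeq m1 m2 fun k => P.B k (z.fst k)) v k
    rw [hv] at this
    simp only [truncSeq, if_neg h] at this
    simpa using this.symm
  set x := state v ⟨m2, by omega⟩ with hx
  -- continuation of the trajectory after stage `m2`; nothing is to be done if `m2 = N`
  obtain ⟨r, q, hr0, hr, hcost⟩ := exists_tail P z hg hg1 hU
    (norm_seqExt_le hU0 hA) (norm_seqExt_le hU0 hB) hctrl hm2 x
  set v' : Primal nx nu N := WithLp.toLp 2 (WithLp.toLp 2 (fun k : Fin N =>
    if (k : ℕ) < m1 then 0 else if (k : ℕ) < m2 then v.fst k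
      else (WithLp.toLp 2 (r (k - m2), q (k - m2)) : StageVar nx nu)), r (N - m2)) with hv'
  have hv'k : ∀ k : Fin N, v'.fst k = if (k : ℕ) < m1 then 0 else if (k : ℕ) < m2 then v.fst k
      else (WithLp.toLp 2 (r (k - m2), q (k - m2)) : StageVar nx nu) := fun _ => rfl
  have hv'N : v'.snd = r (N - m2) := rfl
  have hst : ∀ k : Fin (N + 1), state v' k = if (k : ℕ) < m1 then 0
      else if (k : ℕ) < m2 then state v k else r (k - m2) := by
    intro k
    refine Fin.lastCases ?_ (fun j => ?_) k
    · rw [state_last, hv'N, Fin.val_last, if_neg (by omega), if_neg (by omega)]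
    · rw [state_castSucc, state_castSucc, hv'k, Fin.val_castSucc]
      split_ifs <;> rfl
  refine ⟨r, q, v', hr0, hcost, hv'k, hv'N, ?_⟩
  rw [jac_eq_dynOp P z hf]
  ext1 k
  refine Fin.cases ?_ (fun j => ?_) k
  · rw [dynOp_zero, hst, PiLp.zero_apply, hv0, Fin.val_zero]
    split_ifs with h1 h2
    · rfl
    · rfl
    · omega
  · rw [dynOp_succ, hst, hv'k, PiLp.zero_apply, Fin.val_succ]
    by_cases h1 : (j : ℕ) < m1
    · rw [if_pos h1]
      have : state v j.succ = 0 := hvout j (by omega)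
      have h2 : (j : ℕ) + 1 < m2 := by omega
      simp [this, h2]
    · by_cases h2 : (j : ℕ) < m2
      · rw [if_neg h1, if_pos h2, if_neg (by omega)]
        have h3 := hvin j (by omega) h2
        have h4 : (if (j : ℕ) + 1 < m2 then state v j.succ else r (j + 1 - m2))
            = state v j.succ := by
          split_ifs with h5
          · rfl
          · have e : (j : ℕ) + 1 = m2 := by omega
            rw [show (j : ℕ) + 1 - m2 = 0 by omega, hr0, hx]
            congr 1
            ext1
            simp [e]
        rw [h4, h3, sub_self]
      · rw [if_neg h1, if_neg h2, if_neg (by omega), if_neg (by omega),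
          show (j : ℕ) + 1 - m2 = (j - m2) + 1 by omega, hr,
          show m2 + ((j : ℕ) - m2) = j by omega]
        have e1 : P.Aat z j = P.A j (z.fst j) := seqExt_coe (fun k => P.A k (z.fst k)) j
        have e2 : P.Bat z j = P.B j (z.fst j) := seqExt_coe (fun k => P.B k (z.fst k)) j
        rw [e1, e2]
        exact sub_self _

/-- The reduced Hessian of a truncated problem is positive definite, uniformly in the truncation:
a feasible direction of the truncated problem extends to one of the full problem, and the
penalty `μ` pays for the Hessian along the extension. -/
theorem trunc_coercive (P : Problem nx nu N) (K : BlockHess nx nu N) (z : Primal nx nu N)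
    (hf : ∀ k, DifferentiableAt ℝ (P.f k) (z.fst k)) {gamRH gamC U mu : ℝ} {t : ℕ}
    (hg : 0 < gamC) (hg1 : gamC ≤ 1) (hU : 2 ≤ U) (hRH0 : 0 < gamRH)
    (hRH : ∀ v, P.jac z v = 0 → gamRH * ‖v‖ ^ 2 ≤ ⟪v, K.toCLM v⟫_ℝ)
    (hctrl : P.ControllableAt gamC t z)
    (hK : ∀ k, ‖K.stage k‖ ≤ U) (hKN : ‖K.term‖ ≤ U)
    (hA : ∀ k, ‖P.A k (z.fst k)‖ ≤ U) (hB : ∀ k, ‖P.B k (z.fst k)‖ ≤ U)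
    (hmu : U + U * steerConst gamC t U ≤ mu) {m1 m2 : ℕ} (hm : m1 < m2) (hm2 : m2 ≤ N)
    (v : Primal nx nu N)
    (hv : dynOp (truncSeq m1 m2 fun k => P.A k (z.fst k))
      (truncSeq m1 m2 fun k => P.B k (z.fst k)) v = 0) :
    min gamRH 1 * ‖v‖ ^ 2 ≤ ⟪v, (truncHess K mu m1 m2).toCLM v⟫_ℝ := by
  have hU0 : 0 ≤ U := by linarith
  set c := min gamRH 1 with hc
  have hc0 : 0 < c := lt_min hRH0 one_pos
  have hcg : c ≤ gamRH := min_le_left _ _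
  have hc1 : c ≤ 1 := min_le_right _ _
  obtain ⟨r, q, v', hr0, hcost, hv'k, hv'N, hfeas⟩ :=
    exists_feasible_extension P z hf hg hg1 hU hctrl hA hB hm hm2 v hv
  set x := state v ⟨m2, Nat.lt_succ_of_le hm2⟩ with hx
  have hpos := hRH v' hfeas
  rw [BlockHess.inner_toCLM, norm_sq_primal, hv'N] at hpos
  rw [BlockHess.inner_toCLM, norm_sq_primal]
  have hquad : ∀ {F : Type} [NormedAddCommGroup F] [InnerProductSpace ℝ F] (T : F →L[ℝ] F),
      ‖T‖ ≤ U → ∀ y, |⟪y, T y⟫_ℝ| ≤ U * ‖y‖ ^ 2 := by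
    intro F _ _ T hT y
    calc |⟪y, T y⟫_ℝ| ≤ ‖y‖ * ‖T y‖ := abs_real_inner_le_norm _ _
      _ ≤ ‖y‖ * (U * ‖y‖) := by gcongr; exact T.le_of_opNorm_le hT y
      _ = _ := by ring
  -- comparison of the two quadratic forms, stage by stage
  have hstage : ∀ k : Fin N, ⟪v'.fst k, K.stage k (v'.fst k)⟫_ℝ - gamRH * ‖v'.fst k‖ ^ 2
      ≤ (⟪v.fst k, (truncHess K mu m1 m2).stage k (v.fst k)⟫_ℝ - c * ‖v.fst k‖ ^ 2)
        + ((if m2 ≤ (k : ℕ) then U * (‖r (k - m2)‖ ^ 2 + ‖q (k - m2)‖ ^ 2) else 0)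
          - (if (k : ℕ) = m2 then (mu - U) * ‖x‖ ^ 2 else 0)) := by
    intro k
    have hid : ∀ y : StageVar nx nu,
        0 ≤ ⟪y, ContinuousLinearMap.id ℝ (StageVar nx nu) y⟫_ℝ - c * ‖y‖ ^ 2 := by
      intro y
      rw [ContinuousLinearMap.id_apply, real_inner_self_eq_norm_sq]
      nlinarith [sq_nonneg ‖y‖]
    rw [hv'k]
    simp only [truncHess]
    by_cases h1 : (k : ℕ) < m1
    · rw [if_pos h1, if_neg (show ¬(m1 ≤ (k : ℕ) ∧ (k : ℕ) < m2) by omega),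
        if_neg (show ¬(k : ℕ) = m2 by omega), if_neg (show ¬ m2 ≤ (k : ℕ) by omega),
        if_neg (show ¬(k : ℕ) = m2 by omega)]
      have := hid (v.fst k)
      simp only [map_zero, inner_zero_left, norm_zero]
      linarith
    by_cases h2 : (k : ℕ) < m2
    · rw [if_neg h1, if_pos h2, if_pos (show m1 ≤ (k : ℕ) ∧ (k : ℕ) < m2 by omega),
        if_neg (show ¬ m2 ≤ (k : ℕ) by omega), if_neg (show ¬(k : ℕ) = m2 by omega)]
      have p1 : c * ‖v.fst k‖ ^ 2 ≤ gamRH * ‖v.fst k‖ ^ 2 := by gcongr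
      linarith
    rw [if_neg h1, if_neg h2, if_neg (show ¬(m1 ≤ (k : ℕ) ∧ (k : ℕ) < m2) by omega),
      if_pos (show m2 ≤ (k : ℕ) by omega)]
    set y : StageVar nx nu := WithLp.toLp 2 (r (k - m2), q (k - m2)) with hy
    have hyn : ‖y‖ ^ 2 = ‖r (k - m2)‖ ^ 2 + ‖q (k - m2)‖ ^ 2 := by
      rw [norm_sq_stageVar]; rfl
    have h3 := (abs_le.1 (hquad (K.stage k) (hK k) y)).2
    rw [hyn] at h3 ⊢
    by_cases h4 : (k : ℕ) = m2
    · rw [if_pos h4, if_pos h4, termBlock_apply]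
      have h5 : r (k - m2) = x := by rw [h4, Nat.sub_self, hr0]
      have h6 : (v.fst k).fst = x := by
        rw [hx, ← state_castSucc]
        congr 1
        ext1
        simpa using h4
      have h7 : ⟪v.fst k, (WithLp.toLp 2 ((K.stage k (WithLp.toLp 2 ((v.fst k).fst, 0))).fst
          + mu • (v.fst k).fst, (v.fst k).snd) : StageVar nx nu)⟫_ℝ
          = ⟪x, (K.stage k (WithLp.toLp 2 (x, 0))).fst⟫_ℝ + mu * ‖x‖ ^ 2
            + ‖(v.fst k).snd‖ ^ 2 := by
        rw [inner_stageVar]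
        change ⟪(v.fst k).fst, (K.stage k (WithLp.toLp 2 ((v.fst k).fst, 0))).fst
          + mu • (v.fst k).fst⟫_ℝ + ⟪(v.fst k).snd, (v.fst k).snd⟫_ℝ = _
        rw [h6, inner_add_right, inner_smul_right, real_inner_self_eq_norm_sq,
          real_inner_self_eq_norm_sq]
      have h8 : |⟪x, (K.stage k (WithLp.toLp 2 (x, 0))).fst⟫_ℝ| ≤ U * ‖x‖ ^ 2 := by
        calc _ ≤ ‖x‖ * ‖(K.stage k (WithLp.toLp 2 (x, 0))).fst‖ := abs_real_inner_le_norm _ _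
          _ ≤ ‖x‖ * (U * ‖x‖) := by gcongr; exact norm_fst_apply_toLp_le (hK k) x
          _ = _ := by ring
      have h9 := (abs_le.1 h8).1
      rw [h7, norm_sq_stageVar (v.fst k), h6, h5]
      rw [h5] at h3
      have p1 : c * ‖x‖ ^ 2 ≤ gamRH * ‖x‖ ^ 2 := by gcongr
      have p2 : 0 ≤ gamRH * ‖q (k - m2)‖ ^ 2 := by positivity
      have p3 : c * ‖(v.fst k).snd‖ ^ 2 ≤ 1 * ‖(v.fst k).snd‖ ^ 2 := by gcongr
      linarith
    · rw [if_neg h4, if_neg h4]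
      have := hid (v.fst k)
      have p1 : 0 ≤ gamRH * (‖r (k - m2)‖ ^ 2 + ‖q (k - m2)‖ ^ 2) := by positivity
      linarith
  have hsum := Finset.sum_le_sum fun k (_ : k ∈ Finset.univ) => hstage k
  simp only [Finset.sum_sub_distrib, Finset.sum_add_distrib, ← Finset.mul_sum] at hsum
  rw [sum_fin_ite_le_eq (fun i => U * (‖r i‖ ^ 2 + ‖q i‖ ^ 2)) hm2, ← Finset.mul_sum] at hsum
  simp only [truncHess] at hsum ⊢
  rcases eq_or_lt_of_le hm2 with h | h
  · have hr' : r (N - m2) = v.snd := by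
      rw [h, Nat.sub_self, hr0, hx, ← state_last]
      congr 1
      ext1
      simp [h]
    have e1 : ∑ k : Fin N, (if (k : ℕ) = m2 then (mu - U) * ‖x‖ ^ 2 else 0) = 0 :=
      Finset.sum_eq_zero fun k _ => if_neg (by have := k.isLt; omega)
    have e2 : ∑ i ∈ Finset.range (N - m2), (‖r i‖ ^ 2 + ‖q i‖ ^ 2) = 0 := by
      rw [h, Nat.sub_self, Finset.sum_range_zero]
    rw [if_pos h]
    rw [hr'] at hpos
    rw [e1, e2] at hsum
    have p1 : c * ‖v.snd‖ ^ 2 ≤ gamRH * ‖v.snd‖ ^ 2 := by gcongr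
    linarith
  · have e1 : ∑ k : Fin N, (if (k : ℕ) = m2 then (mu - U) * ‖x‖ ^ 2 else 0)
        = (mu - U) * ‖x‖ ^ 2 := by
      rw [Finset.sum_eq_single (⟨m2, h⟩ : Fin N)]
      · simp
      · intro k _ hk
        exact if_neg fun h' => hk (Fin.ext h')
      · simp
    rw [if_neg h.ne, ContinuousLinearMap.id_apply, real_inner_self_eq_norm_sq]
    rw [e1] at hsum
    have h1 := (abs_le.1 (hquad K.term hKN (r (N - m2)))).2
    have h2 := mul_le_mul_of_nonneg_left hcost hU0
    have h3 : U * steerConst gamC t U * ‖x‖ ^ 2 ≤ (mu - U) * ‖x‖ ^ 2 := by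
      gcongr; linarith
    have p1 : c * ‖v.snd‖ ^ 2 ≤ 1 * ‖v.snd‖ ^ 2 := by gcongr
    have p2 : 0 ≤ gamRH * ‖r (N - m2)‖ ^ 2 := by positivity
    linarith

/-- The threshold for the penalty pays for the steering cost, weighted with the bound `U` for the
Hessian blocks, and for the indefinite block at the terminal stage. -/
theorem steerConst_le_muBar {gamC U : ℝ} {t : ℕ} (hg : 0 < gamC) (hg1 : gamC ≤ 1) (hU : 2 ≤ U) :
    U + U * steerConst gamC t U ≤ muBar gamC t U := by
  unfold steerConst muBar
  have h0 : 0 ≤ U := by linarith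
  have h1 : U * 1 ≤ U * (U ^ (4 * t) / gamC) := by
    gcongr
    rw [le_div_iff₀ hg, one_mul]
    exact hg1.trans (one_le_pow₀ (by linarith))
  have h2 : U * (11 * U ^ (4 * t) / gamC) = 11 * (U * (U ^ (4 * t) / gamC)) := by ring
  have h3 : 32 * U ^ (4 * t + 1) / gamC = 32 * (U * (U ^ (4 * t) / gamC)) := by
    rw [pow_succ]; ring
  rw [h2, h3]
  linarith

/-! ### Stability of the full and the truncated saddle point systems -/

theorem norm_le_norm_add_norm (w : PrimalDual nx nu N) : ‖w‖ ≤ ‖w.fst‖ + ‖w.snd‖ := by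
  refine le_of_sq_le_sq ?_ (by positivity)
  rw [norm_sq_primalDual]
  nlinarith [norm_nonneg w.fst, norm_nonneg w.snd]

theorem norm_primalDual_fst_le (w : PrimalDual nx nu N) : ‖w.fst‖ ≤ ‖w‖ := by
  refine le_of_sq_le_sq ?_ (norm_nonneg _)
  rw [norm_sq_primalDual w]; nlinarith [sq_nonneg ‖w.snd‖]

theorem norm_primalDual_snd_le (w : PrimalDual nx nu N) : ‖w.snd‖ ≤ ‖w‖ := by
  refine le_of_sq_le_sq ?_ (norm_nonneg _)
  rw [norm_sq_primalDual w]; nlinarith [sq_nonneg ‖w.fst‖]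

theorem norm_le_mul_norm_lqKKT {A : Fin N → E nx →L[ℝ] E nx} {B : Fin N → E nu →L[ℝ] E nx}
    {K : BlockHess nx nu N} {g γ h : ℝ} (hg : 0 < g) (hγ : 0 < γ) (hh : 0 ≤ h)
    (hG : ∀ l, g * ‖l‖ ^ 2 ≤ ‖(dynOp A B).adjoint l‖ ^ 2)
    (hH : ∀ v, dynOp A B v = 0 → γ * ‖v‖ ^ 2 ≤ ⟪v, K.toCLM v⟫_ℝ) (hn : ‖K.toCLM‖ ≤ h)
    (w : PrimalDual nx nu N) : ‖w‖ ≤ saddleConst (1 / √g) γ h * ‖lqKKT A B K w‖ :=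
  (norm_le_norm_add_norm w).trans
    (saddle_bound (dynOp A B) K.toCLM hg hγ hh hG hH hn w.fst w.snd
      (norm_primalDual_fst_le (lqKKT A B K w)) (norm_primalDual_snd_le (lqKKT A B K w)))

/-- The stability constant of the truncated problems; it depends neither on the horizon nor on the
truncation. -/
def truncConst (gamRH gamC : ℝ) (t : ℕ) (U mu : ℝ) : ℝ :=
  saddleConst (1 / √(gammaG gamC t U)) (min gamRH 1) (U + mu)

/-- The truncated saddle point matrices have uniformly bounded inverses: their constraints are
observable, and their Hessians are positive definite on the null spaces of the constraints. -/
theorem trunc_stable (P : Problem nx nu N) (K : BlockHess nx nu N) (z : Primal nx nu N)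
    (hf : ∀ k, DifferentiableAt ℝ (P.f k) (z.fst k)) {gamRH gamC U mu : ℝ} {t : ℕ} (ht : 0 < t)
    (hg : 0 < gamC) (hg1 : gamC ≤ 1) (hU : 2 ≤ U) (hRH0 : 0 < gamRH)
    (hRH : ∀ v, P.jac z v = 0 → gamRH * ‖v‖ ^ 2 ≤ ⟪v, K.toCLM v⟫_ℝ)
    (hctrl : P.ControllableAt gamC t z)
    (hK : ∀ k, ‖K.stage k‖ ≤ U) (hKN : ‖K.term‖ ≤ U)
    (hA : ∀ k, ‖P.A k (z.fst k)‖ ≤ U) (hB : ∀ k, ‖P.B k (z.fst k)‖ ≤ U)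
    (hmu : muBar gamC t U ≤ mu) {m1 m2 : ℕ} (hm : m1 < m2) (hm2 : m2 ≤ N)
    (w : PrimalDual nx nu N) :
    ‖w‖ ≤ truncConst gamRH gamC t U mu * ‖lqKKT (truncSeq m1 m2 fun k => P.A k (z.fst k))
      (truncSeq m1 m2 fun k => P.B k (z.fst k)) (truncHess K mu m1 m2) w‖ := by
  have hU0 : 0 ≤ U := by linarith
  have hmu' := (steerConst_le_muBar (t := t) hg hg1 hU).trans hmu
  have hmu0 : 0 ≤ mu := by
    have : 0 ≤ steerConst gamC t U := by unfold steerConst; positivity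
    nlinarith
  have h1 := gammaG_mul_le_norm_adjoint hg hg1 hU (norm_truncSeq_le hU0 hA m1 m2)
    (norm_truncSeq_le hU0 hB m1 m2) (uniformlyObservable_trunc P z ht hctrl hm2)
  have h2 : ∀ v, dynOp (truncSeq m1 m2 fun k => P.A k (z.fst k))
      (truncSeq m1 m2 fun k => P.B k (z.fst k)) v = 0 →
      min gamRH 1 * ‖v‖ ^ 2 ≤ ⟪v, (truncHess K mu m1 m2).toCLM v⟫_ℝ := fun v hv =>
    trunc_coercive P K z hf hg hg1 hU hRH0 hRH hctrl hK hKN hA hB hmu' hm hm2 v hv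
  have h3 := norm_truncHess_le (by linarith) hmu0 hK hKN m1 m2
  have h4 : 0 ≤ U + mu := by linarith
  have h5 : 0 < min gamRH 1 := lt_min hRH0 one_pos
  rw [truncConst]
  generalize truncSeq m1 m2 (fun k => P.A k (z.fst k)) = A at *
  generalize truncSeq m1 m2 (fun k => P.B k (z.fst k)) = B at *
  generalize truncHess K mu m1 m2 = K' at *
  exact norm_le_mul_norm_lqKKT (gammaG_pos t hg hU) h5 h4 h1 h2 h3 w

/-- `G Gᵀ ⪰ γ_G I` for the Jacobian of the constraints. -/
theorem gammaG_mul_le_norm_jac_adjoint (P : Problem nx nu N) (z : Primal nx nu N)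
    (hf : ∀ k, DifferentiableAt ℝ (P.f k) (z.fst k)) {gamC U : ℝ} {t : ℕ} (ht : 0 < t)
    (hg : 0 < gamC) (hg1 : gamC ≤ 1) (hU : 2 ≤ U) (hctrl : P.ControllableAt gamC t z)
    (hA : ∀ k, ‖P.A k (z.fst k)‖ ≤ U) (hB : ∀ k, ‖P.B k (z.fst k)‖ ≤ U) (l : Dual nx N) :
    gammaG gamC t U * ‖l‖ ^ 2 ≤ ‖(P.jac z).adjoint l‖ ^ 2 := by
  rw [jac_eq_dynOp P z hf]
  exact gammaG_mul_le_norm_adjoint hg hg1 hU hA hB (uniformlyObservable_full P z ht hctrl) l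

/-- The saddle point matrix of the full problem has a bounded inverse. -/
theorem kkt_stable (P : Problem nx nu N) (K : BlockHess nx nu N) (z : Primal nx nu N)
    (hf : ∀ k, DifferentiableAt ℝ (P.f k) (z.fst k)) {gamRH gamC U : ℝ} {t : ℕ} (ht : 0 < t)
    (hg : 0 < gamC) (hg1 : gamC ≤ 1) (hU : 2 ≤ U) (hRH0 : 0 < gamRH)
    (hRH : ∀ v, P.jac z v = 0 → gamRH * ‖v‖ ^ 2 ≤ ⟪v, K.toCLM v⟫_ℝ)
    (hctrl : P.ControllableAt gamC t z)
    (hK : ∀ k, ‖K.stage k‖ ≤ U) (hKN : ‖K.term‖ ≤ U)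
    (hA : ∀ k, ‖P.A k (z.fst k)‖ ≤ U) (hB : ∀ k, ‖P.B k (z.fst k)‖ ≤ U)
    (w : PrimalDual nx nu N) :
    ‖w‖ ≤ saddleConst (1 / √(gammaG gamC t U)) gamRH U * ‖P.kkt K z w‖ := by
  rw [kkt_eq_lqKKT P K z hf]
  refine norm_le_mul_norm_lqKKT (gammaG_pos t hg hU) hRH0 (by linarith)
    (gammaG_mul_le_norm_adjoint hg hg1 hU hA hB (uniformlyObservable_full P z ht hctrl))
    (fun v hv => hRH v (by rw [jac_eq_dynOp P z hf, hv]))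
    (BlockHess.norm_toCLM_le K (by linarith) hK hKN) w

/-! ### The error of a subproblem solution -/

theorem hasGradientAt_quadratic {F : Type*} [NormedAddCommGroup F] [InnerProductSpace ℝ F]
    [CompleteSpace F] (T : F →L[ℝ] F) (hT : ∀ x y, ⟪T x, y⟫_ℝ = ⟪x, T y⟫_ℝ) (b p : F) :
    HasGradientAt (fun p => 1 / 2 * ⟪p, T p⟫_ℝ + ⟪b, p⟫_ℝ) (T p + b) p := by
  rw [hasGradientAt_iff_hasFDerivAt]
  have h1 : HasFDerivAt (fun p => ⟪p, T p⟫_ℝ) _ p :=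
    (hasFDerivAt_id p).inner ℝ T.hasFDerivAt
  have h2 : HasFDerivAt (fun p => ⟪b, p⟫_ℝ) (innerSL ℝ b) p := (innerSL ℝ b).hasFDerivAt
  refine ((h1.const_mul (1 / 2)).add h2).congr_fderiv ?_
  ext y
  simp only [add_apply, smul_apply, ContinuousLinearMap.comp_apply, ContinuousLinearMap.prod_apply,
    fderivInnerCLM_apply, innerSL_apply_apply, InnerProductSpace.toDual_apply_apply, inner_add_left,
    ContinuousLinearMap.id_apply, id_eq, smul_eq_mul, hT]
  rw [real_inner_comm (T p) y, hT]
  ring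

theorem inner_apply_comm_of_isSelfAdjoint {F : Type*} [NormedAddCommGroup F]
    [InnerProductSpace ℝ F] [CompleteSpace F] {T : F →L[ℝ] F} (hT : IsSelfAdjoint T) (x y : F) :
    ⟪T x, y⟫_ℝ = ⟪x, T y⟫_ℝ := by
  rw [← ContinuousLinearMap.adjoint_inner_right, ContinuousLinearMap.isSelfAdjoint_iff'.1 hT]

theorem subTermGrad_of_lt (P : Problem nx nu N) {K : BlockHess nx nu N} (hK : K.IsSymm)
    (w : PrimalDual nx nu N) (mu : ℝ) {m2 : Fin (N + 1)} (h : (m2 : ℕ) < N) (p : E nx) :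
    P.subTermGrad K w mu m2 (Boundary.zero nx nu) p
      = (K.stage ⟨m2, h⟩ (WithLp.toLp 2 (p, 0))).fst + mu • p
        + ((P.gradZ w.fst w.snd).fst ⟨m2, h⟩).fst := by
  set H := K.stage ⟨m2, h⟩ with hH
  set e := WithLp.prodContinuousLinearEquiv 2 ℝ (E nx) (E nu) with he
  set T : E nx →L[ℝ] E nx := (WithLp.fstL 2 ℝ (E nx) (E nu)).comp (H.comp
      ((e.symm : _ →L[ℝ] StageVar nx nu).comp (ContinuousLinearMap.inl ℝ (E nx) (E nu))))
        + mu • ContinuousLinearMap.id ℝ (E nx) with hT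
  have hTx : ∀ x, T x = (H (WithLp.toLp 2 (x, 0))).fst + mu • x := fun _ => rfl
  have hin : ∀ x y : E nx, ⟪x, (H (WithLp.toLp 2 (y, 0))).fst⟫_ℝ
      = ⟪(WithLp.toLp 2 (x, 0) : StageVar nx nu), H (WithLp.toLp 2 (y, 0))⟫_ℝ := by
    intro x y
    rw [inner_stageVar]
    change _ = _ + ⟪(0 : E nu), _⟫_ℝ
    rw [inner_zero_left, add_zero]
    rfl
  have hsym : ∀ x y, ⟪T x, y⟫_ℝ = ⟪x, T y⟫_ℝ := by
    intro x y
    rw [hTx, hTx, inner_add_left, inner_add_right, hin, real_inner_comm, hin,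
      real_inner_comm, inner_apply_comm_of_isSelfAdjoint (hK.1 ⟨m2, h⟩), real_inner_smul_left,
      real_inner_smul_right]
  have hfun : P.subTerm K w mu m2 (Boundary.zero nx nu)
      = fun p => 1 / 2 * ⟪p, T p⟫_ℝ + ⟪((P.gradZ w.fst w.snd).fst ⟨m2, h⟩).fst, p⟫_ℝ := by
    funext p
    rw [Problem.subTerm, dif_pos h]
    simp only [Boundary.zero, map_zero, sub_zero]
    rw [hTx, inner_add_right, hin, real_inner_smul_right, real_inner_self_eq_norm_sq,
      real_inner_comm p]
    ring
  rw [Problem.subTermGrad, hfun, (hasGradientAt_quadratic T hsym _ p).gradient, hTx]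

theorem subTermGrad_of_eq (P : Problem nx nu N) {K : BlockHess nx nu N} (hK : K.IsSymm)
    (w : PrimalDual nx nu N) (mu : ℝ) {m2 : Fin (N + 1)} (h : (m2 : ℕ) = N) (d : Boundary nx nu)
    (p : E nx) : P.subTermGrad K w mu m2 d p = K.term p + (P.gradZ w.fst w.snd).snd := by
  have hfun : P.subTerm K w mu m2 d
      = fun p => 1 / 2 * ⟪p, K.term p⟫_ℝ + ⟪(P.gradZ w.fst w.snd).snd, p⟫_ℝ := by
    funext p
    rw [Problem.subTerm, dif_neg (by omega)]
  rw [Problem.subTermGrad, hfun,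
    (hasGradientAt_quadratic K.term (inner_apply_comm_of_isSelfAdjoint hK.2) _ p).gradient]

/-- The error of the terminal condition that a subproblem ending at stage `k < N` imposes, for
the exact direction `d`. -/
def terminalError (P : Problem nx nu N) (K : BlockHess nx nu N) (z : Primal nx nu N) (mu : ℝ)
    (d : PrimalDual nx nu N) (k : Fin N) : E nx :=
  (K.stage k (WithLp.toLp 2 (0, (d.fst.fst k).snd))).fst
    - (P.A k (z.fst k)).adjoint (d.snd k.succ) - mu • (d.fst.fst k).fst

theorem norm_terminalError_sq_le (P : Problem nx nu N) (K : BlockHess nx nu N)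
    (z : Primal nx nu N) {mu U : ℝ} (hmu : 0 ≤ mu) (hU : 0 ≤ U) (d : PrimalDual nx nu N)
    {k : Fin N} (hK : ‖K.stage k‖ ≤ U) (hA : ‖P.A k (z.fst k)‖ ≤ U) :
    ‖terminalError P K z mu d k‖ ^ 2
      ≤ 2 * (U + mu) ^ 2 * (‖d.fst.fst k‖ ^ 2 + ‖d.snd k.succ‖ ^ 2) := by
  have h1 : ‖(K.stage k (WithLp.toLp 2 (0, (d.fst.fst k).snd))).fst‖ ≤ U * ‖d.fst.fst k‖ := by
    refine (norm_fst_le _).trans (((K.stage k).le_of_opNorm_le hK _).trans ?_)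
    gcongr
    exact (WithLp.norm_toLp_snd 2 (E nx) (E nu) _).trans_le (norm_snd_le _)
  have h2 := norm_adjoint_apply_le hA (d.snd k.succ)
  have h3 : ‖mu • (d.fst.fst k).fst‖ ≤ mu * ‖d.fst.fst k‖ := by
    rw [norm_smul, Real.norm_of_nonneg hmu]
    gcongr
    exact norm_fst_le _
  have h4 : ‖terminalError P K z mu d k‖ ≤ (U + mu) * (‖d.fst.fst k‖ + ‖d.snd k.succ‖) := by
    unfold terminalError
    refine (norm_sub_le _ _).trans ?_
    have h5 := norm_sub_le (K.stage k (WithLp.toLp 2 (0, (d.fst.fst k).snd))).fst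
      ((P.A k (z.fst k)).adjoint (d.snd k.succ))
    have h6 : 0 ≤ mu * ‖d.snd k.succ‖ := by positivity
    linarith
  calc _ ≤ ((U + mu) * (‖d.fst.fst k‖ + ‖d.snd k.succ‖)) ^ 2 := by gcongr
    _ ≤ _ := by
      have : 0 ≤ (U + mu) ^ 2 * (‖d.fst.fst k‖ - ‖d.snd k.succ‖) ^ 2 := by positivity
      nlinarith

/-- The difference of a subproblem solution and the exact direction `d` on `[m₁, m₂]`, extended by
zero to all stages. -/
def subError (s : SubVar nx nu N) (d : PrimalDual nx nu N) (m1 m2 : ℕ) : PrimalDual nx nu N :=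
  WithLp.toLp 2 (WithLp.toLp 2 (WithLp.toLp 2 (fun k : Fin N =>
      if m1 ≤ k ∧ (k : ℕ) < m2 then s.pq k - d.fst.fst k
      else if (k : ℕ) = m2 then
        (WithLp.toLp 2 (s.p k.castSucc - (d.fst.fst k).fst, 0) : StageVar nx nu)
      else 0), if m2 = N then s.p (Fin.last N) - d.fst.snd else 0),
    WithLp.toLp 2 (fun k : Fin (N + 1) =>
      if m1 ≤ k ∧ (k : ℕ) ≤ m2 then s.zeta k - d.snd k else 0))

/-- The residual of `subError` in the truncated saddle point system; it is supported at the ends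
of the interval that are not ends of the horizon. -/
def subResidual (P : Problem nx nu N) (K : BlockHess nx nu N) (z : Primal nx nu N) (mu : ℝ)
    (d : PrimalDual nx nu N) (m1 m2 : ℕ) : PrimalDual nx nu N :=
  WithLp.toLp 2 (WithLp.toLp 2 (WithLp.toLp 2 (fun k : Fin N =>
      if (k : ℕ) = m2 then (WithLp.toLp 2 (terminalError P K z mu d k, 0) : StageVar nx nu)
      else 0), 0),
    WithLp.toLp 2 (fun k : Fin (N + 1) => if (k : ℕ) = m1 ∧ 0 < m1 then - state d.fst k else 0))

theorem subError_fst_fst (s : SubVar nx nu N) (d : PrimalDual nx nu N) (m1 m2 : ℕ) (k : Fin N) :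
    (subError s d m1 m2).fst.fst k = if m1 ≤ k ∧ (k : ℕ) < m2 then s.pq k - d.fst.fst k
      else if (k : ℕ) = m2 then
        (WithLp.toLp 2 (s.p k.castSucc - (d.fst.fst k).fst, 0) : StageVar nx nu)
      else 0 := rfl

theorem subError_fst_snd (s : SubVar nx nu N) (d : PrimalDual nx nu N) (m1 m2 : ℕ) :
    (subError s d m1 m2).fst.snd = if m2 = N then s.p (Fin.last N) - d.fst.snd else 0 := rfl

theorem subError_snd (s : SubVar nx nu N) (d : PrimalDual nx nu N) (m1 m2 : ℕ) (k : Fin (N + 1)) :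
    (subError s d m1 m2).snd k = if m1 ≤ k ∧ (k : ℕ) ≤ m2 then s.zeta k - d.snd k else 0 := rfl

theorem state_subError (s : SubVar nx nu N) (d : PrimalDual nx nu N) {m1 m2 : ℕ} (hm : m1 < m2)
    (hm2 : m2 ≤ N) (k : Fin (N + 1)) : state (subError s d m1 m2).fst k
      = if m1 ≤ k ∧ (k : ℕ) ≤ m2 then s.p k - state d.fst k else 0 := by
  refine Fin.lastCases ?_ (fun j => ?_) k
  · rw [state_last, state_last, subError_fst_snd, Fin.val_last]
    by_cases h : m2 = N
    · rw [if_pos h, if_pos (by omega)]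
    · rw [if_neg h, if_neg (by omega)]
  · rw [state_castSucc, state_castSucc, subError_fst_fst, Fin.val_castSucc]
    by_cases h1 : m1 ≤ (j : ℕ) ∧ (j : ℕ) < m2
    · rw [if_pos h1, if_pos (by omega)]; rfl
    · rw [if_neg h1]
      by_cases h2 : (j : ℕ) = m2
      · rw [if_pos h2, if_pos (by omega)]; rfl
      · rw [if_neg h2, if_neg (by omega)]; rfl

/-- The equations for the Newton direction, stage by stage. -/
theorem newton_stage (P : Problem nx nu N) {K : BlockHess nx nu N} {w d : PrimalDual nx nu N}
    (hf : ∀ k, DifferentiableAt ℝ (P.f k) (w.fst.fst k)) (hd : P.IsNewtonDir K w d) :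
    (∀ k : Fin N, K.stage k (d.fst.fst k) + WithLp.toLp 2
        (d.snd k.castSucc - (P.A k (w.fst.fst k)).adjoint (d.snd k.succ),
          -(P.B k (w.fst.fst k)).adjoint (d.snd k.succ)) = -(P.gradZ w.fst w.snd).fst k) ∧
      K.term d.fst.snd + d.snd (Fin.last N) = -(P.gradZ w.fst w.snd).snd ∧
      state d.fst 0 = - P.gradLam w.fst w.snd 0 ∧
      ∀ k : Fin N, state d.fst k.succ - (P.A k (w.fst.fst k) (d.fst.fst k).fst
        + P.B k (w.fst.fst k) (d.fst.fst k).snd) = - P.gradLam w.fst w.snd k.succ := by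
  have h : lqKKT (fun k => P.A k (w.fst.fst k)) (fun k => P.B k (w.fst.fst k)) K d
      = - P.gradL w := by
    rw [← kkt_eq_lqKKT P K w.fst hf]; exact hd
  refine ⟨fun k => ?_, ?_, ?_, fun k => ?_⟩
  · rw [← lqKKT_fst_fst (fun k => P.A k (w.fst.fst k)) (fun k => P.B k (w.fst.fst k)), h]; rfl
  · rw [← lqKKT_fst_snd (fun k => P.A k (w.fst.fst k)) (fun k => P.B k (w.fst.fst k)), h]; rfl
  · rw [← dynOp_zero (fun k => P.A k (w.fst.fst k)) (fun k => P.B k (w.fst.fst k)),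
      ← lqKKT_snd _ _ K, h]; rfl
  · rw [← dynOp_succ (fun k => P.A k (w.fst.fst k)) (fun k => P.B k (w.fst.fst k)),
      ← lqKKT_snd _ _ K, h]; rfl

/-- The optimality conditions of a subproblem are the Newton equations on `[m₁, m₂]`, except for the
zero boundary values; the error of its solution therefore solves the truncated saddle point system
with a right-hand side that sits at the inner ends of the interval. If `m₁ = 0` there is no residual
at `m₁`, since the exact direction has initial state zero. -/
theorem lqKKT_subError (P : Problem nx nu N) {K : BlockHess nx nu N} (hK : K.IsSymm)
    {w d : PrimalDual nx nu N}
    (hf : ∀ k, DifferentiableAt ℝ (P.f k) (w.fst.fst k)) (hd : P.IsNewtonDir K w d)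
    (hd0 : state d.fst 0 = 0) {mu : ℝ} {m1 m2 : Fin (N + 1)} (hm : (m1 : ℕ) < m2)
    {s : SubVar nx nu N} (hs : P.SubFeasible w m1 m2 (Boundary.zero nx nu) s)
    (hs' : P.SubStationary K w mu m1 m2 (Boundary.zero nx nu) s) :
    lqKKT (truncSeq m1 m2 fun k => P.A k (w.fst.fst k))
      (truncSeq m1 m2 fun k => P.B k (w.fst.fst k)) (truncHess K mu m1 m2) (subError s d m1 m2)
      = subResidual P K w.fst mu d m1 m2 := by
  obtain ⟨n1, n2, n3, n4⟩ := newton_stage P hf hd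
  have hm2 : (m2 : ℕ) ≤ N := Nat.le_of_lt_succ m2.isLt
  refine primalDual_ext (primal_ext (fun k => ?_) ?_) ?_
  · rw [lqKKT_fst_fst, subError_fst_fst, subError_snd, subError_snd, Fin.val_castSucc, Fin.val_succ]
    have hr : (subResidual P K w.fst mu d m1 m2).fst.fst k = if (k : ℕ) = m2 then
      (WithLp.toLp 2 (terminalError P K w.fst mu d k, 0) : StageVar nx nu) else 0 := rfl
    rw [hr]
    simp only [truncHess, truncSeq]
    by_cases h1 : (m1 : ℕ) ≤ k ∧ (k : ℕ) < m2
    · have e1 := hs'.1 k h1.1 h1.2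
      have e2 := n1 k
      rw [if_pos h1, if_pos h1, if_pos h1, if_pos h1, if_pos (by omega), if_pos (by omega),
        if_neg (by omega)]
      have e3 : (WithLp.toLp 2 (s.zeta k.castSucc - d.snd k.castSucc
          - (P.A k (w.fst.fst k)).adjoint (s.zeta k.succ - d.snd k.succ),
            -(P.B k (w.fst.fst k)).adjoint (s.zeta k.succ - d.snd k.succ)) : StageVar nx nu)
          = WithLp.toLp 2 (s.zeta k.castSucc - (P.A k (w.fst.fst k)).adjoint (s.zeta k.succ),
            -(P.B k (w.fst.fst k)).adjoint (s.zeta k.succ))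
          - WithLp.toLp 2 (d.snd k.castSucc - (P.A k (w.fst.fst k)).adjoint (d.snd k.succ),
            -(P.B k (w.fst.fst k)).adjoint (d.snd k.succ)) := by
        apply stageVar_ext
        · rw [WithLp.sub_fst]
          simp only [map_sub, WithLp.toLp_fst]; abel
        · rw [WithLp.sub_snd]
          simp only [map_sub, WithLp.toLp_snd]; abel
      rw [e3, map_sub]
      have e4 : ∀ a a' g c c' : StageVar nx nu, a + g + c = 0 → a' + c' = -g →
          a - a' + (c - c') = 0 := by
        intro a a' g c c' h h'
        have : a - a' + (c - c') = (a + g + c) - (a' + c') - g := by abel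
        rw [this, h, h']; abel
      exact e4 _ _ _ _ _ e1 e2
    · rw [if_neg h1, if_neg h1, if_neg h1, if_neg h1]
      by_cases h2 : (k : ℕ) = m2
      · rw [if_pos h2, if_pos h2, if_pos h2, if_pos (by omega), if_neg (by omega), termBlock_apply]
        have hlt : (m2 : ℕ) < N := h2 ▸ k.isLt
        have hk : (⟨m2, hlt⟩ : Fin N) = k := Fin.ext h2.symm
        have hk' : m2 = k.castSucc := Fin.ext (by simpa using h2.symm)
        have e1 := hs'.2
        rw [subTermGrad_of_lt P hK w mu hlt, hk, hk'] at e1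
        have e2 := congrArg (fun v : StageVar nx nu => v.fst) (n1 k)
        simp only [WithLp.add_fst, WithLp.neg_fst, WithLp.toLp_fst] at e2
        have e3 : K.stage k (d.fst.fst k)
            = K.stage k (WithLp.toLp 2 ((d.fst.fst k).fst, 0))
              + K.stage k (WithLp.toLp 2 (0, (d.fst.fst k).snd)) := by
          rw [← map_add]
          congr 1
          apply stageVar_ext
          · simp
          · simp
        have e4 : K.stage k (WithLp.toLp 2 (s.p k.castSucc - (d.fst.fst k).fst, 0))
            = K.stage k (WithLp.toLp 2 (s.p k.castSucc, 0))
              - K.stage k (WithLp.toLp 2 ((d.fst.fst k).fst, 0)) := by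
          rw [← map_sub]
          congr 1
          apply stageVar_ext
          · simp
          · simp
        apply stageVar_ext
        · rw [WithLp.add_fst]
          change (K.stage k (WithLp.toLp 2 (s.p k.castSucc - (d.fst.fst k).fst, 0))).fst
            + mu • (s.p k.castSucc - (d.fst.fst k).fst)
            + (s.zeta k.castSucc - d.snd k.castSucc
              - ContinuousLinearMap.adjoint (0 : E nx →L[ℝ] E nx) 0)
            = (K.stage k (WithLp.toLp 2 (0, (d.fst.fst k).snd))).fst
              - (P.A k (w.fst.fst k)).adjoint (d.snd k.succ) - mu • (d.fst.fst k).fst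
          rw [e3, WithLp.add_fst] at e2
          rw [e4, WithLp.sub_fst, map_zero, sub_zero, smul_sub]
          have e5 : ∀ a x xu g l al m mx ζ : E nx, a + m + g + ζ = 0 → x + xu + (l - al) = -g →
              a - x + (m - mx) + (ζ - l) = xu - al - mx := by
            intro a x xu g l al m mx ζ h h'
            have : a - x + (m - mx) + (ζ - l)
                = (a + m + g + ζ) - (x + xu + (l - al)) - g + (xu - al - mx) := by abel
            rw [this, h, h']; abel
          exact e5 _ _ _ _ _ _ _ _ _ e1 e2
        · rw [WithLp.add_snd]
          change (0 : E nu) + -(ContinuousLinearMap.adjoint (0 : E nu →L[ℝ] E nx) 0) = 0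
          rw [map_zero, neg_zero, add_zero]
      · rw [if_neg h2, if_neg h2, if_neg h2, if_neg (by omega), map_zero, zero_add]
        apply stageVar_ext
        · change (0 : E nx) - ContinuousLinearMap.adjoint (0 : E nx →L[ℝ] E nx) _ = 0
          simp
        · change -(ContinuousLinearMap.adjoint (0 : E nu →L[ℝ] E nx) _) = 0
          simp
  · have hr : (subResidual P K w.fst mu d m1 m2).fst.snd = 0 := rfl
    rw [lqKKT_fst_snd, subError_fst_snd, subError_snd, hr, Fin.val_last]
    simp only [truncHess]
    by_cases h : (m2 : ℕ) = N
    · rw [if_pos h, if_pos h, if_pos (by omega), map_sub]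
      have e1 := hs'.2
      rw [subTermGrad_of_eq P hK w mu h, show m2 = Fin.last N from Fin.ext h] at e1
      have e4 : ∀ a a' g c c' : E nx, a + g + c = 0 → a' + c' = -g →
          a - a' + (c - c') = 0 := by
        intro a a' g c c' h h'
        have : a - a' + (c - c') = (a + g + c) - (a' + c') - g := by abel
        rw [this, h, h']; abel
      exact e4 _ _ _ _ _ e1 n2
    · rw [if_neg h, if_neg h, if_neg (by omega), map_zero, add_zero]
  · rw [lqKKT_snd]
    ext1 k
    have hr : (subResidual P K w.fst mu d m1 m2).snd k
      = if (k : ℕ) = m1 ∧ 0 < (m1 : ℕ) then - state d.fst k else 0 := rfl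
    rw [hr]
    refine Fin.cases ?_ (fun j => ?_) k
    · rw [dynOp_zero, state_subError s d hm hm2, Fin.val_zero]
      by_cases h : (m1 : ℕ) = 0
      · rw [if_pos (by omega), if_neg (by omega), hd0, sub_zero, ← show m1 = 0 from Fin.ext h, hs.1]
        rfl
      · rw [if_neg (by omega), if_neg (by omega)]
    · rw [dynOp_succ, state_subError s d hm hm2, subError_fst_fst, Fin.val_succ]
      simp only [truncSeq]
      by_cases h1 : (m1 : ℕ) ≤ j ∧ (j : ℕ) < m2
      · rw [if_pos (by omega), if_pos h1, if_pos h1, if_pos h1, if_neg (by omega),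
          hs.2 j h1.1 h1.2]
        have e2 := n4 j
        have e3 : state d.fst j.succ = P.A j (w.fst.fst j) (d.fst.fst j).fst
          + P.B j (w.fst.fst j) (d.fst.fst j).snd - P.gradLam w.fst w.snd j.succ := by
          rw [sub_eq_iff_eq_add] at e2; rw [e2]; abel
        rw [e3, WithLp.sub_fst, WithLp.sub_snd, map_sub, map_sub]
        have e4 : (s.pq j).fst = s.p j.castSucc := rfl
        have e5 : (s.pq j).snd = s.q j := rfl
        rw [e4, e5]
        abel
      · rw [if_neg h1, if_neg h1, if_neg h1, zero_apply, zero_apply, add_zero, sub_zero]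
        by_cases h2 : (j : ℕ) + 1 = m1
        · rw [if_pos (by omega), if_pos (by omega)]
          have : s.p j.succ = 0 := by
            rw [show j.succ = m1 from Fin.ext (by simpa using h2), hs.1]; rfl
          rw [this, zero_sub]
        · rw [if_neg (by omega), if_neg (by omega)]

/-! ### The error of the decomposed direction -/

/-- The distance of stage `k` to the ends of `[m₁, m₂]` that are not ends of the horizon `[0, N]`,
cut off at `b`. Beyond such an end it is zero, by truncated subtraction. -/
def endDist (N b m1 m2 k : ℕ) : ℕ :=
  min b (min (if m1 = 0 then b else k - m1) (if m2 = N then b else m2 - k))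

theorem endDist_succ_le (N b m1 m2 k : ℕ) : endDist N b m1 m2 (k + 1) ≤ endDist N b m1 m2 k + 1 := by
  unfold endDist; split_ifs <;> omega

theorem le_endDist_succ (N b m1 m2 k : ℕ) : endDist N b m1 m2 k ≤ endDist N b m1 m2 (k + 1) + 1 := by
  unfold endDist; split_ifs <;> omega

/-- Powers with exponents that differ by at most one. -/
theorem abs_pow_sub_pow_le {ε : ℝ} (hε : 0 ≤ ε) {m n : ℕ} (h1 : m ≤ n + 1) (h2 : n ≤ m + 1) :
    |(1 + ε) ^ m - (1 + ε) ^ n| ≤ ε * |(1 + ε) ^ m| := by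
  have hp : ∀ j : ℕ, 0 < (1 + ε) ^ j := fun j => by positivity
  rw [abs_of_pos (hp m)]
  rcases (by omega : m = n ∨ m = n + 1 ∨ n = m + 1) with rfl | rfl | rfl
  · rw [sub_self, abs_zero]; exact mul_nonneg hε (hp _).le
  · rw [show (1 + ε) ^ (n + 1) - (1 + ε) ^ n = ε * (1 + ε) ^ n by ring,
      abs_of_nonneg (mul_nonneg hε (hp _).le)]
    gcongr
    · linarith
    · omega
  · rw [show (1 + ε) ^ m - (1 + ε) ^ (m + 1) = -(ε * (1 + ε) ^ m) by ring, abs_neg,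
      abs_of_nonneg (mul_nonneg hε (hp _).le)]

theorem norm_sq_subResidual (P : Problem nx nu N) (K : BlockHess nx nu N) (z : Primal nx nu N)
    (mu : ℝ) (d : PrimalDual nx nu N) (m1 m2 : ℕ) :
    ‖subResidual P K z mu d m1 m2‖ ^ 2
      = (∑ k : Fin N, if (k : ℕ) = m2 then ‖terminalError P K z mu d k‖ ^ 2 else 0)
        + ∑ k : Fin (N + 1), if (k : ℕ) = m1 ∧ 0 < m1 then ‖state d.fst k‖ ^ 2 else 0 := by
  rw [norm_sq_primalDual, norm_sq_primal, norm_sq_dual]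
  have h1 : ‖(subResidual P K z mu d m1 m2).fst.snd‖ ^ 2 = 0 := by
    change ‖(0 : E nx)‖ ^ 2 = 0
    simp
  rw [h1, add_zero]
  congr 1
  · refine Finset.sum_congr rfl fun k _ => ?_
    change ‖(if (k : ℕ) = m2 then (WithLp.toLp 2 (terminalError P K z mu d k, 0) : StageVar nx nu)
      else 0)‖ ^ 2 = _
    split_ifs
    · rw [norm_toLp_zero_le]
    · simp
  · refine Finset.sum_congr rfl fun k _ => ?_
    change ‖(if (k : ℕ) = m1 ∧ 0 < m1 then - state d.fst k else 0)‖ ^ 2 = _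
    split_ifs
    · rw [norm_neg]
    · simp

/-- The weights are one where the residual is supported. -/
theorem scale_subResidual (P : Problem nx nu N) (K : BlockHess nx nu N) (z : Primal nx nu N)
    (mu : ℝ) (d : PrimalDual nx nu N) (b m1 m2 : ℕ) (ω : ℝ) :
    scale (fun k : Fin (N + 1) => ω ^ endDist N b m1 m2 k) (subResidual P K z mu d m1 m2)
      = subResidual P K z mu d m1 m2 := by
  refine primalDual_ext (primal_ext (fun k => ?_) ?_) ?_
  · change ω ^ endDist N b m1 m2 k • (if (k : ℕ) = m2 then
      (WithLp.toLp 2 (terminalError P K z mu d k, 0) : StageVar nx nu) else 0)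
        = if (k : ℕ) = m2 then _ else 0
    split_ifs with h
    · have : endDist N b m1 m2 k = 0 := by
        unfold endDist
        rw [if_neg (by omega : ¬ m2 = N)]; omega
      rw [this, pow_zero, one_smul]
    · rw [smul_zero]
  · change _ • (0 : E nx) = 0
    rw [smul_zero]
  · refine PiLp.ext fun k => ?_
    change ω ^ endDist N b m1 m2 k • (if (k : ℕ) = m1 ∧ 0 < m1 then - state d.fst k else 0)
      = if (k : ℕ) = m1 ∧ 0 < m1 then - state d.fst k else 0
    split_ifs with h
    · have : endDist N b m1 m2 k = 0 := by
        unfold endDist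
        rw [if_neg (by omega : ¬ m1 = 0)]; omega
      rw [this, pow_zero, one_smul]
    · rw [smul_zero]

theorem sum_ite_le_of_unique {ι : Type*} [Fintype ι] {p : ι → Prop} [DecidablePred p]
    (h : ∀ i j, p i → p j → i = j) {a : ℝ} (ha : 0 ≤ a) : (∑ i, if p i then a else 0) ≤ a := by
  by_cases hp : ∃ i, p i
  · obtain ⟨i, hi⟩ := hp
    rw [Finset.sum_eq_single i (fun j _ hj => if_neg fun hpj => hj (h j i hpj hi))
      (fun hi => absurd (Finset.mem_univ _) hi), if_pos hi]
  · push Not at hp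
    rw [Finset.sum_eq_zero fun i _ => if_neg (hp i)]
    exact ha

theorem norm_sq_state_sum_le (z : Primal nx nu N) :
    ∑ k : Fin (N + 1), ‖state z k‖ ^ 2 ≤ ‖z‖ ^ 2 := by
  rw [Fin.sum_univ_castSucc, norm_sq_primal]
  simp only [state_castSucc, state_last]
  gcongr with k
  exact norm_fst_le _

theorem IsKnots.lt_succ {M : ℕ} {n : Fin (M + 1) → Fin (N + 1)} (hn : IsKnots n) (i : Fin M) :
    (n i.castSucc : ℕ) < n i.succ := hn.1 Fin.castSucc_lt_succ

theorem IsKnots.exists_block {M : ℕ} {n : Fin (M + 1) → Fin (N + 1)} (hn : IsKnots n) {k : ℕ}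
    (hk : k < N) : ∃ i : Fin M, (n i.castSucc : ℕ) ≤ k ∧ k < n i.succ := by
  by_contra! h
  have : ∀ j : Fin (M + 1), (n j : ℕ) ≤ k := by
    intro j
    induction j using Fin.induction with
    | zero => rw [hn.2.1]; exact Nat.zero_le _
    | succ j ih => exact h j ih
  have h1 := this (Fin.last M)
  rw [hn.2.2, Fin.val_last] at h1
  omega

theorem IsKnots.leftEnd_lt_rightEnd {M : ℕ} {n : Fin (M + 1) → Fin (N + 1)} (hn : IsKnots n)
    (b : ℕ) (i : Fin M) : (leftEnd n b i : ℕ) < rightEnd n b i := by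
  have h1 := hn.lt_succ i
  have h2 := (n i.succ).isLt
  change (n i.castSucc : ℕ) - b < min ((n i.succ : ℕ) + b) N
  omega

/-- The stages of a block are at least `b` away from the inner ends of its extension. -/
theorem endDist_eq {M : ℕ} (n : Fin (M + 1) → Fin (N + 1)) (b : ℕ) (i : Fin M) {k : ℕ} (h1 : (n i.castSucc : ℕ) ≤ k) (h2 : k ≤ n i.succ) :
    endDist N b (leftEnd n b i) (rightEnd n b i) k = b := by
  change endDist N b ((n i.castSucc : ℕ) - b) (min ((n i.succ : ℕ) + b) N) k = b
  unfold endDist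
  split_ifs <;> omega

/-- Each stage is an inner end of at most one subproblem, so that the residuals of all subproblems
together are controlled by the exact direction. -/
theorem sum_norm_sq_subResidual_le (P : Problem nx nu N) (K : BlockHess nx nu N)
    (z : Primal nx nu N) {mu U : ℝ} (hmu : 0 ≤ mu) (hU : 0 ≤ U) (hK : ∀ k, ‖K.stage k‖ ≤ U)
    (hA : ∀ k, ‖P.A k (z.fst k)‖ ≤ U) (d : PrimalDual nx nu N) {M : ℕ}
    {n : Fin (M + 1) → Fin (N + 1)} (hn : IsKnots n) (b : ℕ) :
    ∑ i : Fin M, ‖subResidual P K z mu d (leftEnd n b i) (rightEnd n b i)‖ ^ 2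
      ≤ (2 * (U + mu) ^ 2 + 1) * ‖d‖ ^ 2 := by
  have hinj : ∀ i j : Fin (M + 1), (n i : ℕ) = n j → i = j := fun i j h =>
    hn.1.injective (Fin.ext h)
  simp only [norm_sq_subResidual]
  rw [Finset.sum_add_distrib, Finset.sum_comm]
  have h1 : ∑ k : Fin N, ∑ i : Fin M, (if (k : ℕ) = rightEnd n b i then
      ‖terminalError P K z mu d k‖ ^ 2 else 0) ≤ 2 * (U + mu) ^ 2 * ‖d‖ ^ 2 := by
    calc _ ≤ ∑ k : Fin N, ‖terminalError P K z mu d k‖ ^ 2 := by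
          refine Finset.sum_le_sum fun k _ => sum_ite_le_of_unique (fun i j hi hj => ?_)
            (by positivity)
          have hk := k.isLt
          change (k : ℕ) = min ((n i.succ : ℕ) + b) N at hi
          change (k : ℕ) = min ((n j.succ : ℕ) + b) N at hj
          exact Fin.succ_injective _ (hinj _ _ (by omega))
      _ ≤ ∑ k : Fin N, 2 * (U + mu) ^ 2 * (‖d.fst.fst k‖ ^ 2 + ‖d.snd k.succ‖ ^ 2) :=
          Finset.sum_le_sum fun k _ => norm_terminalError_sq_le P K z hmu hU d (hK k) (hA k)
      _ = 2 * (U + mu) ^ 2 * (∑ k : Fin N, ‖d.fst.fst k‖ ^ 2 + ∑ k : Fin N, ‖d.snd k.succ‖ ^ 2) := by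
          rw [← Finset.mul_sum, Finset.sum_add_distrib]
      _ ≤ _ := by
          rw [norm_sq_eq_stages d]
          gcongr
          · linarith [sq_nonneg ‖d.fst.snd‖]
          · linarith [sq_nonneg ‖d.snd 0‖]
  have h2 : ∑ i : Fin M, ∑ k : Fin (N + 1), (if (k : ℕ) = leftEnd n b i ∧ 0 < (leftEnd n b i : ℕ)
      then ‖state d.fst k‖ ^ 2 else 0) ≤ ‖d‖ ^ 2 := by
    rw [Finset.sum_comm]
    calc _ ≤ ∑ k : Fin (N + 1), ‖state d.fst k‖ ^ 2 := by
          refine Finset.sum_le_sum fun k _ => sum_ite_le_of_unique (fun i j hi hj => ?_)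
            (by positivity)
          have h1 : (k : ℕ) = (n i.castSucc : ℕ) - b ∧ 0 < (n i.castSucc : ℕ) - b := hi
          have h2 : (k : ℕ) = (n j.castSucc : ℕ) - b ∧ 0 < (n j.castSucc : ℕ) - b := hj
          exact Fin.castSucc_injective _ (hinj _ _ (by omega))
      _ ≤ ‖d.fst‖ ^ 2 := norm_sq_state_sum_le _
      _ ≤ ‖d‖ ^ 2 := by gcongr; exact norm_primalDual_fst_le d
  linarith

/-- The part of a block that is kept in the composition carries the largest weight. -/
theorem pow_mul_norm_sub_sq_le {M : ℕ} {n : Fin (M + 1) → Fin (N + 1)} (hn : IsKnots n)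
    (hN : 0 < N) (b : ℕ) {s : Fin M → SubVar nx nu N} {d' : PrimalDual nx nu N}
    (hcomp : IsComposition n s d') (d : PrimalDual nx nu N) {ω : ℝ} (hω : 0 ≤ ω) :
    (ω ^ b) ^ 2 * ‖d' - d‖ ^ 2 ≤ ∑ i : Fin M,
      ‖scale (fun k : Fin (N + 1) => ω ^ endDist N b (leftEnd n b i) (rightEnd n b i) k)
        (subError (s i) d (leftEnd n b i) (rightEnd n b i))‖ ^ 2 := by
  set e : Fin M → PrimalDual nx nu N := fun i =>
    scale (fun k : Fin (N + 1) => ω ^ endDist N b (leftEnd n b i) (rightEnd n b i) k)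
        (subError (s i) d (leftEnd n b i) (rightEnd n b i)) with he
  have hb : 0 ≤ ω ^ b := by positivity
  have hM : 0 < M := by
    obtain ⟨i, -⟩ := hn.exists_block hN
    exact i.pos
  -- the last block
  obtain ⟨iN, hiN⟩ : ∃ i : Fin M, (i : ℕ) + 1 = M := ⟨⟨M - 1, by omega⟩, by simp; omega⟩
  have hlast : (n iN.succ : ℕ) = N := by
    rw [show iN.succ = Fin.last M from Fin.ext (by simp [hiN]), hn.2.2]; rfl
  have hright : (rightEnd n b iN : ℕ) = N := by
    change min ((n iN.succ : ℕ) + b) N = N; omega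
  have hend : endDist N b (leftEnd n b iN) (rightEnd n b iN) (Fin.last N : Fin (N + 1)) = b :=
    endDist_eq n b iN (by have := hn.lt_succ iN; rw [Fin.val_last]; omega)
      (by rw [Fin.val_last]; omega)
  have hleft : (leftEnd n b iN : ℕ) ≤ N := Nat.le_of_lt_succ (leftEnd n b iN).isLt
  -- the component estimates
  have g1 : ∀ k : Fin N, (ω ^ b) ^ 2 * ‖(d' - d).fst.fst k‖ ^ 2
      ≤ ∑ i, ‖(e i).fst.fst k‖ ^ 2 := by
    intro k
    obtain ⟨i, h1, h2⟩ := hn.exists_block k.isLt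
    refine le_trans (le_of_eq ?_) (Finset.single_le_sum
      (f := fun i => ‖(e i).fst.fst k‖ ^ 2) (fun i _ => by positivity) (Finset.mem_univ i))
    have h3 : (e i).fst.fst k = ω ^ b • ((d' - d).fst.fst k) := by
      change ω ^ endDist N b (leftEnd n b i) (rightEnd n b i) k • (subError (s i) d
        (leftEnd n b i) (rightEnd n b i)).fst.fst k = ω ^ b • (d'.fst.fst k - d.fst.fst k)
      rw [endDist_eq n b i h1 h2.le, subError_fst_fst, if_pos, (hcomp.1 i k h1 h2).1]
      have h4 := k.isLt
      have h5 : (leftEnd n b i : ℕ) = (n i.castSucc : ℕ) - b := rfl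
      have h6 : (rightEnd n b i : ℕ) = min ((n i.succ : ℕ) + b) N := rfl
      omega
    simp only [h3, norm_smul, Real.norm_of_nonneg hb, mul_pow]
  have g2 : (ω ^ b) ^ 2 * ‖(d' - d).fst.snd‖ ^ 2 ≤ ∑ i, ‖(e i).fst.snd‖ ^ 2 := by
    refine le_trans (le_of_eq ?_) (Finset.single_le_sum
      (f := fun i => ‖(e i).fst.snd‖ ^ 2) (fun i _ => by positivity) (Finset.mem_univ iN))
    have h3 : (e iN).fst.snd = ω ^ b • ((d' - d).fst.snd) := by
      change ω ^ endDist N b (leftEnd n b iN) (rightEnd n b iN) (Fin.last N : Fin (N + 1))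
        • (subError (s iN) d (leftEnd n b iN) (rightEnd n b iN)).fst.snd
          = ω ^ b • (d'.fst.snd - d.fst.snd)
      rw [hend, subError_fst_snd, if_pos hright, (hcomp.2 iN hiN).1]
    simp only [h3, norm_smul, Real.norm_of_nonneg hb, mul_pow]
  have g3 : ∀ k : Fin (N + 1), (ω ^ b) ^ 2 * ‖(d' - d).snd k‖ ^ 2 ≤ ∑ i, ‖(e i).snd k‖ ^ 2 := by
    intro k
    have h3 : ∃ i, (e i).snd k = ω ^ b • ((d' - d).snd k) := by
      refine Fin.lastCases ?_ (fun k => ?_) k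
      · refine ⟨iN, ?_⟩
        change ω ^ endDist N b (leftEnd n b iN) (rightEnd n b iN) (Fin.last N : Fin (N + 1))
          • (subError (s iN) d (leftEnd n b iN) (rightEnd n b iN)).snd (Fin.last N)
            = ω ^ b • (d'.snd (Fin.last N) - d.snd (Fin.last N))
        rw [hend, subError_snd, if_pos (by rw [Fin.val_last]; omega), (hcomp.2 iN hiN).2]
      · obtain ⟨i, h1, h2⟩ := hn.exists_block k.isLt
        refine ⟨i, ?_⟩
        change ω ^ endDist N b (leftEnd n b i) (rightEnd n b i) k • (subError (s i) d
          (leftEnd n b i) (rightEnd n b i)).snd k.castSucc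
            = ω ^ b • (d'.snd k.castSucc - d.snd k.castSucc)
        rw [endDist_eq n b i h1 h2.le, subError_snd, if_pos, (hcomp.1 i k h1 h2).2]
        have h4 := k.isLt
        have h5 : (leftEnd n b i : ℕ) = (n i.castSucc : ℕ) - b := rfl
        have h6 : (rightEnd n b i : ℕ) = min ((n i.succ : ℕ) + b) N := rfl
        rw [Fin.val_castSucc]
        omega
    obtain ⟨i, hi⟩ := h3
    refine le_trans (le_of_eq ?_) (Finset.single_le_sum
      (f := fun i => ‖(e i).snd k‖ ^ 2) (fun i _ => by positivity) (Finset.mem_univ i))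
    simp only [hi, norm_smul, Real.norm_of_nonneg hb, mul_pow]
  have hsum : ∑ i, ‖e i‖ ^ 2 = ∑ k : Fin N, ∑ i, ‖(e i).fst.fst k‖ ^ 2 + ∑ i, ‖(e i).fst.snd‖ ^ 2
      + ∑ k : Fin (N + 1), ∑ i, ‖(e i).snd k‖ ^ 2 := by
    simp only [norm_sq_primalDual, norm_sq_primal, norm_sq_dual, Finset.sum_add_distrib]
    rw [Finset.sum_comm, Finset.sum_comm (s := Finset.univ) (t := Finset.univ (α := Fin (N + 1)))]
  rw [hsum, norm_sq_primalDual, norm_sq_primal, norm_sq_dual, mul_add, mul_add, Finset.mul_sum,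
    Finset.mul_sum]
  gcongr with k _ k _
  · exact g1 k
  · exact g3 k

/-- The rate of decay `1 / ω`, where `ω` is so close to `1` that weights growing by the factor `ω`
per stage perturb the truncated systems by half of their stability margin. -/
def decayRate (gamRH gamC : ℝ) (t : ℕ) (U mu : ℝ) : ℝ :=
  (1 + 1 / (4 * U * truncConst gamRH gamC t U mu))⁻¹

theorem truncConst_pos {gamRH gamC U mu : ℝ} (t : ℕ) (hg : 0 < gamC) (hU : 2 ≤ U)
    (hRH0 : 0 < gamRH) (hmu : 0 ≤ mu) : 0 < truncConst gamRH gamC t U mu := by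
  have h := gammaG_pos t hg hU
  exact saddleConst_pos (by positivity) (lt_min hRH0 one_pos) (by linarith)

theorem muBar_pos {gamC U : ℝ} (t : ℕ) (hg : 0 < gamC) (hU : 2 ≤ U) : 0 < muBar gamC t U := by
  unfold muBar; positivity

/-- The weights that grow away from the inner ends of an interval are admissible. -/
theorem norm_scale_endDist_le (A : Fin N → E nx →L[ℝ] E nx) (B : Fin N → E nu →L[ℝ] E nx)
    (K : BlockHess nx nu N) {U ε C : ℝ} (hU : 0 ≤ U) (hε : 0 ≤ ε) (hC : 0 ≤ C)
    (hA : ∀ k, ‖A k‖ ≤ U) (hB : ∀ k, ‖B k‖ ≤ U)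
    (hstab : ∀ w, ‖w‖ ≤ C * ‖lqKKT A B K w‖) (hCε : C * (2 * (U * ε)) ≤ 1 / 2)
    (b m1 m2 : ℕ) (w : PrimalDual nx nu N) :
    ‖scale (fun k : Fin (N + 1) => (1 + ε) ^ endDist N b m1 m2 k) w‖
      ≤ 2 * C * ‖scale (fun k : Fin (N + 1) => (1 + ε) ^ endDist N b m1 m2 k)
        (lqKKT A B K w)‖ := by
  refine norm_scale_le A B K hU hε hC hA hB (fun k => ?_) (fun k => ?_) hstab hCε w
  · exact abs_pow_sub_pow_le hε (le_endDist_succ ..) (endDist_succ_le ..)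
  · rw [abs_sub_comm]
    exact abs_pow_sub_pow_le hε (endDist_succ_le ..) (le_endDist_succ ..)

/-- The decomposed direction approximates the Newton direction exponentially well in the overlap:
the error of each subproblem satisfies a stable system with residuals at the inner ends only, and
the weights `ω ^ endDist` are one there and `ω ^ b` on the block that is kept. -/
theorem norm_sub_newton_le (P : Problem nx nu N) (hN : 0 < N) {K : BlockHess nx nu N}
    (hKs : K.IsSymm) {w d d' : PrimalDual nx nu N}
    (hf : ∀ k, DifferentiableAt ℝ (P.f k) (w.fst.fst k)) (hd : P.IsNewtonDir K w d)
    (hd0 : state d.fst 0 = 0) {gamRH gamC U mu : ℝ} {t : ℕ} (ht : 0 < t)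
    (hg : 0 < gamC) (hg1 : gamC ≤ 1) (hU : 2 ≤ U) (hRH0 : 0 < gamRH)
    (hRH : ∀ v, P.jac w.fst v = 0 → gamRH * ‖v‖ ^ 2 ≤ ⟪v, K.toCLM v⟫_ℝ)
    (hctrl : P.ControllableAt gamC t w.fst)
    (hK : ∀ k, ‖K.stage k‖ ≤ U) (hKN : ‖K.term‖ ≤ U)
    (hA : ∀ k, ‖P.A k (w.fst.fst k)‖ ≤ U) (hB : ∀ k, ‖P.B k (w.fst.fst k)‖ ≤ U)
    (hmu : muBar gamC t U ≤ mu) {M : ℕ} {n : Fin (M + 1) → Fin (N + 1)} (hn : IsKnots n) {b : ℕ}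
    (hd' : P.IsFOTDDir K mu n b w d') :
    ‖d' - d‖ ≤ 4 * truncConst gamRH gamC t U mu * (U + mu) * decayRate gamRH gamC t U mu ^ b
      * ‖d‖ := by
  obtain ⟨s, hs, hcomp⟩ := hd'
  have hmu0 : 0 < mu := (muBar_pos t hg hU).trans_le hmu
  have hU0 : 0 ≤ U := by linarith
  set C := truncConst gamRH gamC t U mu with hC
  have hC0 : 0 < C := truncConst_pos t hg hU hRH0 hmu0.le
  set ε := 1 / (4 * U * C) with hε
  have hε0 : 0 ≤ ε := by positivity
  have hω : decayRate gamRH gamC t U mu = (1 + ε)⁻¹ := rfl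
  have hCε : C * (2 * (U * ε)) ≤ 1 / 2 := by
    rw [hε]; apply le_of_eq; field_simp; norm_num
  have h1 : ∀ i : Fin M, ‖scale
      (fun k : Fin (N + 1) => (1 + ε) ^ endDist N b (leftEnd n b i) (rightEnd n b i) k)
        (subError (s i) d (leftEnd n b i) (rightEnd n b i))‖ ^ 2
      ≤ (2 * C) ^ 2 * ‖subResidual P K w.fst mu d (leftEnd n b i) (rightEnd n b i)‖ ^ 2 := by
    intro i
    have hm := hn.leftEnd_lt_rightEnd b i
    have hm2 : (rightEnd n b i : ℕ) ≤ N := Nat.le_of_lt_succ (rightEnd n b i).isLt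
    have hstab :=
      trunc_stable P K w.fst hf ht hg hg1 hU hRH0 hRH hctrl hK hKN hA hB hmu hm hm2
    have hAt := norm_truncSeq_le hU0 hA (leftEnd n b i) (rightEnd n b i)
    have hBt := norm_truncSeq_le hU0 hB (leftEnd n b i) (rightEnd n b i)
    have heq := lqKKT_subError P hKs hf hd hd0 hm (hs i).1 (hs i).2.2
    have h2 : ‖scale
      (fun k : Fin (N + 1) => (1 + ε) ^ endDist N b (leftEnd n b i) (rightEnd n b i) k)
        (subError (s i) d (leftEnd n b i) (rightEnd n b i))‖
        ≤ 2 * C * ‖subResidual P K w.fst mu d (leftEnd n b i) (rightEnd n b i)‖ := by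
      rw [← scale_subResidual P K w.fst mu d b _ _ (1 + ε), ← heq]
      generalize truncSeq (leftEnd n b i) (rightEnd n b i) (fun k => P.A k (w.fst.fst k)) = A' at *
      generalize truncSeq (leftEnd n b i) (rightEnd n b i) (fun k => P.B k (w.fst.fst k)) = B' at *
      generalize truncHess K mu (leftEnd n b i) (rightEnd n b i) = K' at *
      exact norm_scale_endDist_le A' B' K' hU0 hε0 hC0.le hAt hBt hstab hCε b _ _ _
    rw [← mul_pow]
    gcongr
  have h3 := pow_mul_norm_sub_sq_le hn hN b hcomp d (by positivity : 0 ≤ 1 + ε)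
  have h4 := sum_norm_sq_subResidual_le P K w.fst hmu0.le hU0 hK hA d hn b
  have h5 : ((1 + ε) ^ b) ^ 2 * ‖d' - d‖ ^ 2 ≤ (4 * C * (U + mu) * ‖d‖) ^ 2 := by
    calc _ ≤ _ := h3
      _ ≤ ∑ i, (2 * C) ^ 2 * ‖subResidual P K w.fst mu d (leftEnd n b i) (rightEnd n b i)‖ ^ 2 :=
          Finset.sum_le_sum fun i _ => h1 i
      _ = (2 * C) ^ 2 * ∑ i, ‖subResidual P K w.fst mu d (leftEnd n b i) (rightEnd n b i)‖ ^ 2 :=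
          (Finset.mul_sum ..).symm
      _ ≤ (2 * C) ^ 2 * ((2 * (U + mu) ^ 2 + 1) * ‖d‖ ^ 2) := by gcongr
      _ ≤ (2 * C) ^ 2 * ((2 * (U + mu)) ^ 2 * ‖d‖ ^ 2) := by
          gcongr
          nlinarith
      _ = _ := by ring
  rw [← mul_pow] at h5
  have h6 := le_of_sq_le_sq h5 (by positivity)
  rw [hω, inv_pow]
  have hp : 0 < (1 + ε) ^ b := by positivity
  rw [mul_right_comm, ← div_eq_mul_inv, le_div_iff₀ hp]
  linarith

/-! ### The gradient of the Lagrangian in the multipliers -/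

theorem gradLam_eq_constr (P : Problem nx nu N) (z : Primal nx nu N) (lam : Dual nx N) :
    P.gradLam z lam = P.constr z := by
  refine HasGradientAt.gradient ?_
  rw [hasGradientAt_iff_hasFDerivAt]
  have h2 : HasFDerivAt (fun l : Dual nx N => ⟪P.constr z, l⟫_ℝ) (innerSL ℝ (P.constr z)) lam :=
    (innerSL ℝ (P.constr z)).hasFDerivAt
  have h3 : (fun l : Dual nx N => P.lagrangian z l)
      = fun l => P.cost z + ⟪P.constr z, l⟫_ℝ := by
    funext l
    rw [Problem.lagrangian, real_inner_comm]
  rw [h3]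
  exact (h2.const_add _).congr_fderiv rfl

theorem constr_zero (P : Problem nx nu N) (z : Primal nx nu N) :
    P.constr z 0 = state z 0 - P.xbar0 := rfl

/-- A Newton direction does not move the initial state once this has the prescribed value. -/
theorem state_newton_zero (P : Problem nx nu N) {K : BlockHess nx nu N} {w d : PrimalDual nx nu N}
    (hf : ∀ k, DifferentiableAt ℝ (P.f k) (w.fst.fst k)) (hd : P.IsNewtonDir K w d)
    (hw : state w.fst 0 = P.xbar0) : state d.fst 0 = 0 := by
  rw [(newton_stage P hf hd).2.2.1, gradLam_eq_constr, constr_zero, hw, sub_self, neg_zero]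

theorem state_fotd_zero (P : Problem nx nu N) {K : BlockHess nx nu N} {w d : PrimalDual nx nu N}
    (hN : 0 < N) {mu : ℝ} {M : ℕ} {n : Fin (M + 1) → Fin (N + 1)} (hn : IsKnots n) {b : ℕ}
    (hd : P.IsFOTDDir K mu n b w d) : state d.fst 0 = 0 := by
  obtain ⟨s, hs, hcomp⟩ := hd
  obtain ⟨i, h1, h2⟩ := hn.exists_block hN
  have h3 : leftEnd n b i = (⟨0, hN⟩ : Fin N).castSucc := by
    refine Fin.ext ?_
    change (n i.castSucc : ℕ) - b = 0
    omega
  have h4 := (hs i).1.1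
  rw [h3] at h4
  rw [show (0 : Fin (N + 1)) = (⟨0, hN⟩ : Fin N).castSucc from rfl, state_castSucc,
    (hcomp.1 i ⟨0, hN⟩ h1 h2).1]
  exact h4

theorem state_iterate_zero (P : Problem nx nu N) {w d : ℕ → PrimalDual nx nu N} {α : ℕ → ℝ}
    (hw0 : state (w 0).fst 0 = P.xbar0) (hd : ∀ τ, state (d τ).fst 0 = 0)
    (hw : ∀ τ, w (τ + 1) = w τ + α τ • d τ) (τ : ℕ) : state (w τ).fst 0 = P.xbar0 := by
  induction τ with
  | zero => exact hw0
  | succ τ ih =>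
    rw [hw, show (w τ + α τ • d τ).fst = (w τ).fst + α τ • (d τ).fst from rfl, state_add,
      state_smul, hd, smul_zero, add_zero, ih]

/-! ### Calculus of the exact augmented Lagrangian -/

section AugmentedLagrangian

variable {X Y : Type*} [NormedAddCommGroup X] [InnerProductSpace ℝ X]
  [NormedAddCommGroup Y] [InnerProductSpace ℝ Y]

/-- The Lagrangian of the problem `min φ(x)` subject to `c(x) = 0`. -/
def lagr (φ : X → ℝ) (c : X → Y) (x : X) (y : Y) : ℝ := φ x + ⟪y, c x⟫_ℝ

variable {φ : X → ℝ} {c : X → Y}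

theorem hasFDerivAt_lagr {x : X} (hφ : DifferentiableAt ℝ φ x) (hc : DifferentiableAt ℝ c x)
    (y : Y) : HasFDerivAt (fun x' => lagr φ c x' y)
      (fderiv ℝ φ x + (innerSL ℝ y).comp (fderiv ℝ c x)) x :=
  hφ.hasFDerivAt.add ((innerSL ℝ y).hasFDerivAt.comp x hc.hasFDerivAt)

theorem contDiff_fst_withLp {n : WithTop ℕ∞} : ContDiff ℝ n (fun w : WithLp 2 (X × Y) => w.fst) :=
  (WithLp.fstL 2 ℝ X Y).contDiff

theorem contDiff_snd_withLp {n : WithTop ℕ∞} : ContDiff ℝ n (fun w : WithLp 2 (X × Y) => w.snd) :=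
  (WithLp.sndL 2 ℝ X Y).contDiff

theorem contDiff_lagr {n : WithTop ℕ∞} (hφ : ContDiff ℝ n φ) (hc : ContDiff ℝ n c) :
    ContDiff ℝ n (fun w : WithLp 2 (X × Y) => lagr φ c w.fst w.snd) :=
  (hφ.comp contDiff_fst_withLp).add
    (contDiff_snd_withLp.inner ℝ (hc.comp contDiff_fst_withLp))

variable [CompleteSpace X]

/-- The inverse Riesz map as an `ℝ`-linear map; `InnerProductSpace.toDual` is conjugate linear. -/
def rieszInv (X : Type*) [NormedAddCommGroup X] [InnerProductSpace ℝ X] [CompleteSpace X] :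
    StrongDual ℝ X →L[ℝ] X :=
  LinearMap.mkContinuous
    { toFun := (InnerProductSpace.toDual ℝ X).symm
      map_add' := map_add _
      map_smul' := fun c x => by simp } 1 (fun x => by simp)

theorem inner_rieszInv (l : StrongDual ℝ X) (x : X) : ⟪rieszInv X l, x⟫_ℝ = l x :=
  InnerProductSpace.toDual_symm_apply

/-- The gradient of the Lagrangian in the primal variable. -/
def lagrGrad (φ : X → ℝ) (c : X → Y) (x : X) (y : Y) : X := gradient (fun x' => lagr φ c x' y) x

/-- The Hessian of the Lagrangian in the primal variable. -/
def lagrHess (φ : X → ℝ) (c : X → Y) (x : X) (y : Y) : X →L[ℝ] X :=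
  fderiv ℝ (fun x' => lagrGrad φ c x' y) x

/-- The exact augmented Lagrangian. -/
def augLagr (φ : X → ℝ) (c : X → Y) (η₁ η₂ : ℝ) (w : WithLp 2 (X × Y)) : ℝ :=
  lagr φ c w.fst w.snd + η₁ / 2 * ‖c w.fst‖ ^ 2 + η₂ / 2 * ‖lagrGrad φ c w.fst w.snd‖ ^ 2

theorem lagrGrad_eq {x : X} (hφ : DifferentiableAt ℝ φ x) (hc : DifferentiableAt ℝ c x) (y : Y) :
    lagrGrad φ c x y = rieszInv X (fderiv ℝ φ x + (innerSL ℝ y).comp (fderiv ℝ c x)) := by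
  rw [lagrGrad, gradient, (hasFDerivAt_lagr hφ hc y).fderiv]; rfl

theorem inner_lagrGrad {x : X} (hφ : DifferentiableAt ℝ φ x) (hc : DifferentiableAt ℝ c x) (y : Y)
    (v : X) : ⟪lagrGrad φ c x y, v⟫_ℝ = fderiv ℝ φ x v + ⟪y, fderiv ℝ c x v⟫_ℝ := by
  rw [lagrGrad_eq hφ hc, inner_rieszInv]; rfl

theorem contDiff_lagrGrad (hφ : ContDiff ℝ 3 φ) (hc : ContDiff ℝ 3 c) :
    ContDiff ℝ 2 (fun w : WithLp 2 (X × Y) => lagrGrad φ c w.fst w.snd) := by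
  have hφ' := hφ.differentiable (by norm_num)
  have hc' := hc.differentiable (by norm_num)
  have h1 : ContDiff ℝ 2 (fderiv ℝ φ) := hφ.fderiv_right (by norm_num)
  have h2 : ContDiff ℝ 2 (fderiv ℝ c) := hc.fderiv_right (by norm_num)
  simp only [lagrGrad_eq (hφ' _) (hc' _)]
  exact (rieszInv X).contDiff.comp ((h1.comp contDiff_fst_withLp).add
    (((innerSL ℝ).contDiff.comp contDiff_snd_withLp).clm_comp (h2.comp contDiff_fst_withLp)))

theorem contDiff_augLagr (hφ : ContDiff ℝ 3 φ) (hc : ContDiff ℝ 3 c) (η₁ η₂ : ℝ) :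
    ContDiff ℝ 2 (augLagr φ c η₁ η₂) := by
  have h1 : ContDiff ℝ 2 (fun w : WithLp 2 (X × Y) => lagr φ c w.fst w.snd) :=
    contDiff_lagr (hφ.of_le (by norm_num)) (hc.of_le (by norm_num))
  have h2 : ContDiff ℝ 2 (fun w : WithLp 2 (X × Y) => c w.fst) :=
    (hc.of_le (by norm_num)).comp contDiff_fst_withLp
  exact (h1.add (contDiff_const.mul (h2.norm_sq ℝ))).add
    (contDiff_const.mul ((contDiff_lagrGrad hφ hc).norm_sq ℝ))

variable [CompleteSpace Y]

theorem lagrGrad_add_right {x : X} (hφ : DifferentiableAt ℝ φ x) (hc : DifferentiableAt ℝ c x)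
    (y y' : Y) :
    lagrGrad φ c x (y + y') = lagrGrad φ c x y + (fderiv ℝ c x).adjoint y' := by
  refine ext_inner_right ℝ fun v => ?_
  rw [inner_add_left, inner_lagrGrad hφ hc, inner_lagrGrad hφ hc,
    ContinuousLinearMap.adjoint_inner_left, inner_add_left, add_assoc]

/-- The derivative of the gradient of the Lagrangian in both variables: it is affine in the
multiplier, with linear part the adjoint of the Jacobian. -/
theorem fderiv_lagrGrad (hφ : ContDiff ℝ 3 φ) (hc : ContDiff ℝ 3 c) (w v : WithLp 2 (X × Y)) :
    fderiv ℝ (fun w : WithLp 2 (X × Y) => lagrGrad φ c w.fst w.snd) w v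
      = lagrHess φ c w.fst w.snd v.fst + (fderiv ℝ c w.fst).adjoint v.snd := by
  have hφ' := hφ.differentiable (by norm_num)
  have hc' := hc.differentiable (by norm_num)
  set Γ := fun w : WithLp 2 (X × Y) => lagrGrad φ c w.fst w.snd with hΓ
  set e := (WithLp.prodContinuousLinearEquiv 2 ℝ X Y).symm with he
  have hd : HasFDerivAt Γ (fderiv ℝ Γ w) (e (w.fst, w.snd)) :=
    ((contDiff_lagrGrad hφ hc).differentiable (by norm_num) w).hasFDerivAt
  have h1 : HasFDerivAt (fun x : X => lagrGrad φ c x w.snd) ((fderiv ℝ Γ w).comp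
      ((e : _ →L[ℝ] WithLp 2 (X × Y)).comp (ContinuousLinearMap.inl ℝ X Y))) w.fst :=
    HasFDerivAt.comp (f := fun x : X => e (x, w.snd)) w.fst hd
      (e.toContinuousLinearMap.hasFDerivAt.comp w.fst (hasFDerivAt_prodMk_left w.fst w.snd))
  have h2 : HasFDerivAt (fun y : Y => lagrGrad φ c w.fst y) ((fderiv ℝ Γ w).comp
      ((e : _ →L[ℝ] WithLp 2 (X × Y)).comp (ContinuousLinearMap.inr ℝ X Y))) w.snd :=
    HasFDerivAt.comp (f := fun y : Y => e (w.fst, y)) w.snd hd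
      (e.toContinuousLinearMap.hasFDerivAt.comp w.snd (hasFDerivAt_prodMk_right w.fst w.snd))
  have h3 : HasFDerivAt (fun y : Y => lagrGrad φ c w.fst y) (fderiv ℝ c w.fst).adjoint w.snd := by
    have : (fun y : Y => lagrGrad φ c w.fst y)
        = fun y => lagrGrad φ c w.fst 0 + (fderiv ℝ c w.fst).adjoint y := by
      funext y
      rw [← lagrGrad_add_right (hφ' _) (hc' _), zero_add]
    rw [this]
    exact (fderiv ℝ c w.fst).adjoint.hasFDerivAt.const_add _
  rw [lagrHess, h1.fderiv, h3.unique h2]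
  simp only [ContinuousLinearMap.comp_apply]
  rw [← map_add]
  congr 1
  change v = e (v.fst, 0) + e (0, v.snd)
  rw [← map_add, Prod.mk_add_mk, add_zero, zero_add]
  rfl

/-- The directional derivative of the augmented Lagrangian. -/
theorem fderiv_augLagr (hφ : ContDiff ℝ 3 φ) (hc : ContDiff ℝ 3 c) (η₁ η₂ : ℝ)
    (w v : WithLp 2 (X × Y)) :
    fderiv ℝ (augLagr φ c η₁ η₂) w v
      = ⟪lagrGrad φ c w.fst w.snd, v.fst⟫_ℝ + ⟪c w.fst, v.snd⟫_ℝ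
        + η₁ * ⟪c w.fst, fderiv ℝ c w.fst v.fst⟫_ℝ
        + η₂ * ⟪lagrGrad φ c w.fst w.snd, lagrHess φ c w.fst w.snd v.fst
            + (fderiv ℝ c w.fst).adjoint v.snd⟫_ℝ := by
  have hφ' := hφ.differentiable (by norm_num)
  have hc' := hc.differentiable (by norm_num)
  have hF : HasFDerivAt (fun w : WithLp 2 (X × Y) => w.fst) (WithLp.fstL 2 ℝ X Y) w :=
    (WithLp.fstL 2 ℝ X Y).hasFDerivAt
  have hS : HasFDerivAt (fun w : WithLp 2 (X × Y) => w.snd) (WithLp.sndL 2 ℝ X Y) w :=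
    (WithLp.sndL 2 ℝ X Y).hasFDerivAt
  have hcF : HasFDerivAt (fun w : WithLp 2 (X × Y) => c w.fst) _ w :=
    (hc' w.fst).hasFDerivAt.comp w hF
  have hφF : HasFDerivAt (fun w : WithLp 2 (X × Y) => φ w.fst) _ w :=
    (hφ' w.fst).hasFDerivAt.comp w hF
  have hL : HasFDerivAt (fun w : WithLp 2 (X × Y) => lagr φ c w.fst w.snd) _ w :=
    hφF.add (hS.inner ℝ hcF)
  have hΓ := ((contDiff_lagrGrad hφ hc).differentiable (by norm_num) w).hasFDerivAt
  have h : HasFDerivAt (augLagr φ c η₁ η₂) _ w :=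
    (hL.add (hcF.norm_sq.const_mul (η₁ / 2))).add (hΓ.norm_sq.const_mul (η₂ / 2))
  rw [h.fderiv]
  simp only [add_apply, smul_apply, ContinuousLinearMap.comp_apply, fderiv_lagrGrad hφ hc,
    innerSL_apply_apply, smul_eq_mul, nsmul_eq_mul, ContinuousLinearMap.prod_apply,
    fderivInnerCLM_apply, WithLp.fstL_apply, WithLp.sndL_apply]
  rw [inner_lagrGrad (hφ' _) (hc' _) w.snd v.fst, real_inner_comm (c w.fst) v.snd]
  push_cast
  ring

theorem continuous_lagrHess (hφ : ContDiff ℝ 3 φ) (hc : ContDiff ℝ 3 c) :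
    Continuous (fun w : WithLp 2 (X × Y) => lagrHess φ c w.fst w.snd) := by
  have h1 : (fun w : WithLp 2 (X × Y) => lagrHess φ c w.fst w.snd)
      = fun w => (fderiv ℝ (fun w : WithLp 2 (X × Y) => lagrGrad φ c w.fst w.snd) w).comp
        (((WithLp.prodContinuousLinearEquiv 2 ℝ X Y).symm : _ →L[ℝ] WithLp 2 (X × Y)).comp
          (ContinuousLinearMap.inl ℝ X Y)) := by
    funext w
    refine ContinuousLinearMap.ext fun x => ?_
    rw [ContinuousLinearMap.comp_apply, fderiv_lagrGrad hφ hc]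
    change _ = lagrHess φ c w.fst w.snd x + (fderiv ℝ c w.fst).adjoint 0
    rw [map_zero, add_zero]
  rw [h1]
  exact ((contDiff_lagrGrad hφ hc).continuous_fderiv (by norm_num)).clm_comp continuous_const

end AugmentedLagrangian

/-! ### Smoothness of the dynamic program -/

theorem Problem.IsContDiff.mono {P : Problem nx nu N} {r s : ℕ} (h : P.IsContDiff r)
    (hs : s ≤ r) : P.IsContDiff s :=
  have hs' : (s : WithTop ℕ∞) ≤ r := by exact_mod_cast hs
  ⟨fun k => (h.1 k).of_le hs', h.2.1.of_le hs', fun k => (h.2.2 k).of_le hs'⟩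

theorem Problem.IsContDiff.cost {P : Problem nx nu N} {r : ℕ} (h : P.IsContDiff r) :
    ContDiff ℝ r P.cost :=
  (ContDiff.sum fun k _ => (h.1 k).comp (stageProj k).contDiff).add
    (h.2.1.comp (WithLp.sndL 2 ℝ (PiLp 2 (fun _ : Fin N => StageVar nx nu)) (E nx)).contDiff)

theorem Problem.IsContDiff.constr {P : Problem nx nu N} {r : ℕ} (h : P.IsContDiff r) :
    ContDiff ℝ r P.constr := by
  have hst : ∀ k : Fin (N + 1), ContDiff ℝ r (fun z' : Primal nx nu N => state z' k) := fun k => by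
    simp only [← stateProj_apply]
    exact (stateProj k).contDiff
  rw [contDiff_piLp]
  intro i
  refine Fin.cases ?_ (fun k => ?_) i
  · exact (hst 0).sub contDiff_const
  · exact (hst k.succ).sub ((h.2.2 k).comp (stageProj k).contDiff)

theorem Problem.IsContDiff.differentiableAt_f {P : Problem nx nu N} {r : ℕ} (h : P.IsContDiff r)
    (hr : r ≠ 0) (k : Fin N) (v : StageVar nx nu) : DifferentiableAt ℝ (P.f k) v :=
  (h.2.2 k).differentiable (by exact_mod_cast hr) v

theorem augL_eq_augLagr (P : Problem nx nu N) (eta1 eta2 : ℝ) :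
    P.augL eta1 eta2 = augLagr P.cost P.constr eta1 eta2 := by
  funext w
  rw [Problem.augL, gradLam_eq_constr]; rfl

theorem inner_gradient_eq_fderiv {F : Type*} [NormedAddCommGroup F] [InnerProductSpace ℝ F]
    [CompleteSpace F] (f : F → ℝ) (x v : F) : ⟪gradient f x, v⟫_ℝ = fderiv ℝ f x v :=
  InnerProductSpace.toDual_symm_apply

/-! ### Compactness and the constants -/

theorem ProdSet.isCompact_primal {S : ProdSet nx nu N} (h1 : ∀ k, IsCompact (S.Z k))
    (h2 : IsCompact S.ZN) : IsCompact S.primal := by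
  have h3 : S.primal = (fun p : (Fin N → StageVar nx nu) × E nx =>
      (WithLp.toLp 2 (WithLp.toLp 2 p.1, p.2) : Primal nx nu N)) ''
        (Set.pi Set.univ S.Z ×ˢ S.ZN) := by
    ext z
    constructor
    · rintro ⟨ha, hb⟩
      exact ⟨(fun k => z.fst k, z.snd), ⟨fun k _ => ha k, hb⟩, rfl⟩
    · rintro ⟨p, ⟨ha, hb⟩, rfl⟩
      exact ⟨fun k => ha k trivial, hb⟩
  rw [h3]
  refine ((isCompact_univ_pi h1).prod h2).image ?_
  exact (WithLp.prod_continuous_toLp 2 _ _).comp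
    (((PiLp.continuous_toLp 2 _).comp continuous_fst).prodMk continuous_snd)

theorem ProdSet.isCompact_dual {S : ProdSet nx nu N} (h : ∀ k, IsCompact (S.L k)) :
    IsCompact S.dual := by
  have h3 : S.dual = (fun p : Fin (N + 1) → E nx => (WithLp.toLp 2 p : Dual nx N)) ''
        (Set.pi Set.univ S.L) := by
    ext l
    constructor
    · intro ha
      exact ⟨fun k => l k, fun k _ => ha k, rfl⟩
    · rintro ⟨p, ha, rfl⟩
      exact fun k => ha k trivial
  rw [h3]
  exact (isCompact_univ_pi h).image (PiLp.continuous_toLp 2 _)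

/-- The product of the primal and the dual part of `S`, as a set of pairs. -/
def ProdSet.pairs (S : ProdSet nx nu N) : Set (PrimalDual nx nu N) :=
  {w | w.fst ∈ S.primal ∧ w.snd ∈ S.dual}

theorem ProdSet.isCompact_pairs {S : ProdSet nx nu N} (h1 : IsCompact S.primal)
    (h2 : IsCompact S.dual) : IsCompact S.pairs := by
  have h3 : S.pairs = (WithLp.toLp 2 : _ → PrimalDual nx nu N) '' (S.primal ×ˢ S.dual) := by
    ext w
    constructor
    · intro ha
      exact ⟨(w.fst, w.snd), ha, rfl⟩
    · rintro ⟨p, ha, rfl⟩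
      exact ha
  rw [h3]
  exact (h1.prod h2).image (WithLp.prod_continuous_toLp 2 _ _)

theorem exists_isUpsHG {P : Problem nx nu N} (hP : P.IsContDiff 3) {S : ProdSet nx nu N}
    (h1 : IsCompact S.primal) (h2 : IsCompact S.dual) : ∃ c, P.IsUpsHG S c := by
  obtain ⟨a, ha⟩ := (ProdSet.isCompact_pairs h1 h2).exists_bound_of_continuousOn
    (continuous_lagrHess hP.cost hP.constr).continuousOn
  obtain ⟨b, hb⟩ := h1.exists_bound_of_continuousOn
    (hP.constr.continuous_fderiv (by norm_num)).continuousOn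
  refine ⟨max 1 (max a b), by positivity, fun z hz lam hlam => ?_, fun z hz => ?_⟩
  · exact (ha (WithLp.toLp 2 (z, lam)) ⟨hz, hlam⟩).trans
      ((le_max_left a b).trans (le_max_right _ _))
  · exact (hb z hz).trans ((le_max_right a b).trans (le_max_right _ _))

theorem isUnit_of_norm_le {F : Type*} [NormedAddCommGroup F] [NormedSpace ℝ F]
    [FiniteDimensional ℝ F] {T : F →L[ℝ] F} {c : ℝ} (hc : 0 ≤ c) (h : ∀ v, ‖v‖ ≤ c * ‖T v‖) :
    IsUnit T ∧ ‖Ring.inverse T‖ ≤ c := by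
  have := FiniteDimensional.complete ℝ F
  have hinj : Function.Injective (T : F →ₗ[ℝ] F) := by
    rw [injective_iff_map_eq_zero]
    intro v hv
    have h1 : T v = 0 := hv
    have h2 := h v
    rw [h1, norm_zero, mul_zero] at h2
    exact norm_le_zero_iff.1 h2
  have hu : IsUnit T := ContinuousLinearMap.isUnit_iff_bijective.2
    ⟨hinj, LinearMap.injective_iff_surjective.1 hinj⟩
  refine ⟨hu, ContinuousLinearMap.opNorm_le_bound _ hc fun y => ?_⟩
  have h3 : T (Ring.inverse T y) = y := by
    rw [← mul_apply_eq_comp, Ring.mul_inverse_cancel T hu]; rfl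
  simpa only [h3] using h (Ring.inverse T y)

/-! ### Descent along inexact Newton directions -/

section Descent

variable {X Y : Type*} [NormedAddCommGroup X] [InnerProductSpace ℝ X] [CompleteSpace X]
  [NormedAddCommGroup Y] [InnerProductSpace ℝ Y] [CompleteSpace Y]

/-- The directional derivative of the exact augmented Lagrangian, for a point with gradient
`(g, f)`, Jacobian `G` and Hessian `H`. -/
def augDeriv (G : X →L[ℝ] Y) (H : X →L[ℝ] X) (η₁ η₂ : ℝ) (g : X) (f : Y) (u : X) (l : Y) : ℝ :=
  ⟪g, u⟫_ℝ + ⟪f, l⟫_ℝ + η₁ * ⟪f, G u⟫_ℝ + η₂ * ⟪g, H u + G.adjoint l⟫_ℝ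

theorem augDeriv_add (G : X →L[ℝ] Y) (H : X →L[ℝ] X) (η₁ η₂ : ℝ) (g : X) (f : Y) (u u' : X)
    (l l' : Y) : augDeriv G H η₁ η₂ g f (u + u') (l + l')
      = augDeriv G H η₁ η₂ g f u l + augDeriv G H η₁ η₂ g f u' l' := by
  simp only [augDeriv, map_add, inner_add_right]
  ring

/-- The elementary inequality behind the descent estimate: `a = ‖g‖`, `b = ‖f‖`, `m = ‖l‖`,
`n = ‖u‖`, and `p`, `q` are the norms of the components of `u` in the kernel of `G` and in a
complement. -/
theorem descent_ineq {a b m n p q γ r U η₁ η₂ : ℝ} (hn : 0 ≤ n) (hγ : 0 < γ) (hr : 0 < r) (hrU : r ≤ U)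
    (hη₂ : 0 < η₂) (h1 : 17 / (η₂ * γ) ≤ η₁) (h2 : η₂ ≤ r / (12 * U ^ 2))
    (hl : γ * m ^ 2 ≤ (a + U * n) ^ 2) (hu : n ≤ p + q) (hqb : γ * q ^ 2 ≤ b ^ 2) :
    -(r * p ^ 2 - 2 * U * p * q - U * q ^ 2) + 2 * (b * m) - η₁ * b ^ 2 - η₂ * a ^ 2
      + η₂ * (a * (2 * U * n)) ≤ -(η₂ / 2) * a ^ 2 - η₁ / 2 * b ^ 2 := by
  have hU : 0 < U := hr.trans_le hrU
  have hηγ : 0 < η₂ * γ := by positivity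
  have h2' : 12 * (η₂ * U ^ 2) ≤ r := by
    rw [le_div_iff₀ (by positivity)] at h2; linarith
  have hinv : 1 / (η₂ * γ) ≤ η₁ / 17 := by
    rw [show (17 : ℝ) / (η₂ * γ) = 17 * (1 / (η₂ * γ)) by ring] at h1; linarith
  -- the multiplier term
  have e1 : 2 * (b * m) ≤ 8 / 17 * η₁ * b ^ 2 + η₂ / 4 * a ^ 2 + η₂ * U ^ 2 / 4 * n ^ 2 := by
    have i1 : 2 * (b * m) ≤ 8 * (1 / (η₂ * γ)) * b ^ 2 + η₂ * γ / 8 * m ^ 2 := by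
      have : 0 ≤ (8 * b - η₂ * γ * m) ^ 2 / (8 * (η₂ * γ)) := by positivity
      have e : (8 * b - η₂ * γ * m) ^ 2 / (8 * (η₂ * γ))
          = 8 * (1 / (η₂ * γ)) * b ^ 2 + η₂ * γ / 8 * m ^ 2 - 2 * (b * m) := by
        field_simp; ring
      linarith
    have i2 : 8 * (1 / (η₂ * γ)) * b ^ 2 ≤ 8 * (η₁ / 17) * b ^ 2 := by gcongr
    have i3 : γ * m ^ 2 ≤ 2 * a ^ 2 + 2 * (U * n) ^ 2 := by nlinarith [sq_nonneg (a - U * n)]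
    have i4 : η₂ / 8 * (γ * m ^ 2) ≤ η₂ / 8 * (2 * a ^ 2 + 2 * (U * n) ^ 2) := by gcongr
    linarith
  -- the term of the Hessians
  have e2 : η₂ * (a * (2 * U * n)) ≤ η₂ / 4 * a ^ 2 + 4 * (η₂ * U ^ 2) * n ^ 2 := by
    have : 0 ≤ η₂ * (a / 2 - 2 * (U * n)) ^ 2 := by positivity
    linarith
  have e3 : n ^ 2 ≤ 5 / 4 * p ^ 2 + 5 * q ^ 2 := by
    have : n ^ 2 ≤ (p + q) ^ 2 := by gcongr
    nlinarith [sq_nonneg (p - 4 * q)]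
  have e4 : 17 / 4 * (η₂ * U ^ 2) * n ^ 2 ≤ 17 / 48 * r * (5 / 4 * p ^ 2 + 5 * q ^ 2) := by
    have i1 : 17 / 4 * (η₂ * U ^ 2) ≤ 17 / 48 * r := by linarith
    gcongr
  -- all terms in `q` are bounded by `κ q²`
  set κ := U ^ 2 / r with hκ
  have k1 : U ≤ κ := by rw [hκ, le_div_iff₀ hr]; nlinarith
  have k2 : r ≤ κ := hrU.trans k1
  have e5 : 2 * U * p * q ≤ r / 2 * p ^ 2 + 2 * κ * q ^ 2 := by
    have : 0 ≤ (r * p - 2 * U * q) ^ 2 / (2 * r) := by positivity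
    have e : (r * p - 2 * U * q) ^ 2 / (2 * r) = r / 2 * p ^ 2 + 2 * κ * q ^ 2 - 2 * U * p * q := by
      rw [hκ]; field_simp; ring
    linarith
  have e6 : κ * q ^ 2 ≤ η₁ / 204 * b ^ 2 := by
    have i1 : κ ≤ 1 / (12 * η₂) := by
      rw [hκ, div_le_div_iff₀ hr (by positivity)]; nlinarith
    have i2 : q ^ 2 ≤ b ^ 2 / γ := by rw [le_div_iff₀ hγ]; linarith
    calc κ * q ^ 2 ≤ 1 / (12 * η₂) * (b ^ 2 / γ) := by gcongr
      _ = 1 / 12 * (1 / (η₂ * γ)) * b ^ 2 := by field_simp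
      _ ≤ 1 / 12 * (η₁ / 17) * b ^ 2 := by gcongr
      _ = _ := by ring
  have hη₁ : 0 ≤ η₁ := le_trans (by positivity) h1
  have q1 : U * q ^ 2 ≤ κ * q ^ 2 := by gcongr
  have q2 : r * q ^ 2 ≤ κ * q ^ 2 := by gcongr
  have p1 : 0 ≤ r * p ^ 2 := by positivity
  have b1 : 0 ≤ η₁ * b ^ 2 := by positivity
  linarith

/-- The exact Newton direction is a direction of descent. The penalty `η₁` on the constraints pays
for the multiplier and for the part of `u` outside the kernel of `G`, and the coercivity of `K` on
this kernel pays for the difference between `K` and the exact Hessian `H`. -/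
theorem augDeriv_newton_le [FiniteDimensional ℝ Y] (G : X →L[ℝ] Y) (K H : X →L[ℝ] X)
    {γ r U η₁ η₂ : ℝ} (hγ : 0 < γ) (hr : 0 < r) (hrU : r ≤ U) (hη₂ : 0 < η₂)
    (h1 : 17 / (η₂ * γ) ≤ η₁) (h2 : η₂ ≤ r / (12 * U ^ 2))
    (hG : ∀ l, γ * ‖l‖ ^ 2 ≤ ‖G.adjoint l‖ ^ 2) (hK : ∀ v, G v = 0 → r * ‖v‖ ^ 2 ≤ ⟪v, K v⟫_ℝ)
    (hKU : ‖K‖ ≤ U) (hHU : ‖H‖ ≤ U) {g u : X} {f l : Y} (hu : K u + G.adjoint l = -g)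
    (hf : G u = -f) :
    augDeriv G H η₁ η₂ g f u l ≤ -(η₂ / 2) * ‖g‖ ^ 2 - η₁ / 2 * ‖f‖ ^ 2 := by
  obtain ⟨u₁, hu₁, hq⟩ := exists_preimage_of_adjoint_bound G hγ hG (-f)
  rw [norm_neg] at hq
  set u₀ := u - u₁ with hu₀
  have hG0 : G u₀ = 0 := by rw [hu₀, map_sub, hf, hu₁, sub_self]
  have hsum : u = u₀ + u₁ := by rw [hu₀, sub_add_cancel]
  have hl : G.adjoint l = -(g + K u) := by rw [neg_add, ← hu]; abel
  have c1 : ⟪g, u⟫_ℝ = -⟪u, K u⟫_ℝ + ⟪f, l⟫_ℝ := by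
    have : g = -(K u) - G.adjoint l := by rw [hl]; abel
    rw [this, inner_sub_left, inner_neg_left, real_inner_comm,
      ContinuousLinearMap.adjoint_inner_left, hf, inner_neg_right, real_inner_comm f l]
    ring
  have c2 : augDeriv G H η₁ η₂ g f u l = -⟪u, K u⟫_ℝ + 2 * ⟪f, l⟫_ℝ - η₁ * ‖f‖ ^ 2 - η₂ * ‖g‖ ^ 2
      + η₂ * ⟪g, H u - K u⟫_ℝ := by
    rw [augDeriv, c1, hf, hl, inner_neg_right, real_inner_self_eq_norm_sq,
      show H u + -(g + K u) = (H u - K u) - g by abel, inner_sub_right g,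
      real_inner_self_eq_norm_sq]
    ring
  have c3 : ⟪f, l⟫_ℝ ≤ ‖f‖ * ‖l‖ := real_inner_le_norm _ _
  have c4 : ⟪g, H u - K u⟫_ℝ ≤ ‖g‖ * (2 * U * ‖u‖) := by
    refine (real_inner_le_norm _ _).trans ?_
    gcongr
    have := norm_sub_le (H u) (K u)
    have := H.le_of_opNorm_le hHU u
    have := K.le_of_opNorm_le hKU u
    linarith
  have hU : 0 ≤ U := hr.le.trans hrU
  have c5 : r * ‖u₀‖ ^ 2 - 2 * U * ‖u₀‖ * ‖u₁‖ - U * ‖u₁‖ ^ 2 ≤ ⟪u, K u⟫_ℝ := by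
    have hb : ∀ x y, -(U * ‖x‖ * ‖y‖) ≤ ⟪x, K y⟫_ℝ := fun x y => by
      have i1 := (abs_le.1 (abs_real_inner_le_norm x (K y))).1
      have i2 : ‖x‖ * ‖K y‖ ≤ ‖x‖ * (U * ‖y‖) := by
        gcongr; exact K.le_of_opNorm_le hKU y
      linarith
    have i1 := hK u₀ hG0
    have i2 := hb u₀ u₁
    have i3 := hb u₁ u₀
    have i4 := hb u₁ u₁
    rw [hsum, map_add, inner_add_left, inner_add_right, inner_add_right]
    linarith
  have c6 : γ * ‖l‖ ^ 2 ≤ (‖g‖ + U * ‖u‖) ^ 2 := by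
    refine (hG l).trans ?_
    rw [hl, norm_neg]
    gcongr
    exact (norm_add_le _ _).trans (by gcongr; exact K.le_of_opNorm_le hKU u)
  have c7 := descent_ineq (norm_nonneg u) hγ hr hrU hη₂ h1 h2 c6
    (by rw [hsum]; exact norm_add_le _ _) hq
  have c8 : η₂ * ⟪g, H u - K u⟫_ℝ ≤ η₂ * (‖g‖ * (2 * U * ‖u‖)) := by gcongr
  rw [c2]
  linarith

theorem augDeriv_le (G : X →L[ℝ] Y) (H : X →L[ℝ] X) {U η₁ η₂ : ℝ} (hU : 0 ≤ U) (hη₁ : 0 ≤ η₁)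
    (hη₂ : 0 ≤ η₂) (hG : ‖G‖ ≤ U) (hH : ‖H‖ ≤ U) {g u : X} {f l : Y} {e s : ℝ} (hg : ‖g‖ ≤ e)
    (hf : ‖f‖ ≤ e) (hu : ‖u‖ ≤ s) (hl : ‖l‖ ≤ s) :
    augDeriv G H η₁ η₂ g f u l ≤ (2 + η₁ * U + 2 * η₂ * U) * e * s := by
  have he : 0 ≤ e := (norm_nonneg _).trans hg
  have hs : 0 ≤ s := (norm_nonneg _).trans hu
  have i1 : ⟪g, u⟫_ℝ ≤ e * s := (real_inner_le_norm _ _).trans (by gcongr)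
  have i2 : ⟪f, l⟫_ℝ ≤ e * s := (real_inner_le_norm _ _).trans (by gcongr)
  have i3 : ⟪f, G u⟫_ℝ ≤ e * (U * s) := (real_inner_le_norm _ _).trans (by
    gcongr
    exact (G.le_of_opNorm_le hG u).trans (by gcongr))
  have i4 : ⟪g, H u + G.adjoint l⟫_ℝ ≤ e * (2 * U * s) := (real_inner_le_norm _ _).trans (by
    gcongr
    have j1 := norm_add_le (H u) (G.adjoint l)
    have j2 : ‖H u‖ ≤ U * s := (H.le_of_opNorm_le hH u).trans (by gcongr)
    have j3 : ‖G.adjoint l‖ ≤ U * s := (norm_adjoint_apply_le hG l).trans (by gcongr)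
    linarith)
  have i5 := mul_le_mul_of_nonneg_left i3 hη₁
  have i6 := mul_le_mul_of_nonneg_left i4 hη₂
  unfold augDeriv
  linarith

end Descent

/-! ### Backtracking line search -/

section LineSearch

variable {W : Type*} [NormedAddCommGroup W] [NormedSpace ℝ W]

/-- The condition of sufficient decrease of `F` for the step `a` along `d` at `w`. -/
def SufficientDecrease (F : W → ℝ) (β : ℝ) (w d : W) (a : ℝ) : Prop :=
  F (w + a • d) ≤ F w + β * a * fderiv ℝ F w d

/-- Second order Taylor estimate along a segment. -/
theorem taylor_le {F : W → ℝ} (hF : ContDiff ℝ 2 F) {w d : W} {B : ℝ} (hB : 0 ≤ B)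
    (hb : ∀ a ∈ Set.Icc (0 : ℝ) 1, ‖fderiv ℝ (fderiv ℝ F) (w + a • d)‖ ≤ B) {a : ℝ}
    (ha : a ∈ Set.Icc (0 : ℝ) 1) :
    F (w + a • d) ≤ F w + a * fderiv ℝ F w d + B * a ^ 2 * ‖d‖ ^ 2 := by
  have hF1 : Differentiable ℝ F := hF.differentiable (by norm_num)
  have hF2 : Differentiable ℝ (fderiv ℝ F) :=
    (hF.fderiv_right (m := 1) (by norm_num)).differentiable (by norm_num)
  have hw : w ∈ segment ℝ w (w + a • d) := left_mem_segment _ _ _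
  have hseg : ∀ x ∈ segment ℝ w (w + a • d),
      ‖fderiv ℝ (fderiv ℝ F) x‖ ≤ B ∧ ‖x - w‖ ≤ a * ‖d‖ := by
    intro x hx
    rw [segment_eq_image'] at hx
    obtain ⟨s, hs, rfl⟩ := hx
    have e : w + s • (w + a • d - w) = w + (s * a) • d := by
      rw [add_sub_cancel_left, smul_smul]
    have hsa : s * a ≤ a := mul_le_of_le_one_left ha.1 hs.2
    refine ⟨?_, ?_⟩
    · simp only [e]
      exact hb _ ⟨mul_nonneg hs.1 ha.1, hsa.trans ha.2⟩
    · simp only [e]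
      rw [add_sub_cancel_left, norm_smul, Real.norm_of_nonneg (mul_nonneg hs.1 ha.1)]
      gcongr
  have h1 : ∀ x ∈ segment ℝ w (w + a • d), ‖fderiv ℝ F x - fderiv ℝ F w‖ ≤ B * (a * ‖d‖) := by
    intro x hx
    have := (convex_segment w (w + a • d)).norm_image_sub_le_of_norm_hasFDerivWithin_le
      (f := fderiv ℝ F) (fun y _ => (hF2 y).hasFDerivAt.hasFDerivWithinAt)
      (fun y hy => (hseg y hy).1) hw hx
    exact this.trans (by gcongr; exact (hseg x hx).2)
  have h2 := (convex_segment w (w + a • d)).norm_image_sub_le_of_norm_hasFDerivWithin_le'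
    (f := F) (φ := fderiv ℝ F w) (fun y _ => (hF1 y).hasFDerivAt.hasFDerivWithinAt) h1 hw
    (right_mem_segment _ _ _)
  rw [add_sub_cancel_left, map_smul, norm_smul, Real.norm_of_nonneg ha.1, smul_eq_mul,
    Real.norm_eq_abs] at h2
  have h3 := (abs_le.1 h2).2
  nlinarith

/-- Global convergence of a backtracking line search along directions of sufficient descent: `e τ`
measures stationarity, the directions are bounded by `R e`, and the slopes by `-κ e²`. -/
theorem tendsto_of_sufficientDecrease {F : W → ℝ} (hF : ContDiff ℝ 2 F) {S : Set W}
    (hS : IsCompact S) {w d : ℕ → W} {α e : ℕ → ℝ} {β θ κ R : ℝ} (hβ : β ∈ Set.Ioo (0 : ℝ) (1 / 2))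
    (hθ : θ ∈ Set.Ioo (0 : ℝ) 1) (hκ : 0 < κ) (he : ∀ τ, 0 ≤ e τ)
    (hseg : ∀ τ, ∀ a ∈ Set.Icc (0 : ℝ) 1, w τ + a • d τ ∈ S)
    (hdes : ∀ τ, fderiv ℝ F (w τ) (d τ) ≤ -κ * e τ ^ 2) (hd : ∀ τ, ‖d τ‖ ≤ R * e τ)
    (hrun : ∀ τ, w (τ + 1) = w τ + α τ • d τ ∧
      ∀ j, (SufficientDecrease F β (w τ) (d τ) (θ ^ j) ∧
        ∀ i < j, ¬ SufficientDecrease F β (w τ) (d τ) (θ ^ i)) → α τ = θ ^ j) :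
    (∀ τ, ∃ j, SufficientDecrease F β (w τ) (d τ) (θ ^ j) ∧
        ∀ i < j, ¬ SufficientDecrease F β (w τ) (d τ) (θ ^ i)) ∧
      Tendsto e atTop (𝓝 0) := by
  classical
  obtain ⟨hβ0, hβ1⟩ := hβ
  obtain ⟨hθ0, hθ1⟩ := hθ
  have hF2 : Continuous (fderiv ℝ (fderiv ℝ F)) :=
    (hF.fderiv_right (m := 1) (by norm_num)).continuous_fderiv (by norm_num)
  obtain ⟨B', hB'⟩ := hS.exists_bound_of_continuousOn
    (f := fderiv ℝ (fderiv ℝ F)) hF2.continuousOn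
  set B := max B' 0 with hB
  have hB0 : 0 ≤ B := le_max_right _ _
  set D := B * R ^ 2 + 1 with hD
  have hD0 : 0 < D := by positivity
  -- all steps below `a₀` give sufficient decrease
  set a₀ := κ / (2 * D) with ha₀
  have ha₀0 : 0 < a₀ := by positivity
  have hsmall : ∀ τ, ∀ a : ℝ, 0 ≤ a → a ≤ 1 → a ≤ a₀ →
      SufficientDecrease F β (w τ) (d τ) a := by
    intro τ a h0 h1 h2
    have t1 := taylor_le hF hB0
      (fun a ha => (hB' _ (hseg τ a ha)).trans (le_max_left _ _)) ⟨h0, h1⟩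
    have t2 : ‖d τ‖ ^ 2 ≤ R ^ 2 * e τ ^ 2 := by
      rw [← mul_pow]; exact pow_le_pow_left₀ (norm_nonneg _) (hd τ) 2
    have t3 : B * a ^ 2 * ‖d τ‖ ^ 2 ≤ a * (κ / 2 * e τ ^ 2) := by
      have u1 : a * D ≤ κ / 2 := by
        rw [ha₀, le_div_iff₀ (by positivity)] at h2; linarith
      calc B * a ^ 2 * ‖d τ‖ ^ 2 ≤ B * a ^ 2 * (R ^ 2 * e τ ^ 2) := by gcongr
        _ = a * ((a * (B * R ^ 2)) * e τ ^ 2) := by ring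
        _ ≤ a * ((a * D) * e τ ^ 2) := by gcongr; rw [hD]; linarith
        _ ≤ a * (κ / 2 * e τ ^ 2) := by gcongr
    have t4 : (1 - β) * fderiv ℝ F (w τ) (d τ) ≤ -(κ / 2 * e τ ^ 2) := by
      have := hdes τ
      have : 0 ≤ κ * e τ ^ 2 := by positivity
      nlinarith
    have t5 := mul_le_mul_of_nonneg_left t4 h0
    unfold SufficientDecrease
    linarith
  have hacc : ∀ τ, ∃ j, SufficientDecrease F β (w τ) (d τ) (θ ^ j) ∧
      ∀ i < j, ¬ SufficientDecrease F β (w τ) (d τ) (θ ^ i) := by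
    intro τ
    have hex : ∃ j, SufficientDecrease F β (w τ) (d τ) (θ ^ j) := by
      obtain ⟨j, hj⟩ := exists_pow_lt_of_lt_one ha₀0 hθ1
      exact ⟨j, hsmall τ _ (by positivity) (pow_le_one₀ hθ0.le hθ1.le) hj.le⟩
    exact ⟨Nat.find hex, Nat.find_spec hex, fun i hi => Nat.find_min hex hi⟩
  refine ⟨hacc, ?_⟩
  -- accepted steps are bounded below
  set a₁ := min 1 (θ * a₀) with ha₁
  have ha₁0 : 0 < a₁ := lt_min one_pos (by positivity)
  have hdec : ∀ τ, β * a₁ * κ * e τ ^ 2 ≤ F (w τ) - F (w (τ + 1)) := by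
    intro τ
    obtain ⟨j, hj, hj'⟩ := hacc τ
    have hα := (hrun τ).2 j ⟨hj, hj'⟩
    have hlow : a₁ ≤ α τ := by
      rw [hα]
      cases j with
      | zero => rw [pow_zero]; exact min_le_left _ _
      | succ j =>
        refine (min_le_right _ _).trans ?_
        rw [pow_succ, mul_comm]
        refine mul_le_mul_of_nonneg_right ?_ hθ0.le
        by_contra hlt
        push Not at hlt
        exact hj' j (Nat.lt_succ_self j)
          (hsmall τ _ (by positivity) (pow_le_one₀ hθ0.le hθ1.le) hlt.le)
    rw [← hα] at hj
    unfold SufficientDecrease at hj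
    rw [← (hrun τ).1] at hj
    have u1 : β * α τ * fderiv ℝ F (w τ) (d τ) ≤ β * α τ * (-κ * e τ ^ 2) := by
      have : 0 ≤ β * α τ := mul_nonneg hβ0.le (ha₁0.le.trans hlow)
      exact mul_le_mul_of_nonneg_left (hdes τ) this
    have u2 : β * a₁ * κ * e τ ^ 2 ≤ β * α τ * κ * e τ ^ 2 := by gcongr
    linarith
  have hwS : ∀ τ, w τ ∈ S := fun τ => by
    simpa using hseg τ 0 ⟨le_rfl, zero_le_one⟩
  have hanti : Antitone fun τ => F (w τ) := antitone_nat_of_succ_le fun τ => by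
    have h1 := hdec τ
    have h2 : 0 ≤ β * a₁ * κ * e τ ^ 2 := by positivity
    linarith
  have hbdd : BddBelow (Set.range fun τ => F (w τ)) := by
    refine (hS.bddBelow_image hF.continuous.continuousOn).mono ?_
    rintro _ ⟨τ, rfl⟩
    exact ⟨w τ, hwS τ, rfl⟩
  have hlim := tendsto_atTop_ciInf hanti hbdd
  have hdiff : Tendsto (fun τ => F (w τ) - F (w (τ + 1))) atTop (𝓝 0) := by
    simpa using hlim.sub (hlim.comp (tendsto_add_atTop_nat 1))
  set q := β * a₁ * κ with hq
  have hq0 : 0 < q := by positivity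
  have hsq : Tendsto (fun τ => e τ ^ 2) atTop (𝓝 0) := by
    refine squeeze_zero (fun τ => by positivity) (fun τ => ?_)
      (g := fun τ => (F (w τ) - F (w (τ + 1))) / q) (by simpa using hdiff.div_const q)
    rw [le_div_iff₀ hq0, mul_comm]
    exact hdec τ
  have hsqrt := (Real.continuous_sqrt.tendsto 0).comp hsq
  rw [Real.sqrt_zero] at hsqrt
  refine hsqrt.congr fun τ => ?_
  simp [Real.sqrt_sq (he τ)]

end LineSearch

/-! ### Global convergence for the dynamic program -/

/-- The null space of the constraint Jacobian contains a nonzero vector, moving the last control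
and the last state, so that the lower bound on the reduced Hessian is at most the upper bound. -/
theorem reducedHessian_le (hnu : 0 < nu) (hN : 0 < N) (P : Problem nx nu N)
    (K : BlockHess nx nu N) (z : Primal nx nu N)
    (hf : ∀ k, DifferentiableAt ℝ (P.f k) (z.fst k)) {r U : ℝ} (hU : 0 ≤ U)
    (hK : ∀ k, ‖K.stage k‖ ≤ U) (hKN : ‖K.term‖ ≤ U)
    (hRH : ∀ v, P.jac z v = 0 → r * ‖v‖ ^ 2 ≤ ⟪v, K.toCLM v⟫_ℝ) : r ≤ U := by
  set j : Fin N := ⟨N - 1, by omega⟩ with hj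
  set u : E nu := EuclideanSpace.single ⟨0, hnu⟩ 1 with hu
  set v : Primal nx nu N := WithLp.toLp 2 (WithLp.toLp 2 (fun k : Fin N =>
    if k = j then (WithLp.toLp 2 (0, u) : StageVar nx nu) else 0), P.B j (z.fst j) u) with hv
  have hvk : ∀ k, v.fst k = if k = j then (WithLp.toLp 2 (0, u) : StageVar nx nu) else 0 :=
    fun _ => rfl
  have hvk1 : ∀ k, (v.fst k).fst = 0 := fun k => by rw [hvk]; split_ifs <;> rfl
  have hker : P.jac z v = 0 := by
    rw [jac_eq_dynOp P z hf]
    refine PiLp.ext fun k => ?_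
    refine Fin.cases ?_ (fun k => ?_) k
    · rw [dynOp_zero, show (0 : Fin (N + 1)) = (⟨0, hN⟩ : Fin N).castSucc from rfl,
        state_castSucc, hvk1]
      rfl
    · rw [dynOp_succ, hvk1, map_zero, zero_add]
      by_cases hk : k = j
      · have h1 : k.succ = Fin.last N := by
          rw [hk]; refine Fin.ext ?_
          simp only [Fin.val_succ, Fin.val_last, hj]
          omega
        rw [h1, state_last, hvk, if_pos hk, hk]
        exact sub_self _
      · have h1 : (k : ℕ) + 1 < N := by
          have := k.isLt
          have : (k : ℕ) ≠ N - 1 := fun h => hk (Fin.ext h)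
          omega
        rw [show k.succ = (⟨k + 1, h1⟩ : Fin N).castSucc from rfl, state_castSucc, hvk1, hvk,
          if_neg hk]
        change (0 : E nx) - P.B k (z.fst k) 0 = 0
        rw [map_zero, sub_zero]
  have hpos : 0 < ‖v‖ ^ 2 := by
    have h1 : v ≠ 0 := by
      intro h
      have h2 : v.fst j = 0 := by rw [h]; rfl
      rw [hvk, if_pos rfl] at h2
      have h3 : u = 0 := congrArg (fun p : StageVar nx nu => p.snd) h2
      have h4 : ‖u‖ = 1 := by rw [hu, PiLp.norm_single, norm_one]
      rw [h3, norm_zero] at h4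
      exact zero_ne_one h4
    positivity
  have h1 := hRH v hker
  have h2 : ⟪v, K.toCLM v⟫_ℝ ≤ U * ‖v‖ ^ 2 := by
    refine (real_inner_le_norm _ _).trans ?_
    have := K.toCLM.le_of_opNorm_le (BlockHess.norm_toCLM_le K hU hK hKN) v
    calc ‖v‖ * ‖K.toCLM v‖ ≤ ‖v‖ * (U * ‖v‖) := by gcongr
      _ = _ := by ring
  exact le_of_mul_le_mul_right (h1.trans h2) hpos

theorem exists_isUpsKKT {P : Problem nx nu N} (hP : P.IsContDiff 1)
    {gamRH gamC U : ℝ} {t : ℕ} (ht : 0 < t) (hg : 0 < gamC) (hg1 : gamC ≤ 1) (hU : 2 ≤ U)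
    (hRH0 : 0 < gamRH) {w : ℕ → PrimalDual nx nu N} {K : ℕ → BlockHess nx nu N}
    (hRH : P.ReducedHessianBound gamRH w K) (hctrl : P.Controllable gamC t w)
    (hup : P.UpperBounded U w K) : ∃ c, P.IsUpsKKT w K c := by
  have hγ := gammaG_pos t hg hU
  have hc : 0 < saddleConst (1 / √(gammaG gamC t U)) gamRH U :=
    saddleConst_pos (by positivity) hRH0 (by linarith)
  exact ⟨_, hc, fun τ => isUnit_of_norm_le hc.le
    (kkt_stable P (K τ) (w τ).fst (fun k => hP.differentiableAt_f one_ne_zero k _) ht hg hg1 hU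
      hRH0 (hRH τ) (hctrl τ) (fun k => ((hup τ).1 k).1) (hup τ).2 (fun k => ((hup τ).1 k).2.1)
      (fun k => ((hup τ).1 k).2.2))⟩

theorem Problem.IsUpsKKT.norm_newton_le {P : Problem nx nu N} {w : ℕ → PrimalDual nx nu N}
    {K : ℕ → BlockHess nx nu N} {c : ℝ} (hc : P.IsUpsKKT w K c) {τ : ℕ} {d : PrimalDual nx nu N}
    (hd : P.IsNewtonDir (K τ) (w τ) d) : ‖d‖ ≤ c * ‖P.gradL (w τ)‖ := by
  obtain ⟨hu, hn⟩ := hc.2 τ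
  have h1 : d = Ring.inverse (P.kkt (K τ) (w τ).fst) (-P.gradL (w τ)) := by
    rw [← hd, ← mul_apply_eq_comp, Ring.inverse_mul_cancel _ hu]; rfl
  rw [h1, ← norm_neg (P.gradL (w τ))]
  exact ContinuousLinearMap.le_of_opNorm_le _ hn _

theorem Problem.IsUpsKKT.exists_newton {P : Problem nx nu N} {w : ℕ → PrimalDual nx nu N}
    {K : ℕ → BlockHess nx nu N} {c : ℝ} (hc : P.IsUpsKKT w K c) (τ : ℕ) :
    ∃ d, P.IsNewtonDir (K τ) (w τ) d := by
  refine ⟨Ring.inverse (P.kkt (K τ) (w τ).fst) (-P.gradL (w τ)), ?_⟩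
  rw [Problem.IsNewtonDir, ← mul_apply_eq_comp, Ring.mul_inverse_cancel _ (hc.2 τ).1]; rfl

theorem fderiv_augL (P : Problem nx nu N) (hP : P.IsContDiff 3) (eta1 eta2 : ℝ)
    (w v : PrimalDual nx nu N) : fderiv ℝ (P.augL eta1 eta2) w v
      = augDeriv (P.jac w.fst) (P.hess w.fst w.snd) eta1 eta2 (P.gradZ w.fst w.snd)
        (P.constr w.fst) v.fst v.snd := by
  rw [augL_eq_augLagr, fderiv_augLagr hP.cost hP.constr]; rfl

/-- The error of the direction is so small that half of the descent of the exact Newton direction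
is left. -/
theorem perturbation_ineq {γ r U η₁ η₂ δ e : ℝ} (hγ0 : 0 < γ) (hγ1 : γ ≤ 1) (hr : 0 < r)
    (hrU : r ≤ U) (hU : 2 ≤ U) (hη₁ : 0 < η₁) (hη₂ : 0 < η₂) (h1 : 17 / (η₂ * γ) ≤ η₁)
    (h2 : η₂ ≤ r / (12 * U ^ 2)) (hδ0 : 0 ≤ δ) (hδ : δ ≤ η₂ * γ / (9 * η₁ * U ^ 2)) :
    η₂ ≤ η₁ ∧ δ ≤ 1 ∧ (2 + η₁ * U + 2 * η₂ * U) * e * (δ * (U * e)) ≤ η₂ / 4 * e ^ 2 := by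
  have hU0 : 0 < U := by linarith
  have k1 : η₂ * U ≤ 1 := by
    rw [le_div_iff₀ (by positivity)] at h2
    have : 12 * (η₂ * U) * U ≤ 1 * U := by linarith
    have := le_of_mul_le_mul_right this hU0
    linarith
  have k2 : η₂ ≤ 1 := by nlinarith
  have k3 : 17 ≤ η₁ := by
    rw [div_le_iff₀ (by positivity)] at h1
    have : η₂ * γ ≤ 1 := mul_le_one₀ k2 hγ0.le hγ1
    nlinarith
  rw [le_div_iff₀ (by positivity)] at hδ
  have k4 : η₂ * γ ≤ η₂ := mul_le_of_le_one_right hη₂.le hγ1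
  have k5 : 2 + η₁ * U + 2 * η₂ * U ≤ 2 * (η₁ * U) := by nlinarith
  refine ⟨by linarith, ?_, ?_⟩
  · by_contra hlt
    push Not at hlt
    have : 1 ≤ 9 * η₁ * U ^ 2 := by nlinarith
    nlinarith
  · calc (2 + η₁ * U + 2 * η₂ * U) * e * (δ * (U * e))
        = (2 + η₁ * U + 2 * η₂ * U) * (δ * U * e ^ 2) := by ring
      _ ≤ 2 * (η₁ * U) * (δ * U * e ^ 2) := by gcongr
      _ = 2 / 9 * (δ * (9 * η₁ * U ^ 2)) * e ^ 2 := by ring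
      _ ≤ 2 / 9 * η₂ * e ^ 2 := by gcongr; linarith
      _ ≤ η₂ / 4 * e ^ 2 := by gcongr ?_ * _; linarith

/-- Global convergence of the SQP method with inexact Newton directions. -/
theorem tendsto_gradL (hnu : 0 < nu) (hN : 0 < N) {P : Problem nx nu N}
    {gamRH gamC upsU eta1 eta2 beta theta delta : ℝ} {t : ℕ} (ht : 0 < t)
    (hg : 0 < gamC) (hg1 : gamC ≤ 1) (hU : 2 ≤ upsU) (hRH0 : 0 < gamRH)
    {w d newton : ℕ → PrimalDual nx nu N} {α : ℕ → ℝ} {K : ℕ → BlockHess nx nu N}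
    {S : ProdSet nx nu N} (heta1 : 0 < eta1) (heta2 : 0 < eta2)
    (hbeta : beta ∈ Set.Ioo (0 : ℝ) (1 / 2)) (htheta : theta ∈ Set.Ioo (0 : ℝ) 1)
    (hdelta : 0 ≤ delta) (hrun : P.IsRun eta1 eta2 beta theta w d α)
    (hnewton : ∀ τ, P.IsNewtonDir (K τ) (w τ) (newton τ))
    (herr : ∀ τ, ‖d τ - newton τ‖ ≤ delta * ‖newton τ‖)
    (hRH : P.ReducedHessianBound gamRH w K) (hctrl : P.Controllable gamC t w)
    (hup : P.UpperBounded upsU w K) (hS : P.Compactness upsU S w d) {upsKKT upsHG ups : ℝ}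
    (hKKT : P.IsUpsKKT w K upsKKT) (hHG : P.IsUpsHG S upsHG)
    (hups : ups = max upsU (max upsKKT upsHG))
    (hpen : PenaltyCond gamRH (gammaG gamC t upsU) ups eta1 eta2)
    (hsmall : delta ≤ eta2 * gammaG gamC t upsU / (9 * eta1 * ups ^ 2)) :
    (∀ τ, ∃ j, P.Accepts eta1 eta2 beta theta (w τ) (d τ) j) ∧
      Tendsto (fun τ => ‖P.gradL (w τ)‖) atTop (𝓝 0) := by
  obtain ⟨hP, hcZ, hcZN, hcL, hseg, -, -⟩ := hS
  have hf : ∀ τ k, DifferentiableAt ℝ (P.f k) ((w τ).fst.fst k) := fun τ k =>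
    hP.differentiableAt_f three_ne_zero k _
  have hU1 : upsU ≤ ups := by rw [hups]; exact le_max_left _ _
  have hU2 : upsKKT ≤ ups := by rw [hups]; exact (le_max_left _ _).trans (le_max_right _ _)
  have hU3 : upsHG ≤ ups := by rw [hups]; exact (le_max_right _ _).trans (le_max_right _ _)
  have hups0 : 0 ≤ ups := by linarith
  set γ := gammaG gamC t upsU with hγ
  have hγ0 : 0 < γ := gammaG_pos t hg hU
  have hγ1 : γ ≤ 1 := gammaG_le_one t hg hU
  have hrU : gamRH ≤ ups := (reducedHessian_le hnu hN P (K 0) (w 0).fst (hf 0) (by linarith)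
    (fun k => ((hup 0).1 k).1) (hup 0).2 (hRH 0)).trans hU1
  have hwS : ∀ τ, (w τ).fst ∈ S.primal ∧ (w τ).snd ∈ S.dual := fun τ => by
    have := hseg τ 0 ⟨le_rfl, zero_le_one⟩
    rwa [zero_smul, add_zero] at this
  have hnorm : ∀ τ, ‖newton τ‖ ≤ ups * ‖P.gradL (w τ)‖ := fun τ =>
    (hKKT.norm_newton_le (hnewton τ)).trans (by gcongr)
  have hdiff : ∀ τ, ‖d τ - newton τ‖ ≤ delta * (ups * ‖P.gradL (w τ)‖) := fun τ =>
    (herr τ).trans (by gcongr; exact hnorm τ)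
  have hineq : ∀ e, _ := fun e => perturbation_ineq (e := e) hγ0 hγ1 hRH0 hrU (hU.trans hU1) heta1
    heta2 hpen.1 hpen.2 hdelta hsmall
  have hdes : ∀ τ, fderiv ℝ (P.augL eta1 eta2) (w τ) (d τ)
      ≤ -(eta2 / 4) * ‖P.gradL (w τ)‖ ^ 2 := by
    intro τ
    obtain ⟨i1, i2, i3⟩ := hineq ‖P.gradL (w τ)‖
    have hgl : (P.gradL (w τ)).snd = P.constr (w τ).fst := gradLam_eq_constr P _ _
    have hkkt := hnewton τ
    rw [Problem.IsNewtonDir, P.kkt_apply] at hkkt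
    have hk1 : (K τ).toCLM (newton τ).fst + (P.jac (w τ).fst).adjoint (newton τ).snd
        = -P.gradZ (w τ).fst (w τ).snd := congrArg (fun p : PrimalDual nx nu N => p.fst) hkkt
    have hk2 : P.jac (w τ).fst (newton τ).fst = -P.constr (w τ).fst := by
      rw [← hgl]
      exact congrArg (fun p : PrimalDual nx nu N => p.snd) hkkt
    have hsq : ‖P.gradL (w τ)‖ ^ 2
        = ‖P.gradZ (w τ).fst (w τ).snd‖ ^ 2 + ‖P.constr (w τ).fst‖ ^ 2 := by
      rw [norm_sq_primalDual, hgl]; rfl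
    have hex := augDeriv_newton_le (P.jac (w τ).fst) (K τ).toCLM (P.hess (w τ).fst (w τ).snd) hγ0
      hRH0 hrU heta2 hpen.1 hpen.2
      (gammaG_mul_le_norm_jac_adjoint P (w τ).fst (hf τ) ht hg hg1 hU (hctrl τ)
        (fun k => ((hup τ).1 k).2.1) (fun k => ((hup τ).1 k).2.2)) (hRH τ)
      (BlockHess.norm_toCLM_le (K τ) hups0 (fun k => ((hup τ).1 k).1.trans hU1)
        ((hup τ).2.trans hU1))
      ((hHG.2.1 _ (hwS τ).1 _ (hwS τ).2).trans hU3) hk1 hk2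
    have hcn : ‖P.constr (w τ).fst‖ ≤ ‖P.gradL (w τ)‖ := by
      rw [← hgl]; exact norm_primalDual_snd_le (P.gradL (w τ))
    have her := augDeriv_le (P.jac (w τ).fst) (P.hess (w τ).fst (w τ).snd) hups0 heta1.le heta2.le
      ((hHG.2.2 _ (hwS τ).1).trans hU3) ((hHG.2.1 _ (hwS τ).1 _ (hwS τ).2).trans hU3)
      (norm_primalDual_fst_le (P.gradL (w τ)))
      hcn
      ((norm_primalDual_fst_le _).trans (hdiff τ)) ((norm_primalDual_snd_le _).trans (hdiff τ))
    have hsplit : d τ = newton τ + (d τ - newton τ) := by abel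
    rw [fderiv_augL P hP]
    have hadd := augDeriv_add (P.jac (w τ).fst) (P.hess (w τ).fst (w τ).snd) eta1 eta2
      (P.gradZ (w τ).fst (w τ).snd) (P.constr (w τ).fst) (newton τ).fst (d τ - newton τ).fst
      (newton τ).snd (d τ - newton τ).snd
    have hd1 : (newton τ).fst + (d τ - newton τ).fst = (d τ).fst :=
      congrArg (fun p : PrimalDual nx nu N => p.fst) hsplit.symm
    have hd2 : (newton τ).snd + (d τ - newton τ).snd = (d τ).snd :=
      congrArg (fun p : PrimalDual nx nu N => p.snd) hsplit.symm
    rw [hd1, hd2] at hadd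
    rw [hadd]
    have hmul : eta2 / 2 * ‖P.constr (w τ).fst‖ ^ 2 ≤ eta1 / 2 * ‖P.constr (w τ).fst‖ ^ 2 := by
      gcongr
    have her' := her.trans i3
    rw [hsq] at her' ⊢
    have hgZ : (P.gradL (w τ)).fst = P.gradZ (w τ).fst (w τ).snd := rfl
    rw [hgZ] at her'
    linarith
  have hbound : ∀ τ, ‖d τ‖ ≤ 2 * ups * ‖P.gradL (w τ)‖ := by
    intro τ
    have hδ1 := (hineq 0).2.1
    have h1 : ‖d τ‖ ≤ ‖newton τ‖ + ‖d τ - newton τ‖ := norm_le_norm_add_norm_sub' _ _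
    have h2 : delta * ‖newton τ‖ ≤ 1 * ‖newton τ‖ := by gcongr
    linarith [herr τ, hnorm τ]
  have hsmooth : ContDiff ℝ 2 (P.augL eta1 eta2) := by
    rw [augL_eq_augLagr]
    exact contDiff_augLagr hP.cost hP.constr eta1 eta2
  have harm : ∀ τ a, P.Armijo eta1 eta2 beta (w τ) (d τ) a
      ↔ SufficientDecrease (P.augL eta1 eta2) beta (w τ) (d τ) a := fun τ a => by
    rw [Problem.Armijo, inner_gradient_eq_fderiv, SufficientDecrease]
  simp only [Problem.IsRun, Problem.Accepts, harm] at hrun ⊢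
  exact tendsto_of_sufficientDecrease hsmooth
    (ProdSet.isCompact_pairs (ProdSet.isCompact_primal hcZ hcZN) (ProdSet.isCompact_dual hcL))
    hbeta htheta (by positivity) (fun τ => norm_nonneg _) hseg hdes hbound hrun

theorem decayRate_pos {gamRH gamC U mu : ℝ} (t : ℕ) (hg : 0 < gamC) (hU : 2 ≤ U)
    (hRH0 : 0 < gamRH) (hmu : 0 ≤ mu) : 0 < decayRate gamRH gamC t U mu := by
  have := truncConst_pos t hg hU hRH0 hmu
  unfold decayRate
  positivity

theorem decayRate_lt_one {gamRH gamC U mu : ℝ} (t : ℕ) (hg : 0 < gamC) (hU : 2 ≤ U)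
    (hRH0 : 0 < gamRH) (hmu : 0 ≤ mu) : decayRate gamRH gamC t U mu < 1 := by
  have h1 := truncConst_pos t hg hU hRH0 hmu
  have h2 : 0 < 1 / (4 * U * truncConst gamRH gamC t U mu) := by positivity
  exact inv_lt_one_of_one_lt₀ (by linarith)

/-- The logarithmic condition on the overlap makes the relative error small. -/
theorem mul_pow_le_of_log_le {C ρ x : ℝ} {b : ℕ} (hC : 0 < C) (hρ0 : 0 < ρ) (hρ1 : ρ < 1)
    (hx : 0 < x) (h : Real.log (C / x) / Real.log (1 / ρ) ≤ b) : C * ρ ^ b ≤ x := by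
  have hlog : 0 < Real.log (1 / ρ) := Real.log_pos (by rw [lt_div_iff₀ hρ0]; linarith)
  rw [div_le_iff₀ hlog, ← Real.log_pow,
    Real.log_le_log_iff (by positivity) (by positivity), one_div, inv_pow, div_le_iff₀ hx] at h
  have hp : 0 < ρ ^ b := by positivity
  rwa [inv_mul_eq_div, le_div_iff₀ hp] at h

end FOTD

end

theorem theorem5
    (gamRH gamC upsU : ℝ) (t : ℕ)
    (hgamRH : 0 < gamRH) (hgamC : 0 < gamC) (hgamC' : gamC ≤ 1) (hups : 2 ≤ upsU) (ht : 0 < t) :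
    -- SQP with inexact directions
    (∀ (nx nu N : ℕ) (_ : 0 < nu) (_ : 0 < N) (P : Problem nx nu N)
        (eta1 eta2 beta theta delta : ℝ)
        (w d newton : ℕ → PrimalDual nx nu N) (α : ℕ → ℝ)
        (K : ℕ → BlockHess nx nu N) (S : ProdSet nx nu N),
      0 < eta1 → 0 < eta2 → beta ∈ Set.Ioo (0 : ℝ) (1 / 2) → theta ∈ Set.Ioo (0 : ℝ) 1 →
      delta ∈ Set.Ioo (0 : ℝ) 1 →
      (∀ τ, (K τ).IsSymm) →
      P.IsRun eta1 eta2 beta theta w d α →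
      (∀ τ, P.IsNewtonDir (K τ) (w τ) (newton τ)) →
      (∀ τ, ‖d τ - newton τ‖ ≤ delta * ‖newton τ‖) →
      P.ReducedHessianBound gamRH w K →
      P.Controllable gamC t w →
      P.UpperBounded upsU w K →
      P.Compactness upsU S w d →
      (∃ upsKKT, P.IsUpsKKT w K upsKKT) ∧ (∃ upsHG, P.IsUpsHG S upsHG) ∧
      ∀ upsKKT upsHG ups : ℝ,
        P.IsUpsKKT w K upsKKT → P.IsUpsHG S upsHG → ups = max upsU (max upsKKT upsHG) →
        PenaltyCond gamRH (gammaG gamC t upsU) ups eta1 eta2 →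
        delta ≤ eta2 * gammaG gamC t upsU / (9 * eta1 * ups ^ 2) →
        (∀ τ, ∃ j, P.Accepts eta1 eta2 beta theta (w τ) (d τ) j) ∧
        Tendsto (fun τ => ‖P.gradL (w τ)‖) atTop (𝓝 0)) ∧
    -- FOTD
    (∀ mu : ℝ, muBar gamC t upsU ≤ mu →
      ∃ C ρ : ℝ, 0 < C ∧ 0 < ρ ∧ ρ < 1 ∧
      ∀ (nx nu N : ℕ) (_ : 0 < nu) (_ : 0 < N) (P : Problem nx nu N)
          (eta1 eta2 beta theta : ℝ)
          (M : ℕ) (n : Fin (M + 1) → Fin (N + 1)) (b : ℕ)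
          (w d : ℕ → PrimalDual nx nu N) (α : ℕ → ℝ)
          (K : ℕ → BlockHess nx nu N),
        0 < eta1 → 0 < eta2 → beta ∈ Set.Ioo (0 : ℝ) (1 / 2) → theta ∈ Set.Ioo (0 : ℝ) 1 →
        IsKnots n → 1 ≤ b →
        P.IsContDiff 2 →
        (∀ τ, (K τ).IsSymm) →
        state (w 0).fst 0 = P.xbar0 →
        (∀ τ, P.IsFOTDDir (K τ) mu n b (w τ) (d τ)) →
        P.IsRun eta1 eta2 beta theta w d α →
        P.ReducedHessianBound gamRH w K →
        P.Controllable gamC t w →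
        P.UpperBounded upsU w K →
        -- `C` and `ρ` bound the error of the FOTD direction
        (∀ τ newton, P.IsNewtonDir (K τ) (w τ) newton →
          ‖d τ - newton‖ ≤ C * ρ ^ b * ‖newton‖) ∧
        ∀ S : ProdSet nx nu N, P.Compactness upsU S w d →
          (∃ upsKKT, P.IsUpsKKT w K upsKKT) ∧ (∃ upsHG, P.IsUpsHG S upsHG) ∧
          ∀ upsKKT upsHG ups : ℝ,
            P.IsUpsKKT w K upsKKT → P.IsUpsHG S upsHG → ups = max upsU (max upsKKT upsHG) →
            PenaltyCond gamRH (gammaG gamC t upsU) ups eta1 eta2 →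
            Real.log (9 * C * eta1 * ups ^ 2 / (eta2 * gammaG gamC t upsU)) / Real.log (1 / ρ)
              ≤ (b : ℝ) →
            (∀ τ, ∃ j, P.Accepts eta1 eta2 beta theta (w τ) (d τ) j) ∧
            Tendsto (fun τ => ‖P.gradL (w τ)‖) atTop (𝓝 0)) := by
  refine ⟨?_, fun mu hmu => ?_⟩
  · intro nx nu N hnu hN P eta1 eta2 beta theta delta w d newton α K S heta1 heta2 hbeta htheta
      hdelta _ hrun hnewton herr hRH hctrl hup hS
    exact ⟨exists_isUpsKKT (hS.1.mono (by norm_num)) ht hgamC hgamC' hups hgamRH hRH hctrl hup,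
      exists_isUpsHG hS.1 (ProdSet.isCompact_primal hS.2.1 hS.2.2.1)
        (ProdSet.isCompact_dual hS.2.2.2.1),
      fun upsKKT upsHG ups hKKT hHG hupseq hpen hsmall =>
        tendsto_gradL hnu hN ht hgamC hgamC' hups hgamRH heta1 heta2 hbeta htheta hdelta.1.le hrun
          hnewton herr hRH hctrl hup hS hKKT hHG hupseq hpen hsmall⟩
  · have hmu0 : 0 < mu := (muBar_pos t hgamC hups).trans_le hmu
    have hC0 := truncConst_pos t hgamC hups hgamRH hmu0.le
    have hρ0 := decayRate_pos t hgamC hups hgamRH hmu0.le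
    have hρ1 := decayRate_lt_one t hgamC hups hgamRH hmu0.le
    set C := 4 * truncConst gamRH gamC t upsU mu * (upsU + mu) with hC
    set ρ := decayRate gamRH gamC t upsU mu with hρ
    have hCpos : 0 < C := by positivity
    refine ⟨C, ρ, hCpos, hρ0, hρ1, ?_⟩
    intro nx nu N hnu hN P eta1 eta2 beta theta M n b w d α K heta1 heta2 hbeta htheta hn _ hP
      hKs hw0 hd hrun hRH hctrl hup
    have hf : ∀ τ k, DifferentiableAt ℝ (P.f k) ((w τ).fst.fst k) := fun τ k =>
      hP.differentiableAt_f two_ne_zero k _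
    have hstate : ∀ τ, state (w τ).fst 0 = P.xbar0 := state_iterate_zero P hw0
      (fun τ => state_fotd_zero P hN hn (hd τ)) (fun τ => (hrun τ).1)
    have herr : ∀ τ newton, P.IsNewtonDir (K τ) (w τ) newton →
        ‖d τ - newton‖ ≤ C * ρ ^ b * ‖newton‖ := fun τ newton hnewton =>
      norm_sub_newton_le P hN (hKs τ) (hf τ) hnewton
        (state_newton_zero P (hf τ) hnewton (hstate τ)) ht hgamC hgamC' hups hgamRH (hRH τ)
        (hctrl τ) (fun k => ((hup τ).1 k).1) (hup τ).2 (fun k => ((hup τ).1 k).2.1)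
        (fun k => ((hup τ).1 k).2.2) hmu hn (hd τ)
    refine ⟨herr, fun S hS => ⟨exists_isUpsKKT (hP.mono (by norm_num)) ht hgamC hgamC' hups hgamRH
      hRH hctrl hup, exists_isUpsHG hS.1 (ProdSet.isCompact_primal hS.2.1 hS.2.2.1)
        (ProdSet.isCompact_dual hS.2.2.2.1), ?_⟩⟩
    intro upsKKT upsHG ups hKKT hHG hupseq hpen hb
    -- part (i) applies with `δ = C ρ ^ b`
    choose newton hnewton using hKKT.exists_newton
    have hγ0 := gammaG_pos t hgamC hups
    have hups0 : 0 < ups := by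
      have : upsU ≤ ups := by rw [hupseq]; exact le_max_left _ _
      linarith
    refine tendsto_gradL hnu hN ht hgamC hgamC' hups hgamRH heta1 heta2 hbeta htheta
      (by positivity) hrun hnewton (fun τ => herr τ _ (hnewton τ)) hRH hctrl hup hS hKKT hHG hupseq
      hpen (mul_pow_le_of_log_le hCpos hρ0 hρ1 (by positivity) ?_)
    rwa [show C / (eta2 * gammaG gamC t upsU / (9 * eta1 * ups ^ 2))
      = 9 * C * eta1 * ups ^ 2 / (eta2 * gammaG gamC t upsU) by field_simp]
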